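/- Throughout, a knot is an oriented tame knot in $S^3$ (one isotopic to a polygonal knot), considered up to ambient isotopy of $S^3$. A diagram $D$ of a knot is given by a regular projection to the plane of a polygonal knot isotopic to it. If $D$ has at least one crossing, its points can be divided, at points of $D$ that are not crossings, into consecutive closed arcs which are alternately overpasses (arcs containing at least one overcrossing and no undercrossing) and underpasses (arcs containing at least one undercrossing and no overcrossing); the number of overpasses does not depend on the division and is denoted by $l(D)$. If $D$ has no crossing, put $l(D)=0$. For a knot $K$, let $l(K)=\min\{l(D) \mid D \text{ is a diagram of } K\}$ be the minimal number of overpasses (the bridge number of $K$), and let the braid index $b(K)$ be the minimal number of strands of a braid whose closure is isotopic to $K$. **Theorem.** If $K$ is a nontrivial knot, then $l(K)\le b(K)$. -/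

import Mathlib

/-! ## Knots in the 3-sphere -/

/-- Euclidean 3-space. -/
abbrev E3 : Type := EuclideanSpace ℝ (Fin 3)

/-- The 3-sphere, as the one-point compactification of Euclidean 3-space. -/
abbrev S3 : Type := OnePoint E3

/-- An oriented knot in the 3-sphere: a continuous injective map of the circle `ℝ / ℤ`
(an embedding, since the circle is compact); only the image and the direction in which it is
traversed matter, see `Knot.Isotopic`. -/
structure Knot where
  toFun : UnitAddCircle → S3
  continuous_toFun : Continuous toFun
  injective_toFun : Function.Injective toFun

/-- Two oriented knots are isotopic: some ambient isotopy `H` of the 3-sphere carries the first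
onto the second, respecting the orientations. The function `f` is the lift to the real line of an
orientation preserving homeomorphism of the circle `ℝ / ℤ`. -/
def Knot.Isotopic (K L : Knot) : Prop :=
  ∃ H : unitInterval → S3 ≃ₜ S3,
    Continuous (fun p : unitInterval × S3 => H p.1 p.2) ∧
    (∀ x, H 0 x = x) ∧
    ∃ f : ℝ → ℝ, Continuous f ∧ StrictMono f ∧ (∀ t, f (t + 1) = f t + 1) ∧
      ∀ t : ℝ, H 1 (K.toFun (t : UnitAddCircle)) = L.toFun (f t : UnitAddCircle)

/-- The point with coordinates `(Re w, Im w, 0)` in Euclidean 3-space. -/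
noncomputable def planePoint (w : ℂ) : E3 := !₂[w.re, w.im, 0]

/-- The standard unknot: the unit circle of the horizontal coordinate plane, traversed once. -/
noncomputable def unknot : Knot where
  toFun x := ((planePoint (AddCircle.toCircle x : ℂ) : E3) : S3)
  continuous_toFun := by
    refine OnePoint.continuous_coe.comp ?_
    have hc : Continuous fun x : UnitAddCircle => ((AddCircle.toCircle x : Circle) : ℂ) :=
      continuous_subtype_val.comp AddCircle.continuous_toCircle
    unfold planePoint
    refine (PiLp.continuous_toLp 2 _).comp (continuous_pi fun i => ?_)
    fin_cases i
    · exact Complex.continuous_re.comp hc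
    · exact Complex.continuous_im.comp hc
    · exact continuous_const
  injective_toFun := by
    intro x y h
    have h' := OnePoint.coe_injective h
    have h0 := congrArg (fun p : E3 => p 0) h'
    have h1 := congrArg (fun p : E3 => p 1) h'
    simp only [planePoint] at h0 h1
    refine AddCircle.injective_toCircle one_ne_zero (Subtype.ext (Complex.ext ?_ ?_))
    · simpa using h0
    · simpa using h1

/-- A knot is trivial if it is isotopic to the standard unknot. -/
def Knot.IsTrivial (K : Knot) : Prop := K.Isotopic unknot

/-! ## Polygonal knots -/

/-- The polygonal curve through the points `v i`, which runs through the segment from `v i` to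
`v (i + 1)` at unit parameter speed while the parameter runs from `i` to `i + 1`. -/
noncomputable def polygonalCurve (v : ℤ → E3) (t : ℝ) : E3 :=
  AffineMap.lineMap (v ⌊t⌋) (v (⌊t⌋ + 1)) (Int.fract t)

theorem polygonalCurve_of_mem (v : ℤ → E3) (k : ℤ) {t : ℝ} (h0 : (k : ℝ) ≤ t)
    (h1 : t ≤ k + 1) :
    polygonalCurve v t = AffineMap.lineMap (v k) (v (k + 1)) (t - k) := by
  rcases h1.lt_or_eq with h | h
  · have hk : ⌊t⌋ = k := Int.floor_eq_iff.2 ⟨h0, h⟩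
    simp only [polygonalCurve, Int.fract, hk]
  · have hk : ⌊t⌋ = k + 1 := by
      rw [h]; exact_mod_cast Int.floor_intCast (R := ℝ) (k + 1)
    have e0 : Int.fract t = 0 := by
      rw [Int.fract, hk, h]; push_cast; ring
    have e1 : t - k = 1 := by rw [h]; ring
    simp only [polygonalCurve, e0, e1, hk, AffineMap.lineMap_apply_zero,
      AffineMap.lineMap_apply_one]

theorem continuous_polygonalCurve (v : ℤ → E3) : Continuous (polygonalCurve v) := by
  have piece : ∀ k : ℤ, ContinuousOn (polygonalCurve v) (Set.Icc (k : ℝ) (k + 1)) := by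
    intro k
    refine ContinuousOn.congr (f := fun t : ℝ =>
      AffineMap.lineMap (v k) (v (k + 1)) (t - k)) ?_ ?_
    · exact (AffineMap.lineMap_continuous.comp (continuous_id.sub continuous_const)).continuousOn
    · intro t ht
      exact polygonalCurve_of_mem v k ht.1 ht.2
  have hu : ∀ k : ℤ, ContinuousOn (polygonalCurve v) (Set.Icc ((k : ℝ) - 1) (k + 1)) := by
    intro k
    have h1 := piece (k - 1)
    have h2 := piece k
    push_cast at h1
    rw [sub_add_cancel] at h1
    have := h1.union_of_isClosed h2 isClosed_Icc isClosed_Icc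
    rwa [Set.Icc_union_Icc_eq_Icc (by linarith) (by linarith)] at this
  rw [continuous_iff_continuousAt]
  intro t
  rcases (Int.floor_le t).lt_or_eq with h | h
  · exact (piece ⌊t⌋).continuousAt (Icc_mem_nhds h (Int.lt_floor_add_one t))
  · exact (hu ⌊t⌋).continuousAt (Icc_mem_nhds (by linarith) (by linarith))

theorem polygonalCurve_add_period (v : ℤ → E3) (m : ℕ) (hv : ∀ i, v (i + m) = v i) (t : ℝ) :
    polygonalCurve v (t + m) = polygonalCurve v t := by
  have h : ⌊t + (m : ℝ)⌋ = ⌊t⌋ + m := Int.floor_add_natCast t m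
  have h' : ⌊t⌋ + (m : ℤ) + 1 = ⌊t⌋ + 1 + m := by ring
  simp only [polygonalCurve, h, Int.fract_add_natCast, hv, h']

/-- An oriented polygonal knot in Euclidean 3-space: a cyclic sequence of vertices (indexed by the
integers modulo the number of edges) whose closed polygonal curve has no self-intersection. -/
structure PolygonalKnot where
  numEdges : ℕ
  numEdges_pos : 0 < numEdges
  vertex : ℤ → E3
  vertex_periodic : ∀ i, vertex (i + numEdges) = vertex i
  embedded : ∀ s t : ℝ, polygonalCurve vertex s = polygonalCurve vertex t →
    ∃ k : ℤ, t = s + k * numEdges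

namespace PolygonalKnot

/-- The parametrization of a polygonal knot, periodic with period the number of edges. -/
noncomputable def curve (P : PolygonalKnot) : ℝ → E3 := polygonalCurve P.vertex

/-- The underlying set of a polygonal knot. -/
def carrier (P : PolygonalKnot) : Set E3 := Set.range P.curve

theorem periodic_scaled (P : PolygonalKnot) :
    Function.Periodic (fun t : ℝ => ((P.curve (t * P.numEdges) : E3) : S3)) 1 := by
  intro t
  have := polygonalCurve_add_period P.vertex P.numEdges P.vertex_periodic (t * P.numEdges)
  simp only [curve, add_mul, one_mul, this]

/-- A polygonal knot, regarded as an oriented knot in the 3-sphere. -/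
noncomputable def toKnot (P : PolygonalKnot) : Knot where
  toFun := P.periodic_scaled.lift
  continuous_toFun := by
    refine continuous_coinduced_dom.mpr ?_
    exact OnePoint.continuous_coe.comp
      ((continuous_polygonalCurve P.vertex).comp (continuous_id.mul continuous_const))
  injective_toFun := by
    intro x y
    induction x using QuotientAddGroup.induction_on with | _ s
    induction y using QuotientAddGroup.induction_on with | _ t
    intro h
    obtain ⟨k, hk⟩ := P.embedded _ _ (OnePoint.coe_injective h)
    have hm : (P.numEdges : ℝ) ≠ 0 := by exact_mod_cast P.numEdges_pos.ne'
    have hst : t = s + k := by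
      have : t * P.numEdges = (s + k) * P.numEdges := by rw [hk]; ring
      exact mul_right_cancel₀ hm this
    refine (QuotientAddGroup.eq_iff_sub_mem).2 ?_
    refine AddSubgroup.mem_zmultiples_iff.2 ⟨-k, ?_⟩
    rw [hst]; simp

end PolygonalKnot

/-- A knot is tame if it is isotopic to a polygonal knot. -/
def Knot.IsTame (K : Knot) : Prop := ∃ P : PolygonalKnot, K.Isotopic P.toKnot

/-! ## Diagrams and overpasses -/

/-- The orthogonal projection to the horizontal coordinate plane. -/
noncomputable def planeProj (p : E3) : EuclideanSpace ℝ (Fin 2) := !₂[p 0, p 1]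

namespace PolygonalKnot

/-- The multiple points of the projection of a polygonal knot to the plane. -/
def multiplePoints (P : PolygonalKnot) : Set (EuclideanSpace ℝ (Fin 2)) :=
  {q | ∃ a ∈ P.carrier, ∃ b ∈ P.carrier, a ≠ b ∧ planeProj a = q ∧ planeProj b = q}

/-- The projection of a polygonal knot to the plane is regular: it has finitely many multiple
points, these are all double points, and no vertex lies over one of them. (Hence at each double
point two edges cross transversely in interior points.) -/
structure HasRegularProjection (P : PolygonalKnot) : Prop where
  finite_multiplePoints : P.multiplePoints.Finite
  double : ∀ q ∈ P.multiplePoints, {p | p ∈ P.carrier ∧ planeProj p = q}.encard = 2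
  vertex_notMem : ∀ i, planeProj (P.vertex i) ∉ P.multiplePoints

end PolygonalKnot

/-- A knot diagram: a polygonal knot whose projection to the plane is regular. The heights of the
two points over a double point tell the overcrossing from the undercrossing. -/
structure KnotDiagram extends PolygonalKnot where
  regular : toPolygonalKnot.HasRegularProjection

namespace KnotDiagram

/-- `D` is a diagram of the knot `K`. -/
def IsDiagramOf (D : KnotDiagram) (K : Knot) : Prop := K.Isotopic D.toPolygonalKnot.toKnot

/-- The point of the diagram with parameter `t` is an overcrossing: it lies over a double point,
and above the other point over the same double point. -/
def IsOvercrossing (D : KnotDiagram) (t : ℝ) : Prop :=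
  ∃ p ∈ D.carrier, planeProj p = planeProj (D.curve t) ∧ p 2 < D.curve t 2

/-- The point of the diagram with parameter `t` is an undercrossing: it lies over a double point,
and below the other point over the same double point. -/
def IsUndercrossing (D : KnotDiagram) (t : ℝ) : Prop :=
  ∃ p ∈ D.carrier, planeProj p = planeProj (D.curve t) ∧ D.curve t 2 < p 2

/-- The diagram has an over-underpass sequence `s 1, f 1, ..., s k, f k`, given by parameters.
For `k > 0` the sequence is continued to all integer indices, so that raising the index by `k`
means one full turn along the knot; the arcs `[s i, f i]` are the overpasses, the arcs
`[f i, s (i + 1)]` the underpasses. The empty sequence, `k = 0`, belongs to a diagram without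
crossings. -/
def HasOverUnderpassSequence (D : KnotDiagram) (k : ℕ) : Prop :=
  (k = 0 ∧ ∀ t, ¬ D.IsOvercrossing t ∧ ¬ D.IsUndercrossing t) ∨
  (0 < k ∧ ∃ s f : ℤ → ℝ,
    (∀ i, s i < f i ∧ f i < s (i + 1)) ∧
    (∀ i, s (i + k) = s i + D.numEdges ∧ f (i + k) = f i + D.numEdges) ∧
    (∀ i, ¬ D.IsOvercrossing (s i) ∧ ¬ D.IsUndercrossing (s i)) ∧
    (∀ i, ¬ D.IsOvercrossing (f i) ∧ ¬ D.IsUndercrossing (f i)) ∧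
    (∀ i, (∃ t ∈ Set.Icc (s i) (f i), D.IsOvercrossing t) ∧
      ∀ t ∈ Set.Icc (s i) (f i), ¬ D.IsUndercrossing t) ∧
    (∀ i, (∃ t ∈ Set.Icc (f i) (s (i + 1)), D.IsUndercrossing t) ∧
      ∀ t ∈ Set.Icc (f i) (s (i + 1)), ¬ D.IsOvercrossing t))

/-- The number `l(D)` of overpasses of a diagram: the length of its over-underpass sequences
(which all have the same length). -/
noncomputable def overpassNumber (D : KnotDiagram) : ℕ∞ :=
  ⨅ (k : ℕ) (_ : D.HasOverUnderpassSequence k), (k : ℕ∞)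

end KnotDiagram

/-- The number `l(K)`: the minimal number of overpasses of the diagrams of `K`. -/
noncomputable def Knot.overpassNumber (K : Knot) : ℕ∞ :=
  ⨅ (D : KnotDiagram) (_ : D.IsDiagramOf K), D.overpassNumber

/-! ## Closed braids and the braid index -/

/-- The half-plane bounded by the third coordinate axis whose points have polar angle `θ`. -/
def page (θ : ℝ) : Set E3 := {p | ∃ r : ℝ, 0 < r ∧ p 0 = r * Real.cos θ ∧ p 1 = r * Real.sin θ}

/-- A polygonal knot is a closed braid on `n` strands with the third coordinate axis as its axis:
it winds strictly counterclockwise around the axis (every edge is seen from it under a positive angle less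
than `π`), and it meets every half-plane bounded by the axis in exactly `n` points. Cut open
along such a half-plane, it becomes a braid on `n` strands, of which it is the closure. -/
def PolygonalKnot.IsClosedBraid (P : PolygonalKnot) (n : ℕ) : Prop :=
  (∀ i, 0 < P.vertex i 0 * P.vertex (i + 1) 1 - P.vertex i 1 * P.vertex (i + 1) 0) ∧
  ∀ θ : ℝ, (P.carrier ∩ page θ).encard = n

/-- The braid index `b(K)`: the minimal number of strands of the closed braids isotopic
to `K`. -/
noncomputable def Knot.braidIndex (K : Knot) : ℕ∞ :=
  ⨅ (n : ℕ) (_ : ∃ P : PolygonalKnot, K.Isotopic P.toKnot ∧ P.IsClosedBraid n), (n : ℕ∞)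

/-!
The theorem follows from a construction which turns a closed braid on `n` strands into a diagram
with at most `n` overpasses.

Cut the closed braid by a plane containing its axis, `y = 0` say. In each of the two half-spaces,
the strands run from one half-plane bounded by the axis to the opposite one, always in the same
direction around the axis; so each half-space contains a trivial tangle. More precisely, the
strands describe a motion of finitely many points in the half-plane, which extends to an isotopy of
the half-plane (`exists_isotopy_extending_motion`). Undoing this isotopy straightens the strands
on both sides at the price of a homeomorphism of one half-plane, the monodromy `G` of the braid. It
is absorbed by moving all layers parallel to the plane `y = 0` in the half-space `y ≤ 0` by `G`.
What results is a knot (`IsStraightened`) whose arcs in `y ≥ 0` project along the `y`-axis to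
disjoint parallel segments, and whose arcs in `y ≤ 0` project to images of such segments under the
homeomorphism `G`, which are disjoint and simple as well (`exists_straightening`). All crossings
are crossings of an arc in `y ≥ 0` over an arc in `y ≤ 0`, and there are as many arcs of either kind
as the braid has turns around the axis.

The isotopy of the half-plane consists of piecewise affine maps, and the circles around the axis
are replaced by squares, so that the straightened knot is polygonal. The lower arcs are finally
put in general position (`IsStraightened.exists_generic`), and the projection then is
regular (`PolygonalKnot.exists_diagram_of_straightened`). The arcs form an alternating sequence of
arcs without undercrossings and arcs without overcrossings, and by merging arcs without any
crossing it becomes a sequence of overpasses and underpasses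
(`KnotDiagram.overpassNumber_le_of_isAlternatingDivision`).

All the homeomorphisms of Euclidean space used here are the identity outside a ball, and by the
Alexander trick they come from ambient isotopies (`Knot.Isotopic.of_bijection`).
-/

/-! ### Compactly supported homeomorphisms and ambient isotopies -/

/-- A continuous bijection of a normed space which is the identity outside some ball. -/
structure IsCompactlySupportedBijection {E : Type*} [NormedAddCommGroup E] (f : E → E) : Prop where
  continuous : Continuous f
  bijective : Function.Bijective f
  exists_radius : ∃ R : ℝ, ∀ x, R ≤ ‖x‖ → f x = x

theorem IsCompactlySupportedBijection.comp {E : Type*} [NormedAddCommGroup E] {f g : E → E}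
    (hf : IsCompactlySupportedBijection f) (hg : IsCompactlySupportedBijection g) :
    IsCompactlySupportedBijection (f ∘ g) := by
  obtain ⟨R, hR⟩ := hf.exists_radius
  obtain ⟨R', hR'⟩ := hg.exists_radius
  refine ⟨hf.continuous.comp hg.continuous, hf.bijective.comp hg.bijective, max R R', ?_⟩
  intro x hx
  simp only [Function.comp, hR' x ((le_max_right _ _).trans hx), hR x ((le_max_left _ _).trans hx)]

/-- The displacement of a compactly supported bijection of a finite dimensional space is
bounded. -/
theorem IsCompactlySupportedBijection.exists_bound {E : Type*} [NormedAddCommGroup E]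
    [ProperSpace E] {f : E → E} (hf : IsCompactlySupportedBijection f) :
    ∃ C : ℝ, 0 ≤ C ∧ ∀ x, ‖f x - x‖ ≤ C := by
  obtain ⟨R, hR⟩ := hf.exists_radius
  obtain ⟨C, hC⟩ := (isCompact_closedBall (0 : E) R).exists_bound_of_continuousOn
    (f := fun x => f x - x) (hf.continuous.sub continuous_id).continuousOn
  refine ⟨max C 0, le_max_right _ _, fun x => ?_⟩
  rcases le_total R ‖x‖ with h | h
  · simp [hR x h]
  · exact (hC x (by simpa using h)).trans (le_max_left _ _)

/-- The Alexander trick: the stage `s` of the isotopy from the identity to `f`. For `s > 0` this is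
`f` conjugated by the homothety with factor `s`, for `s = 0` it is the identity. -/
noncomputable def alexanderStage (f : E3 → E3) (s : ℝ) (x : E3) : E3 :=
  x + s • (f (s⁻¹ • x) - s⁻¹ • x)

theorem alexanderStage_zero (f : E3 → E3) (x : E3) : alexanderStage f 0 x = x := by
  simp [alexanderStage]

theorem alexanderStage_of_ne {f : E3 → E3} {s : ℝ} (hs : s ≠ 0) (x : E3) :
    alexanderStage f s x = s • f (s⁻¹ • x) := by
  simp [alexanderStage, smul_sub, smul_smul, hs]

theorem bijective_alexanderStage {f : E3 → E3} (hf : Function.Bijective f) (s : ℝ) :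
    Function.Bijective (alexanderStage f s) := by
  rcases eq_or_ne s 0 with rfl | hs
  · have : alexanderStage f 0 = id := funext (alexanderStage_zero f)
    rw [this]; exact Function.bijective_id
  · have : alexanderStage f s = (fun x => s • x) ∘ f ∘ (fun x => s⁻¹ • x) :=
      funext (alexanderStage_of_ne hs)
    rw [this]
    exact (MulAction.bijective₀ hs).comp (hf.comp (MulAction.bijective₀ (inv_ne_zero hs)))

theorem alexanderStage_of_le {f : E3 → E3} {R : ℝ} (hR : ∀ x, R ≤ ‖x‖ → f x = x) {s : ℝ}
    (h0 : 0 ≤ s) (h1 : s ≤ 1) {x : E3} (hx : R ≤ ‖x‖) : alexanderStage f s x = x := by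
  rcases h0.eq_or_lt with rfl | hs
  · exact alexanderStage_zero f x
  · have : f (s⁻¹ • x) = s⁻¹ • x := by
      refine hR _ ?_
      rw [norm_smul, norm_inv, Real.norm_of_nonneg h0]
      exact hx.trans (le_mul_of_one_le_left (norm_nonneg x) ((one_le_inv₀ hs).2 h1))
    simp [alexanderStage, this]

theorem continuous_alexanderStage {f : E3 → E3} (hf : IsCompactlySupportedBijection f) :
    Continuous fun p : unitInterval × E3 => alexanderStage f p.1 p.2 := by
  obtain ⟨C, hC0, hC⟩ := hf.exists_bound
  rw [continuous_iff_continuousAt]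
  rintro ⟨s, x⟩
  by_cases hs : (s : ℝ) = 0
  · -- near `s = 0` the displacement is at most `s * C`
    have hfst : Filter.Tendsto (fun p : unitInterval × E3 => (p.1 : ℝ)) (nhds (s, x)) (nhds 0) := by
      rw [← hs]; exact (continuous_subtype_val.comp continuous_fst).continuousAt
    have hd : Filter.Tendsto (fun p : unitInterval × E3 =>
        (p.1 : ℝ) • (f ((p.1 : ℝ)⁻¹ • p.2) - (p.1 : ℝ)⁻¹ • p.2)) (nhds (s, x)) (nhds 0) := by
      refine squeeze_zero_norm (a := fun p : unitInterval × E3 => (p.1 : ℝ) * C) (fun p => ?_) ?_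
      · rw [norm_smul, Real.norm_of_nonneg p.1.2.1]
        exact mul_le_mul_of_nonneg_left (hC _) p.1.2.1
      · simpa using hfst.mul_const C
    have := (continuous_snd.continuousAt (x := (s, x))).tendsto.add hd
    simpa [ContinuousAt, alexanderStage, hs] using this
  · have h1 : ContinuousAt (fun p : unitInterval × E3 => (p.1 : ℝ)) (s, x) :=
      (continuous_subtype_val.comp continuous_fst).continuousAt
    have h2 : ContinuousAt (fun p : unitInterval × E3 => (p.1 : ℝ)⁻¹ • p.2) (s, x) :=
      (h1.inv₀ hs).smul continuous_snd.continuousAt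
    exact continuous_snd.continuousAt.add
      (h1.smul ((hf.continuous.continuousAt.comp h2).sub h2))

/-- A homeomorphism of the 3-sphere from a bijection of Euclidean space that is continuous after
fixing the point at infinity. -/
noncomputable def sphereHomeomorph (g : E3 → E3) (hg : Function.Bijective g)
    (hc : Continuous (OnePoint.map g)) : S3 ≃ₜ S3 :=
  Continuous.homeoOfEquivCompactToT2 (f := Equiv.ofBijective (OnePoint.map g) (by
    constructor
    · exact Option.map_injective hg.1
    · rintro (_ | y)
      · exact ⟨OnePoint.infty, rfl⟩
      · obtain ⟨x, rfl⟩ := hg.2 y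
        exact ⟨(x : S3), rfl⟩)) hc

theorem continuous_map_alexanderStage {f : E3 → E3} (hf : IsCompactlySupportedBijection f) :
    Continuous fun p : unitInterval × S3 => (OnePoint.map (alexanderStage f p.1) p.2 : S3) := by
  obtain ⟨R, hR⟩ := hf.exists_radius
  rw [continuous_iff_continuousAt]
  rintro ⟨s, x⟩
  induction x using OnePoint.rec with
  | infty =>
    have hopen : IsOpen (((↑) '' Metric.closedBall (0 : E3) R : Set S3)ᶜ) :=
      OnePoint.isOpen_compl_image_coe.2
        ⟨Metric.isClosed_closedBall, isCompact_closedBall _ _⟩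
    have hmem : ((↑) '' Metric.closedBall (0 : E3) R : Set S3)ᶜ ∈ nhds (OnePoint.infty : S3) :=
      hopen.mem_nhds (OnePoint.infty_notMem_image_coe)
    refine ContinuousAt.congr (f := fun p : unitInterval × S3 => p.2) continuous_snd.continuousAt ?_
    filter_upwards [continuous_snd.continuousAt.preimage_mem_nhds
      (show _ ∈ nhds ((s, (OnePoint.infty : S3)).2) from hmem)] with p hp
    obtain ⟨t, y⟩ := p
    induction y using OnePoint.rec with
    | infty => rfl
    | coe y =>
      have : R ≤ ‖y‖ := by
        by_contra h
        exact hp ⟨y, by simpa using (not_le.1 h).le, rfl⟩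
      simp [alexanderStage_of_le hR t.2.1 t.2.2 this]
  | coe x =>
    have hemb : Topology.IsOpenEmbedding
        (Prod.map id (↑) : unitInterval × E3 → unitInterval × S3) :=
      Topology.IsOpenEmbedding.id.prodMap OnePoint.isOpenEmbedding_coe
    have := hemb.continuousAt_iff (x := (s, x))
      (g := fun p : unitInterval × S3 => (OnePoint.map (alexanderStage f p.1) p.2 : S3))
    refine this.1 ?_
    exact (OnePoint.continuous_coe.comp (continuous_alexanderStage hf)).continuousAt

/-- A compactly supported homeomorphism of Euclidean space that carries one knot to another one
gives an ambient isotopy between them. -/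
theorem Knot.Isotopic.of_bijection {K L : Knot} {h : E3 → E3}
    (hh : IsCompactlySupportedBijection h) (f : ℝ → ℝ) (hf : Continuous f) (hmono : StrictMono f)
    (hper : ∀ t, f (t + 1) = f t + 1)
    (hKL : ∀ t : ℝ, OnePoint.map h (K.toFun (t : UnitAddCircle)) =
      L.toFun (f t : UnitAddCircle)) : K.Isotopic L := by
  have hc := continuous_map_alexanderStage hh
  refine ⟨fun s => sphereHomeomorph (alexanderStage h s) (bijective_alexanderStage hh.bijective s)
    (hc.comp (Continuous.prodMk_right s)), hc, ?_, f, hf, hmono, hper, ?_⟩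
  · intro x
    change OnePoint.map (alexanderStage h ((0 : unitInterval) : ℝ)) x = x
    have : alexanderStage h ((0 : unitInterval) : ℝ) = id := funext (alexanderStage_zero h)
    rw [this]; exact congrFun OnePoint.map_id x
  · intro t
    have : alexanderStage h ((1 : unitInterval) : ℝ) = h := funext fun x => by
      simp [alexanderStage]
    rw [← hKL]
    change OnePoint.map (alexanderStage h ((1 : unitInterval) : ℝ)) _ = _
    rw [this]

theorem Knot.Isotopic.trans {K L M : Knot} (h : K.Isotopic L) (h' : L.Isotopic M) :
    K.Isotopic M := by
  obtain ⟨H, hH, hH0, f, hf, hfm, hfp, hfK⟩ := h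
  obtain ⟨G, hG, hG0, g, hg, hgm, hgp, hgL⟩ := h'
  refine ⟨fun s => (H s).trans (G s), hG.comp (continuous_fst.prodMk hH), fun x => ?_,
    g ∘ f, hg.comp hf, hgm.comp hfm, fun t => ?_, fun t => ?_⟩
  · simp [hH0, hG0]
  · simp [hfp, hgp]
  · simp only [Homeomorph.trans_apply, Function.comp, hfK, hgL]

/-- A continuous bijection of a finite dimensional normed space is a homeomorphism if it does not
decrease the norms of points of large norm. -/
theorem continuous_symm_of_norm_le {E : Type*} [NormedAddCommGroup E] [ProperSpace E]
    (e : E ≃ E) (he : Continuous e) (R : ℝ) (hR : ∀ x, ‖x‖ ≤ max R ‖e x‖) :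
    Continuous e.symm := by
  have hproper : IsProperMap e := by
    rw [isProperMap_iff_tendsto_cocompact]
    refine ⟨he, ?_⟩
    rw [← Metric.cobounded_eq_cocompact]
    rw [← tendsto_norm_atTop_iff_cobounded]
    rw [Filter.tendsto_atTop]
    intro b
    have := (tendsto_norm_cobounded_atTop (E := E)).eventually (Filter.eventually_gt_atTop (max R b))
    filter_upwards [this] with x hx
    rcases le_max_iff.1 (hR x) with h | h
    · exact absurd (hx.trans_le h) (not_lt.2 (le_max_left _ _))
    · exact (le_max_right _ _).trans (hx.le.trans h)
  exact (e.toHomeomorphOfContinuousClosed he hproper.isClosedMap).symm.continuous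

/-! ### Counting overpasses -/

/-- A division of a closed curve with parameter period `T` into `k` arcs `[s i, f i]` avoiding
the set `U` which alternate with `k` arcs `[f i, s (i + 1)]` avoiding the set `O`. Other than in
`KnotDiagram.HasOverUnderpassSequence`, arcs without any crossing are allowed. -/
structure IsAlternatingDivision (O U : ℝ → Prop) (T : ℝ) (k : ℕ) (s f : ℤ → ℝ) : Prop where
  lt : ∀ i, s i < f i ∧ f i < s (i + 1)
  periodic : ∀ i, s (i + k) = s i + T ∧ f (i + k) = f i + T
  avoids_U : ∀ i, ∀ t ∈ Set.Icc (s i) (f i), ¬ U t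
  avoids_O : ∀ i, ∀ t ∈ Set.Icc (f i) (s (i + 1)), ¬ O t

theorem add_mul_of_periodic {a : ℤ → ℝ} {T : ℝ} {k : ℤ} (h : ∀ i, a (i + k) = a i + T)
    (i q : ℤ) : a (i + q * k) = a i + q * T := by
  induction q using Int.induction_on with
  | zero => simp
  | succ n ih =>
    have := h (i + n * k)
    rw [ih] at this
    rw [add_mul, one_mul, ← add_assoc, this]; push_cast; ring
  | pred n ih =>
    have := h (i + (-n - 1) * k)
    rw [show i + (-(n : ℤ) - 1) * k + k = i + -n * k by ring, ih] at this
    push_cast at this ⊢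
    linarith

theorem iff_add_mul_of_periodic {A : ℝ → Prop} {T : ℝ} (h : ∀ t, A (t + T) ↔ A t) (t : ℝ)
    (q : ℤ) : A (t + q * T) ↔ A t := by
  induction q using Int.induction_on with
  | zero => simp
  | succ n ih => rw [← ih, ← h (t + (n : ℤ) * T)]; push_cast; ring_nf
  | pred n ih => rw [← ih, ← h]; push_cast; ring_nf

namespace IsAlternatingDivision

variable {O U : ℝ → Prop} {T : ℝ} {k : ℕ} {s f : ℤ → ℝ}

/-- Exchange of the roles of the two kinds of arcs. -/
theorem swap (h : IsAlternatingDivision O U T k s f) :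
    IsAlternatingDivision U O T k f (fun i => s (i + 1)) where
  lt i := ⟨(h.lt i).2, (h.lt (i + 1)).1⟩
  periodic i := ⟨(h.periodic i).2, by
    rw [show i + (k : ℤ) + 1 = i + 1 + k by ring]; exact (h.periodic (i + 1)).1⟩
  avoids_U := h.avoids_O
  avoids_O i := h.avoids_U (i + 1)

theorem shift (h : IsAlternatingDivision O U T k s f) (j : ℤ) :
    IsAlternatingDivision O U T k (fun i => s (i + j)) (fun i => f (i + j)) where
  lt i := by
    have := h.lt (i + j)
    rwa [show i + 1 + j = i + j + 1 by ring]
  periodic i := by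
    rw [show i + (k : ℤ) + j = i + j + k by ring]; exact h.periodic (i + j)
  avoids_U i := h.avoids_U (i + j)
  avoids_O i := by
    rw [show i + 1 + j = i + j + 1 by ring]; exact h.avoids_O (i + j)

/-- If one of at least two arcs avoiding `U` avoids `O`, too, it can be merged with its two
neighbours. The remaining arcs are those whose index is not a multiple of `m + 1`. -/
theorem merge {m : ℕ} (hm : 0 < m) (h : IsAlternatingDivision O U T (m + 1) s f)
    (hO : ∀ t, O (t + T) ↔ O t) (h0 : ∀ t ∈ Set.Icc (s 0) (f 0), ¬ O t) :
    IsAlternatingDivision O U T m (fun j => s (j + j / m + 1)) (fun j => f (j + j / m + 1)) := by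
  have hm0 : (m : ℤ) ≠ 0 := by exact_mod_cast hm.ne'
  have hmpos : (0 : ℤ) < m := by exact_mod_cast hm
  have hfree : ∀ q : ℤ, ∀ t ∈ Set.Icc (s ((m + 1) * q)) (f ((m + 1) * q)), ¬ O t := by
    intro q t ht
    have e1 := add_mul_of_periodic (fun i => (h.periodic i).1) 0 q
    have e2 := add_mul_of_periodic (fun i => (h.periodic i).2) 0 q
    push_cast at e1 e2
    rw [zero_add, mul_comm q] at e1 e2
    rw [e1, e2] at ht
    have := (iff_add_mul_of_periodic hO (t - q * T) q)
    rw [sub_add_cancel] at this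
    rw [this]
    exact h0 _ ⟨by linarith [ht.1], by linarith [ht.2]⟩
  have hstep : ∀ j : ℤ, (j + 1) / (m : ℤ) = j / m ∨
      ((j + 1) / (m : ℤ) = j / m + 1 ∧ j + j / m + 1 + 1 = (m + 1) * (j / m + 1)) := by
    intro j
    have d1 := Int.mul_ediv_add_emod j m
    have r1 := Int.emod_nonneg j hm0
    have r2 := Int.emod_lt_of_pos j hmpos
    rcases (show j % m + 1 < m ∨ j % m + 1 = m by omega) with hr | hr
    · left
      rw [show j + 1 = (j % m + 1) + m * (j / m) by linarith, Int.add_mul_ediv_left _ _ hm0,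
        Int.ediv_eq_zero_of_lt (by omega) hr, zero_add]
    · right
      have hj : j + 1 = m * (j / m + 1) := by linarith
      refine ⟨?_, ?_⟩
      · conv_lhs => rw [hj]
        exact Int.mul_ediv_cancel_left _ hm0
      · linarith
  refine ⟨fun j => ⟨(h.lt _).1, ?_⟩, fun j => ?_, fun j => h.avoids_U _, fun j => ?_⟩
  · rcases hstep j with e | ⟨e, -⟩
    · rw [e, show j + 1 + j / m + 1 = j + j / m + 1 + 1 by ring]
      exact (h.lt _).2
    · rw [e, show j + 1 + (j / m + 1) + 1 = j + j / m + 1 + 1 + 1 by ring]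
      exact (h.lt _).2.trans ((h.lt _).1.trans (h.lt _).2)
  · have : j + (m : ℤ) + (j + m) / m + 1 = j + j / m + 1 + ((m + 1 : ℕ) : ℤ) := by
      rw [Int.add_ediv_of_dvd_right (dvd_refl _), Int.ediv_self hm0]; push_cast; ring
    simp only [this]
    exact h.periodic _
  · intro t ht
    rcases hstep j with e | ⟨e, e'⟩
    · rw [e, show j + 1 + j / m + 1 = j + j / m + 1 + 1 by ring] at ht
      exact h.avoids_O _ t ht
    · rw [e, show j + 1 + (j / m + 1) + 1 = j + j / m + 1 + 1 + 1 by ring] at ht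
      rcases le_total t (s (j + j / m + 1 + 1)) with h1 | h1
      · exact h.avoids_O _ t ⟨ht.1, h1⟩
      rcases le_total t (f (j + j / m + 1 + 1)) with h2 | h2
      · exact hfree (j / m + 1) t (by rw [← e']; exact ⟨h1, h2⟩)
      · exact h.avoids_O _ t ⟨h2, ht.2⟩

theorem exists_mem_Icc (h : IsAlternatingDivision O U T k s f) (hT : 0 < T) (t : ℝ) :
    ∃ i, s i ≤ t ∧ t ≤ s (i + 1) := by
  have hmono : StrictMono s := strictMono_int_of_lt_succ fun i => (h.lt i).1.trans (h.lt i).2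
  have hval : ∀ q : ℤ, s (q * k) = s 0 + q * T := fun q => by
    simpa using add_mul_of_periodic (fun i => (h.periodic i).1) 0 q
  obtain ⟨q, hq⟩ := exists_int_gt ((t - s 0) / T)
  obtain ⟨q', hq'⟩ := exists_int_lt ((t - s 0) / T)
  rw [div_lt_iff₀ hT] at hq
  rw [lt_div_iff₀ hT] at hq'
  obtain ⟨i, hi, hmax⟩ := Int.exists_greatest_of_bdd (P := fun i => s i ≤ t)
    ⟨q * k, fun z hz => (hmono.lt_iff_lt.1 (hz.trans_lt (by rw [hval]; linarith))).le⟩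
    ⟨q' * k, by rw [hval]; linarith⟩
  refine ⟨i, hi, ?_⟩
  by_contra hlt
  have := hmax (i + 1) (not_le.1 hlt).le
  omega

/-- If an arc avoiding `U` avoids `O`, too, then there is a division into fewer arcs, or `O` is
empty. -/
theorem exists_shorter (h : IsAlternatingDivision O U T k s f) (hk : 0 < k) (hT : 0 < T)
    (hO : ∀ t, O (t + T) ↔ O t) {j : ℤ} (hj : ∀ t ∈ Set.Icc (s j) (f j), ¬ O t) :
    (∀ t, ¬ O t) ∨ ∃ m, 0 < m ∧ m < k ∧ ∃ s' f', IsAlternatingDivision O U T m s' f' := by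
  obtain ⟨m, rfl⟩ : ∃ m, k = m + 1 := ⟨k - 1, by omega⟩
  rcases Nat.eq_zero_or_pos m with rfl | hm
  · left
    intro t
    obtain ⟨i, h1, h2⟩ := h.exists_mem_Icc hT t
    rcases le_total t (f i) with h3 | h3
    · have e1 := add_mul_of_periodic (fun i => (h.periodic i).1) j (i - j)
      have e2 := add_mul_of_periodic (fun i => (h.periodic i).2) j (i - j)
      have := iff_add_mul_of_periodic hO (t - (i - j : ℤ) * T) (i - j)
      rw [sub_add_cancel] at this
      rw [this]
      simp only [zero_add, Nat.cast_one, mul_one, add_sub_cancel] at e1 e2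
      exact hj _ ⟨by linarith, by linarith⟩
    · exact h.avoids_O i t ⟨h3, h2⟩
  · right
    exact ⟨m, hm, Nat.lt_succ_self m, _, _,
      (h.shift j).merge hm hO (by simpa using hj)⟩

end IsAlternatingDivision

namespace KnotDiagram

theorem curve_add_numEdges (D : KnotDiagram) (t : ℝ) :
    D.curve (t + D.numEdges) = D.curve t :=
  polygonalCurve_add_period D.vertex D.numEdges D.vertex_periodic t

/-- A division of a diagram into `k` arcs without undercrossings and `k` arcs without
overcrossings bounds the number of overpasses: as long as some arc has no crossing at all, the
number of arcs can be reduced. -/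
theorem overpassNumber_le_of_isAlternatingDivision (D : KnotDiagram) {k : ℕ} (hk : 0 < k)
    {s f : ℤ → ℝ}
    (h : IsAlternatingDivision D.IsOvercrossing D.IsUndercrossing D.numEdges k s f) :
    D.overpassNumber ≤ k := by
  have hT : (0 : ℝ) < D.numEdges := by exact_mod_cast D.numEdges_pos
  have hO : ∀ t, D.IsOvercrossing (t + D.numEdges) ↔ D.IsOvercrossing t := fun t => by
    simp only [IsOvercrossing, curve_add_numEdges]
  have hU : ∀ t, D.IsUndercrossing (t + D.numEdges) ↔ D.IsUndercrossing t := fun t => by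
    simp only [IsUndercrossing, curve_add_numEdges]
  have hOU : (∀ t, ¬ D.IsOvercrossing t) ↔ (∀ t, ¬ D.IsUndercrossing t) := by
    constructor
    · rintro h t ⟨_, ⟨t', rfl⟩, h1, h2⟩
      exact h t' ⟨_, ⟨t, rfl⟩, h1.symm, h2⟩
    · rintro h t ⟨_, ⟨t', rfl⟩, h1, h2⟩
      exact h t' ⟨_, ⟨t, rfl⟩, h1.symm, h2⟩
  induction k using Nat.strong_induction_on generalizing s f with
  | _ k ih =>
  have hle : ∀ m, D.HasOverUnderpassSequence m → m ≤ k → D.overpassNumber ≤ k := fun m hm hmk =>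
    (iInf₂_le m hm).trans (by exact_mod_cast hmk)
  by_cases hnone : ∀ t, ¬ D.IsOvercrossing t
  · exact hle 0 (Or.inl ⟨rfl, fun t => ⟨hnone t, hOU.1 hnone t⟩⟩) (Nat.zero_le k)
  by_cases h1 : ∃ j, ∀ t ∈ Set.Icc (s j) (f j), ¬ D.IsOvercrossing t
  · obtain ⟨j, hj⟩ := h1
    rcases h.exists_shorter hk hT hO hj with h' | ⟨m, hm, hmk, s', f', h'⟩
    · exact absurd h' hnone
    · exact (ih m hmk hm h').trans (by exact_mod_cast hmk.le)
  by_cases h2 : ∃ j, ∀ t ∈ Set.Icc (f j) (s (j + 1)), ¬ D.IsUndercrossing t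
  · obtain ⟨j, hj⟩ := h2
    rcases h.swap.exists_shorter hk hT hU hj with h' | ⟨m, hm, hmk, s', f', h'⟩
    · exact absurd (hOU.2 h') hnone
    · exact (ih m hmk hm h'.swap).trans (by exact_mod_cast hmk.le)
  push Not at h1 h2
  refine hle k (Or.inr ⟨hk, s, f, h.lt, h.periodic, fun i => ⟨?_, ?_⟩, fun i => ⟨?_, ?_⟩,
    fun i => ⟨h1 i, h.avoids_U i⟩, fun i => ⟨h2 i, h.avoids_O i⟩⟩) le_rfl
  · have := h.avoids_O (i - 1) (s i)
    rw [sub_add_cancel] at this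
    exact this ⟨by simpa using (h.lt (i - 1)).2.le, le_rfl⟩
  · exact h.avoids_U i _ ⟨le_rfl, (h.lt i).1.le⟩
  · exact h.avoids_O i _ ⟨le_rfl, (h.lt i).2.le⟩
  · exact h.avoids_U i _ ⟨(h.lt i).1.le, le_rfl⟩

end KnotDiagram

/-! ### Polar angles of curves winding around the axis -/

/-- The horizontal part of a point of Euclidean space, as a complex number. -/
def horizontal (p : E3) : ℂ := ⟨p 0, p 1⟩

theorem continuous_horizontal : Continuous horizontal := by
  have h : horizontal = fun p : E3 => ((p 0 : ℝ) : ℂ) + ((p 1 : ℝ) : ℂ) * Complex.I := by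
    funext p
    exact Complex.ext (by simp [horizontal]) (by simp [horizontal])
  rw [h]
  fun_prop

/-- The determinant of the horizontal parts of two points; if it is positive, the second one is
seen from the axis at an angle between `0` and `π` from the first. -/
def horizontalCross (p q : E3) : ℝ := p 0 * q 1 - p 1 * q 0

theorem horizontalCross_lineMap (p q : E3) (s t : ℝ) :
    horizontalCross (AffineMap.lineMap p q s) (AffineMap.lineMap p q t) =
      (t - s) * horizontalCross p q := by
  simp [horizontalCross, AffineMap.lineMap_apply]
  ring

theorem horizontal_ne_zero_of_cross {p q : E3} (h : 0 < horizontalCross p q) :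
    horizontal p ≠ 0 := by
  intro h0
  have h1 : p 0 = 0 := congrArg Complex.re h0
  have h2 : p 1 = 0 := congrArg Complex.im h0
  simp [horizontalCross, h1, h2] at h

/-- The winding condition on an edge, for all pairs of its points. -/
theorem horizontalCross_polygonalCurve_pos {v : ℤ → E3}
    (hv : ∀ i, 0 < horizontalCross (v i) (v (i + 1))) {k : ℤ} {s t : ℝ} (hs : k ≤ s) (hst : s < t)
    (ht : t ≤ k + 1) : 0 < horizontalCross (polygonalCurve v s) (polygonalCurve v t) := by
  rw [polygonalCurve_of_mem v k hs (hst.le.trans ht), polygonalCurve_of_mem v k (hs.trans hst.le) ht,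
    horizontalCross_lineMap]
  exact mul_pos (by linarith) (hv k)

theorem horizontal_polygonalCurve_ne_zero {v : ℤ → E3}
    (hv : ∀ i, 0 < horizontalCross (v i) (v (i + 1))) (t : ℝ) :
    horizontal (polygonalCurve v t) ≠ 0 :=
  horizontal_ne_zero_of_cross (q := v (⌊t⌋ + 1)) (by
    have h := horizontalCross_lineMap (v ⌊t⌋) (v (⌊t⌋ + 1)) (Int.fract t) 1
    rw [AffineMap.lineMap_apply_one] at h
    rw [polygonalCurve, h]
    exact mul_pos (sub_pos.2 (Int.fract_lt_one t)) (hv _))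

theorem exists_continuous_angle {w : ℝ → ℂ} (hw : Continuous w) (h0 : ∀ t, w t ≠ 0) :
    ∃ θ : ℝ → ℝ, Continuous θ ∧ ∀ t, w t = ‖w t‖ * Complex.exp (θ t * Complex.I) := by
  let g : ℝ → Circle := fun t => ⟨w t / ‖w t‖, by simp [Submonoid.unitSphere, h0 t]⟩
  have hg : Continuous g := by
    refine Continuous.subtype_mk (hw.div (by fun_prop) fun t => ?_) _
    simpa using h0 t
  obtain ⟨e, he⟩ := Circle.exp_surjective (g 0)
  obtain ⟨F, ⟨-, hF⟩, -⟩ :=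
    Circle.isCoveringMap_exp.existsUnique_continuousMap_lifts ⟨g, hg⟩ 0 e he
  refine ⟨F, F.continuous, fun t => ?_⟩
  have h1 : Circle.exp (F t) = g t := congrFun hF t
  have h2 : Complex.exp (F t * Complex.I) = w t / ‖w t‖ := by
    rw [← Circle.coe_exp, h1]
  have h3 : (‖w t‖ : ℂ) ≠ 0 := by simpa using h0 t
  rw [h2, mul_div_cancel₀ _ h3]

theorem strictMono_of_strictMonoOn_Icc_int {θ : ℝ → ℝ}
    (h : ∀ k : ℤ, StrictMonoOn θ (Set.Icc (k : ℝ) (k + 1))) : StrictMono θ := by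
  have hz : StrictMono fun k : ℤ => θ k := strictMono_int_of_lt_succ fun k => by
    have := h k ⟨le_rfl, by linarith⟩ ⟨by linarith, le_rfl⟩ (show (k : ℝ) < k + 1 by linarith)
    simpa using this
  intro s t hst
  have hs0 := Int.floor_le s
  have hs1 := (Int.lt_floor_add_one s).le
  have ht0 := Int.floor_le t
  have ht1 := (Int.lt_floor_add_one t).le
  rcases (Int.floor_mono hst.le).eq_or_lt with e | hlt
  · rw [← e] at ht0 ht1
    exact h ⌊s⌋ ⟨hs0, hs1⟩ ⟨ht0, ht1⟩ hst
  · have hle : ⌊s⌋ + 1 ≤ ⌊t⌋ := hlt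
    have h1 : θ s < θ (⌊s⌋ + 1) :=
      h ⌊s⌋ ⟨hs0, hs1⟩ ⟨by linarith, le_rfl⟩ (Int.lt_floor_add_one s)
    have h2 : θ ⌊t⌋ ≤ θ t := (h ⌊t⌋).monotoneOn ⟨le_rfl, by linarith⟩ ⟨ht0, ht1⟩ ht0
    have h3 : θ ((⌊s⌋ + 1 : ℤ) : ℝ) ≤ θ ((⌊t⌋ : ℤ) : ℝ) := hz.monotone hle
    push_cast at h3
    linarith

theorem horizontalCross_eq_sin {p q : E3} {a b : ℝ}
    (hp : horizontal p = ‖horizontal p‖ * Complex.exp (a * Complex.I))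
    (hq : horizontal q = ‖horizontal q‖ * Complex.exp (b * Complex.I)) :
    horizontalCross p q = ‖horizontal p‖ * ‖horizontal q‖ * Real.sin (b - a) := by
  have p0 := congrArg Complex.re hp
  have p1 := congrArg Complex.im hp
  have q0 := congrArg Complex.re hq
  have q1 := congrArg Complex.im hq
  rw [Complex.re_ofReal_mul, Complex.exp_ofReal_mul_I_re] at p0 q0
  rw [Complex.im_ofReal_mul, Complex.exp_ofReal_mul_I_im] at p1 q1
  change p 0 = _ at p0
  change p 1 = _ at p1
  change q 0 = _ at q0
  change q 1 = _ at q1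
  rw [horizontalCross, p0, p1, q0, q1, Real.sin_sub]
  ring

theorem strictMonoOn_of_sin_pos {θ : ℝ → ℝ} (hθ : Continuous θ) {a b : ℝ}
    (h : ∀ s t, a ≤ s → s < t → t ≤ b → 0 < Real.sin (θ t - θ s)) :
    StrictMonoOn θ (Set.Icc a b) := by
  intro s hs t ht hst
  by_contra hle
  rw [not_lt] at hle
  -- Near `s` the angle increases, so it would take the value `θ s` a second time.
  have hnear : ∀ᶠ x in nhdsWithin s (Set.Ioi s), θ s < θ x ∧ x < t := by
    have h1 : ∀ᶠ x in nhds s, |θ x - θ s| < Real.pi := by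
      have : Filter.Tendsto (fun x => |θ x - θ s|) (nhds s) (nhds 0) := by
        have := ((hθ.sub (continuous_const (y := θ s))).abs).tendsto s
        simpa using this
      exact this.eventually (gt_mem_nhds Real.pi_pos)
    have h2 : ∀ᶠ x in nhds s, x < t := gt_mem_nhds hst
    filter_upwards [mem_nhdsWithin_of_mem_nhds h1, mem_nhdsWithin_of_mem_nhds h2,
      self_mem_nhdsWithin] with x hx1 hx2 hx3
    refine ⟨?_, hx2⟩
    by_contra hc
    have := Real.sin_nonpos_of_nonpos_of_neg_pi_le (x := θ x - θ s) (by linarith)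
      (by linarith [(abs_lt.1 hx1).1])
    linarith [h s x hs.1 hx3 (hx2.le.trans ht.2)]
  obtain ⟨x, ⟨hx1, hx2⟩, hx3⟩ := (hnear.and self_mem_nhdsWithin).exists
  obtain ⟨y, hy, hyx⟩ := intermediate_value_Icc' hx2.le hθ.continuousOn ⟨hle, hx1.le⟩
  have := h s y hs.1 ((show s < x from hx3).trans_le hy.1) (hy.2.trans ht.2)
  rw [hyx] at this
  simp at this

theorem surjective_of_add_period {θ : ℝ → ℝ} (hθ : Continuous θ) {m c : ℝ} (hc : 0 < c)
    (h : ∀ t, θ (t + m) = θ t + c) : Function.Surjective θ := by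
  have hq : ∀ q : ℤ, θ (q * m) = θ 0 + q * c := by
    intro q
    induction q using Int.induction_on with
    | zero => simp
    | succ n ih =>
      rw [show ((n + 1 : ℤ) : ℝ) * m = ((n : ℤ) : ℝ) * m + m by push_cast; ring, h, ih]
      push_cast; ring
    | pred n ih =>
      have := h (((-n - 1 : ℤ) : ℝ) * m)
      rw [show ((-n - 1 : ℤ) : ℝ) * m + m = ((-n : ℤ) : ℝ) * m by push_cast; ring, ih] at this
      push_cast at this ⊢; linarith
  intro y
  obtain ⟨q, hq1⟩ := exists_int_gt ((y - θ 0) / c)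
  obtain ⟨r, hr1⟩ := exists_int_lt ((y - θ 0) / c)
  rw [div_lt_iff₀ hc] at hq1
  rw [lt_div_iff₀ hc] at hr1
  exact mem_range_of_exists_le_of_exists_ge hθ ⟨r * m, by rw [hq]; linarith⟩
    ⟨q * m, by rw [hq]; linarith⟩

/-- A closed polygon winding strictly counterclockwise around the axis has a continuous, strictly
increasing polar angle. -/
theorem exists_strictMono_angle {v : ℤ → E3} {m : ℕ} (hm : 0 < m) (hper : ∀ i, v (i + m) = v i)
    (hv : ∀ i, 0 < horizontalCross (v i) (v (i + 1))) :
    ∃ (θ : ℝ → ℝ) (N : ℕ), 0 < N ∧ Continuous θ ∧ StrictMono θ ∧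
      (∀ t, θ (t + m) = θ t + N * (2 * Real.pi)) ∧
      ∀ t, horizontal (polygonalCurve v t) =
        ‖horizontal (polygonalCurve v t)‖ * Complex.exp (θ t * Complex.I) := by
  have h0 := horizontal_polygonalCurve_ne_zero hv
  obtain ⟨θ, hθ, hw⟩ := exists_continuous_angle
    (continuous_horizontal.comp (continuous_polygonalCurve v)) h0
  have hmono : StrictMono θ := strictMono_of_strictMonoOn_Icc_int fun k =>
    strictMonoOn_of_sin_pos hθ fun s t hs hst ht => by
      have := horizontalCross_polygonalCurve_pos hv hs hst ht
      rw [horizontalCross_eq_sin (hw s) (hw t)] at this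
      exact pos_of_mul_pos_right this (by positivity)
  have hmem : ∀ t, ∃ N : ℤ, (N : ℝ) = (θ (t + m) - θ t) / (2 * Real.pi) := by
    intro t
    have h1 := hw (t + m)
    simp only [Function.comp, polygonalCurve_add_period v m hper t] at h1
    have h2 := hw t
    simp only [Function.comp] at h2
    have h3 : ((‖horizontal (polygonalCurve v t)‖ : ℝ) : ℂ) ≠ 0 := by simpa using h0 t
    obtain ⟨N, hN⟩ := Complex.exp_eq_exp_iff_exists_int.1 (mul_left_cancel₀ h3 (h1.symm.trans h2))
    refine ⟨N, ?_⟩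
    have h4 : ((θ (t + m) : ℝ) : ℂ) = ((θ t + N * (2 * Real.pi) : ℝ) : ℂ) := by
      refine mul_right_cancel₀ Complex.I_ne_zero ?_
      rw [hN]; push_cast; ring
    rw [Complex.ofReal_inj.1 h4]
    field_simp; ring
  obtain ⟨y, ⟨N, rfl⟩, hN⟩ := isPreconnected_univ.eqOn_const_of_mapsTo
    (T := Set.range (Int.cast : ℤ → ℝ)) (f := fun t => (θ (t + m) - θ t) / (2 * Real.pi))
    Int.isClosedEmbedding_coe_real.isEmbedding.isDiscrete_range
    (Continuous.continuousOn (by fun_prop)) (fun t _ => hmem t) ⟨_, 0, rfl⟩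
  have hN' : ∀ t, θ (t + m) = θ t + N * (2 * Real.pi) := by
    intro t
    have h1 : (θ (t + m) - θ t) / (2 * Real.pi) = N := hN (Set.mem_univ t)
    rw [div_eq_iff (by positivity)] at h1
    linarith
  have hNpos : 0 < N := by
    have h1 := hmono (show (0 : ℝ) < 0 + m by simpa using hm)
    rw [hN' 0] at h1
    have h2 : (0 : ℝ) < N := pos_of_mul_pos_left (b := 2 * Real.pi) (by linarith) (by positivity)
    exact_mod_cast h2
  lift N to ℕ using hNpos.le
  exact ⟨θ, N, by exact_mod_cast hNpos, hθ, hmono, fun t => by simpa using hN' t, hw⟩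

/-- The vertices of the square with vertices `(±1, 0)`, `(0, ±1)` in the horizontal plane. -/
noncomputable def diamondVertex (k : ℤ) : E3 :=
  !₂[if k % 4 = 0 then 1 else if k % 4 = 2 then -1 else 0,
    if k % 4 = 1 then 1 else if k % 4 = 3 then -1 else 0, 0]

/-- The boundary of the square with vertices `(±1, 0)`, `(0, ±1)`, which is the unit circle of the
norm `|x| + |y|`, traversed counterclockwise with period `4`. It replaces the round circle since
it is piecewise affine. -/
noncomputable def diamond : ℝ → E3 := polygonalCurve diamondVertex

theorem diamondVertex_add_four (k : ℤ) : diamondVertex (k + (4 : ℕ)) = diamondVertex k := by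
  simp [diamondVertex]

theorem diamond_add_four (a : ℝ) : diamond (a + 4) = diamond a := by
  have := polygonalCurve_add_period diamondVertex 4 diamondVertex_add_four a
  exact_mod_cast this

theorem horizontalCross_diamondVertex (k : ℤ) :
    0 < horizontalCross (diamondVertex k) (diamondVertex (k + 1)) := by
  rcases (show k % 4 = 0 ∨ k % 4 = 1 ∨ k % 4 = 2 ∨ k % 4 = 3 by omega) with h | h | h | h
  · have h' : (k + 1) % 4 = 1 := by omega
    simp [horizontalCross, diamondVertex, h, h']
  · have h' : (k + 1) % 4 = 2 := by omega
    simp [horizontalCross, diamondVertex, h, h']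
  · have h' : (k + 1) % 4 = 3 := by omega
    simp [horizontalCross, diamondVertex, h, h']
  · have h' : (k + 1) % 4 = 0 := by omega
    simp [horizontalCross, diamondVertex, h, h']

theorem diamond_of_mem_upper {c : ℝ} (h0 : 0 ≤ c) (h2 : c ≤ 2) :
    diamond c 0 = 1 - c ∧ diamond c 1 = 1 - |1 - c| := by
  rcases le_total c 1 with h | h
  · have := polygonalCurve_of_mem diamondVertex 0 (t := c) (by simpa using h0) (by simpa using h)
    rw [diamond, this, abs_of_nonneg (by linarith)]
    simp [diamondVertex, AffineMap.lineMap_apply]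
    ring
  · have := polygonalCurve_of_mem diamondVertex 1 (t := c) (by simpa using h)
      (by push_cast; linarith)
    rw [diamond, this, abs_of_nonpos (by linarith)]
    constructor
    · simp [diamondVertex, AffineMap.lineMap_apply]
    · simp [diamondVertex, AffineMap.lineMap_apply]
      ring

theorem diamond_of_mem_lower {c : ℝ} (h0 : 2 ≤ c) (h2 : c ≤ 4) :
    diamond c 0 = c - 3 ∧ diamond c 1 = -(1 - |c - 3|) := by
  rcases le_total c 3 with h | h
  · have := polygonalCurve_of_mem diamondVertex 2 (t := c) (by simpa using h0)
      (by push_cast; linarith)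
    rw [diamond, this, abs_of_nonpos (by linarith)]
    constructor
    · simp [diamondVertex, AffineMap.lineMap_apply]
      ring
    · simp [diamondVertex, AffineMap.lineMap_apply]
      ring
  · have := polygonalCurve_of_mem diamondVertex 3 (t := c) (by simpa using h)
      (by push_cast; linarith)
    rw [diamond, this, abs_of_nonneg (by linarith)]
    constructor
    · simp [diamondVertex, AffineMap.lineMap_apply]
    · simp [diamondVertex, AffineMap.lineMap_apply]
      ring

theorem diamond_add_four_mul (a : ℝ) (q : ℤ) : diamond (a + 4 * q) = diamond a := by
  have h : Function.Periodic diamond 4 := diamond_add_four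
  rw [mul_comm]; exact h.int_mul q a

/-- Reduction of a parameter modulo the period `4`. -/
theorem exists_eq_add_four_mul (a : ℝ) : ∃ (c : ℝ) (q : ℤ), 0 ≤ c ∧ c < 4 ∧ a = c + 4 * q := by
  refine ⟨a - 4 * ⌊a / 4⌋, ⌊a / 4⌋, ?_, ?_, by ring⟩
  · linarith [Int.floor_le (a / 4)]
  · linarith [Int.lt_floor_add_one (a / 4)]

theorem abs_diamond_add_abs_diamond (a : ℝ) : |diamond a 0| + |diamond a 1| = 1 := by
  obtain ⟨c, q, h0, h4, rfl⟩ := exists_eq_add_four_mul a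
  rw [diamond_add_four_mul]
  rcases le_total c 2 with h | h
  · obtain ⟨e0, e1⟩ := diamond_of_mem_upper h0 h
    have : |1 - c| ≤ 1 := abs_le.2 ⟨by linarith, by linarith⟩
    rw [e0, e1, abs_of_nonneg (sub_nonneg.2 this)]; ring
  · obtain ⟨e0, e1⟩ := diamond_of_mem_lower h h4.le
    have : |c - 3| ≤ 1 := abs_le.2 ⟨by linarith, by linarith⟩
    rw [e0, e1, abs_neg, abs_of_nonneg (sub_nonneg.2 this)]; ring

/-- The polar angle along the diamond grows by `2π` on each period. -/
theorem exists_strictMono_angle_diamond :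
    ∃ θ : ℝ → ℝ, Continuous θ ∧ StrictMono θ ∧ (∀ t, θ (t + 4) = θ t + 2 * Real.pi) ∧
      ∀ t, horizontal (diamond t) =
        ‖horizontal (diamond t)‖ * Complex.exp (θ t * Complex.I) := by
  obtain ⟨θ, N, hN, hθ, hmono, hper, hw⟩ := exists_strictMono_angle (v := diamondVertex) (m := 4)
    (by norm_num) diamondVertex_add_four horizontalCross_diamondVertex
  change ∀ t, horizontal (diamond t) = ‖horizontal (diamond t)‖ * _ at hw
  refine ⟨θ, hθ, hmono, ?_, hw⟩
  suffices hN1 : N = 1 by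
    subst hN1
    intro t; simpa using hper t
  by_contra hne
  have hN2 : (2 : ℝ) ≤ N := by exact_mod_cast (show 2 ≤ N by omega)
  have h4 := hper 0
  norm_num at h4
  have hpi := Real.pi_pos
  obtain ⟨a, ⟨ha0, ha4⟩, ha⟩ := intermediate_value_Ioo (show (0 : ℝ) ≤ 4 by norm_num)
    hθ.continuousOn (show θ 0 + 2 * Real.pi ∈ Set.Ioo (θ 0) (θ 4) by
      constructor
      · linarith
      · rw [h4]; nlinarith)
  -- The point with parameter `a` lies in the same direction as the point with parameter `0`.
  have h0 := hw 0
  have h1 := hw a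
  have hexp : Complex.exp ((θ 0 + 2 * Real.pi : ℝ) * Complex.I) = Complex.exp (θ 0 * Complex.I) := by
    push_cast
    rw [add_mul, Complex.exp_add, Complex.exp_two_pi_mul_I, mul_one]
  rw [ha, hexp] at h1
  have hc := horizontalCross_eq_sin h0 h1
  rw [sub_self, Real.sin_zero, mul_zero] at hc
  obtain ⟨z0, z1⟩ := diamond_of_mem_upper le_rfl (show (0 : ℝ) ≤ 2 by norm_num)
  norm_num at z0 z1
  have hy : diamond a 1 = 0 := by simpa [horizontalCross, z0, z1] using hc
  have hpos : 0 < diamond a 0 := by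
    have e0 : Complex.exp (θ 0 * Complex.I) * ‖horizontal (diamond 0)‖ = 1 := by
      rw [mul_comm, ← h0]; exact Complex.ext (by simp [horizontal, z0]) (by simp [horizontal, z1])
    have hn0 : horizontal (diamond 0) ≠ 0 :=
      horizontal_polygonalCurve_ne_zero horizontalCross_diamondVertex 0
    have hna : horizontal (diamond a) ≠ 0 :=
      horizontal_polygonalCurve_ne_zero horizontalCross_diamondVertex a
    have e1 : horizontal (diamond a) * ‖horizontal (diamond 0)‖ = ‖horizontal (diamond a)‖ := by
      rw [h1, mul_assoc, e0, mul_one]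
      simp [Complex.norm_exp_ofReal_mul_I]
    have e2 := congrArg Complex.re e1
    rw [Complex.re_mul_ofReal, Complex.ofReal_re] at e2
    have e3 : 0 < (horizontal (diamond a)).re * ‖horizontal (diamond 0)‖ := by
      rw [e2]; exact norm_pos_iff.2 hna
    exact pos_of_mul_pos_left e3 (norm_nonneg _)
  rcases le_total a 2 with h | h
  · obtain ⟨e0, e1⟩ := diamond_of_mem_upper ha0.le h
    rw [hy] at e1
    rw [e0] at hpos
    rw [abs_of_pos hpos] at e1
    linarith
  · obtain ⟨e0, e1⟩ := diamond_of_mem_lower h ha4.le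
    rw [hy] at e1
    rw [e0] at hpos
    rw [abs_of_pos hpos] at e1
    linarith

namespace PolygonalKnot

theorem curve_add_numEdges (P : PolygonalKnot) (t : ℝ) : P.curve (t + P.numEdges) = P.curve t :=
  polygonalCurve_add_period P.vertex P.numEdges P.vertex_periodic t

/-- A closed braid on `n` strands can be parametrized by the direction in which its points are
seen from the axis, measured along the diamond. It runs around the axis at most `n` times, since
the half-planes bounded by the axis meet it in `n` points only. -/
theorem IsClosedBraid.exists_orderIso {P : PolygonalKnot} {n : ℕ} (h : P.IsClosedBraid n) :
    ∃ (N : ℕ) (α : ℝ ≃o ℝ), 0 < N ∧ N ≤ n ∧ (∀ t, α (t + P.numEdges) = α t + 4 * N) ∧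
      ∀ t, ∃ ρ > 0, P.curve t 0 = ρ * diamond (α t) 0 ∧ P.curve t 1 = ρ * diamond (α t) 1 := by
  have hv : ∀ i, 0 < horizontalCross (P.vertex i) (P.vertex (i + 1)) := h.1
  obtain ⟨θ, N, hN, hθ, hmono, hper, hw⟩ := exists_strictMono_angle (v := P.vertex)
    P.numEdges_pos P.vertex_periodic hv
  obtain ⟨η, hη, hηmono, hηper, hηw⟩ := exists_strictMono_angle_diamond
  have hne : ∀ t, horizontal (P.curve t) ≠ 0 := horizontal_polygonalCurve_ne_zero hv
  have hηne : ∀ t, horizontal (diamond t) ≠ 0 :=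
    horizontal_polygonalCurve_ne_zero horizontalCross_diamondVertex
  change ∀ t, horizontal (P.curve t) = ‖horizontal (P.curve t)‖ * _ at hw
  have hNpos : (0 : ℝ) < N := by exact_mod_cast hN
  have hpi := Real.pi_pos
  have hsurj : Function.Surjective θ := surjective_of_add_period hθ (by positivity) hper
  let e₁ : ℝ ≃o ℝ := hmono.orderIsoOfSurjective θ hsurj
  let e₂ : ℝ ≃o ℝ := hηmono.orderIsoOfSurjective η
    (surjective_of_add_period hη (by positivity) hηper)
  have hα : ∀ t, η (e₂.symm (e₁ t)) = θ t := fun t => e₂.apply_symm_apply (e₁ t)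
  refine ⟨N, e₁.trans e₂.symm, hN, ?_, fun t => ?_, fun t => ?_⟩
  · have hcard := h.2 0
    choose τ hτ using fun j : Fin N => hsurj (j * (2 * Real.pi))
    have hinj : Function.Injective fun j : Fin N => P.curve (τ j) := by
      intro i j hij
      obtain ⟨k, hk⟩ := P.embedded _ _ hij
      have hper' : ∀ (k : ℤ) t, θ (t + k * P.numEdges) = θ t + k * (N * (2 * Real.pi)) := by
        intro k t
        induction k using Int.induction_on with
        | zero => simp
        | succ n ih =>
          have := hper (t + n * P.numEdges)
          push_cast at ih ⊢
          rw [add_mul, one_mul, ← add_assoc, this, ih]; ring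
        | pred n ih =>
          have := hper (t + (-n - 1) * P.numEdges)
          rw [show t + (-(n : ℝ) - 1) * P.numEdges + P.numEdges = t + -n * P.numEdges by ring] at this
          push_cast at ih ⊢
          linarith
      have h1 := hper' k (τ i)
      rw [← hk, hτ, hτ] at h1
      have h2 : ((j : ℕ) : ℝ) = (i : ℕ) + k * N := by
        refine mul_right_cancel₀ (show 2 * Real.pi ≠ 0 by positivity) ?_
        rw [h1]; ring
      have h3 : ((j : ℕ) : ℤ) = (i : ℕ) + k * N := by exact_mod_cast h2
      have hi := i.2
      have hj := j.2
      have h4 : ((j : ℕ) : ℤ) % N = ((i : ℕ) : ℤ) % N := by rw [h3, Int.add_mul_emod_self_right]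
      rw [Int.emod_eq_of_lt (by omega) (by omega), Int.emod_eq_of_lt (by omega) (by omega)] at h4
      exact Fin.ext (by omega)
    have hsub : Set.range (fun j : Fin N => P.curve (τ j)) ⊆ P.carrier ∩ page 0 := by
      rintro _ ⟨j, rfl⟩
      refine ⟨⟨_, rfl⟩, ‖horizontal (P.curve (τ j))‖, norm_pos_iff.2 (hne _), ?_⟩
      have h1 := hw (τ j)
      rw [hτ] at h1
      have h2 : Complex.exp ((((j : ℕ) : ℝ) * (2 * Real.pi) : ℝ) * Complex.I) = 1 := by
        rw [Complex.exp_eq_one_iff]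
        exact ⟨(j : ℕ), by push_cast; ring⟩
      rw [h2, mul_one] at h1
      constructor
      · rw [Real.cos_zero, mul_one]; exact congrArg Complex.re h1
      · rw [Real.sin_zero, mul_zero]; exact congrArg Complex.im h1
    have h5 := Set.encard_le_encard hsub
    rw [hcard, ← Set.image_univ, hinj.encard_image, Set.encard_univ, ENat.card_eq_coe_fintype_card,
      Fintype.card_fin] at h5
    exact_mod_cast h5
  · refine hηmono.injective ?_
    have h4 : ∀ (k : ℕ) t, η (t + 4 * k) = η t + k * (2 * Real.pi) := by
      intro k t
      induction k with
      | zero => simp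
      | succ k ih =>
        rw [show t + 4 * ((k + 1 : ℕ) : ℝ) = t + 4 * k + 4 by push_cast; ring, hηper, ih]
        push_cast; ring
    change η (e₂.symm (e₁ (t + P.numEdges))) = η (e₂.symm (e₁ t) + 4 * N)
    rw [h4, hα, hα, hper]
  · have h1 := hw t
    have h2 := hηw (e₂.symm (e₁ t))
    rw [hα] at h2
    have h3 := norm_pos_iff.2 (hne t)
    have h4 := norm_pos_iff.2 (hηne (e₂.symm (e₁ t)))
    refine ⟨‖horizontal (P.curve t)‖ / ‖horizontal (diamond (e₂.symm (e₁ t)))‖, by positivity, ?_⟩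
    have h5 : horizontal (P.curve t) =
        ((‖horizontal (P.curve t)‖ / ‖horizontal (diamond (e₂.symm (e₁ t)))‖ : ℝ) : ℂ) *
          horizontal (diamond (e₂.symm (e₁ t))) := by
      conv_lhs => rw [h1]
      conv_rhs => rw [h2]
      have h6 : (‖horizontal (diamond (e₂.symm (e₁ t)))‖ : ℂ) ≠ 0 := by exact_mod_cast h4.ne'
      simp only [Complex.norm_mul, Complex.norm_real, Complex.norm_exp_ofReal_mul_I, mul_one,
        norm_norm]
      push_cast
      field_simp
    have r := congrArg Complex.re h5
    have i := congrArg Complex.im h5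
    rw [Complex.re_ofReal_mul] at r
    rw [Complex.im_ofReal_mul] at i
    exact ⟨r, i⟩

end PolygonalKnot

/-! ### Piecewise affine functions -/

/-- A real function which is affine near each point on either side of that point. On a compact
interval it is affine between finitely many breakpoints. -/
def LocallyPiecewiseAffine (g : ℝ → ℝ) : Prop :=
  ∀ t, (∃ m : ℝ, ∀ᶠ x in nhdsWithin t (Set.Ici t), g x = g t + m * (x - t)) ∧
    ∃ m : ℝ, ∀ᶠ x in nhdsWithin t (Set.Iic t), g x = g t + m * (x - t)

namespace LocallyPiecewiseAffine

theorem const (c : ℝ) : LocallyPiecewiseAffine fun _ => c :=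
  fun _ => ⟨⟨0, by simp⟩, ⟨0, by simp⟩⟩

theorem id : LocallyPiecewiseAffine fun t => t :=
  fun _ => ⟨⟨1, by simp⟩, ⟨1, by simp⟩⟩

theorem add {g h : ℝ → ℝ} (hg : LocallyPiecewiseAffine g) (hh : LocallyPiecewiseAffine h) :
    LocallyPiecewiseAffine fun t => g t + h t := by
  intro t
  obtain ⟨⟨m, hm⟩, ⟨m', hm'⟩⟩ := hg t
  obtain ⟨⟨l, hl⟩, ⟨l', hl'⟩⟩ := hh t
  refine ⟨⟨m + l, ?_⟩, ⟨m' + l', ?_⟩⟩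
  · filter_upwards [hm, hl] with x h1 h2
    rw [h1, h2]; ring
  · filter_upwards [hm', hl'] with x h1 h2
    rw [h1, h2]; ring

theorem const_mul {g : ℝ → ℝ} (hg : LocallyPiecewiseAffine g) (c : ℝ) :
    LocallyPiecewiseAffine fun t => c * g t := by
  intro t
  obtain ⟨⟨m, hm⟩, ⟨m', hm'⟩⟩ := hg t
  refine ⟨⟨c * m, ?_⟩, ⟨c * m', ?_⟩⟩
  · filter_upwards [hm] with x h1
    rw [h1]; ring
  · filter_upwards [hm'] with x h1
    rw [h1]; ring

theorem sub {g h : ℝ → ℝ} (hg : LocallyPiecewiseAffine g) (hh : LocallyPiecewiseAffine h) :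
    LocallyPiecewiseAffine fun t => g t - h t := by
  simpa [sub_eq_add_neg] using hg.add (hh.const_mul (-1))

theorem sum {ι : Type*} (s : Finset ι) {g : ι → ℝ → ℝ}
    (hg : ∀ i ∈ s, LocallyPiecewiseAffine (g i)) :
    LocallyPiecewiseAffine fun t => ∑ i ∈ s, g i t := by
  classical
  induction s using Finset.induction_on with
  | empty => simpa using const 0
  | insert i s hi ih =>
    simp only [Finset.sum_insert hi]
    exact (hg i (Finset.mem_insert_self i s)).add
      (ih fun j hj => hg j (Finset.mem_insert_of_mem hj))

theorem max_zero {g : ℝ → ℝ} (hg : LocallyPiecewiseAffine g) :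
    LocallyPiecewiseAffine fun t => max (g t) 0 := by
  intro t
  -- away from the zeros of `g` this holds with the slope of `g` or with slope zero
  have key : ∀ (s : Set ℝ) (m : ℝ), g t ≠ 0 →
      (∀ᶠ x in nhdsWithin t s, g x = g t + m * (x - t)) →
      ∃ m' : ℝ, ∀ᶠ x in nhdsWithin t s, max (g x) 0 = max (g t) 0 + m' * (x - t) := by
    intro s m h0 hm
    have hlim : Filter.Tendsto (fun x => g t + m * (x - t)) (nhdsWithin t s) (nhds (g t)) := by
      have : ContinuousAt (fun x => g t + m * (x - t)) t := by fun_prop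
      simpa [ContinuousAt] using this.tendsto.mono_left nhdsWithin_le_nhds
    rcases h0.lt_or_gt with h | h
    · refine ⟨0, ?_⟩
      filter_upwards [hm, hlim.eventually (gt_mem_nhds h)] with x h1 h2
      rw [max_eq_right (by rw [h1]; exact h2.le), max_eq_right h.le]; ring
    · refine ⟨m, ?_⟩
      filter_upwards [hm, hlim.eventually (lt_mem_nhds h)] with x h1 h2
      rw [max_eq_left (by rw [h1]; exact h2.le), max_eq_left h.le, h1]
  obtain ⟨⟨m, hm⟩, ⟨m', hm'⟩⟩ := hg t
  by_cases h0 : g t = 0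
  · refine ⟨⟨max m 0, ?_⟩, ⟨min m' 0, ?_⟩⟩
    · filter_upwards [hm, self_mem_nhdsWithin] with x h1 h2
      have h3 : 0 ≤ x - t := sub_nonneg.2 h2
      rw [h1, h0, max_mul_of_nonneg _ _ h3]
      simp
    · filter_upwards [hm', self_mem_nhdsWithin] with x h1 h2
      have h3 : x - t ≤ 0 := sub_nonpos.2 h2
      rw [h1, h0]
      rcases le_total m' 0 with h | h
      · rw [min_eq_left h, max_eq_left (by nlinarith)]; simp
      · rw [min_eq_right h, max_eq_right (by nlinarith)]; simp
  · exact ⟨key _ m h0 hm, key _ m' h0 hm'⟩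

theorem max {g h : ℝ → ℝ} (hg : LocallyPiecewiseAffine g) (hh : LocallyPiecewiseAffine h) :
    LocallyPiecewiseAffine fun t => max (g t) (h t) := by
  have : (fun t => Max.max (g t) (h t)) = fun t => h t + Max.max (g t - h t) 0 := by
    funext t; rw [← max_add_add_left]; simp
  rw [this]
  exact hh.add (hg.sub hh).max_zero

theorem min {g h : ℝ → ℝ} (hg : LocallyPiecewiseAffine g) (hh : LocallyPiecewiseAffine h) :
    LocallyPiecewiseAffine fun t => min (g t) (h t) := by
  have : (fun t => Min.min (g t) (h t)) = fun t => g t + h t - Max.max (g t) (h t) := by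
    funext t; rw [← min_add_max (g t) (h t)]; ring
  rw [this]
  exact (hg.add hh).sub (hg.max hh)

theorem abs {g : ℝ → ℝ} (hg : LocallyPiecewiseAffine g) :
    LocallyPiecewiseAffine fun t => |g t| := by
  have : (fun t => |g t|) = fun t => Max.max (g t) (-1 * g t) := by
    funext t; rw [neg_one_mul]; rfl
  rw [this]
  exact hg.max (hg.const_mul (-1))

theorem continuous {g : ℝ → ℝ} (hg : LocallyPiecewiseAffine g) : Continuous g := by
  rw [continuous_iff_continuousAt]
  intro t
  have key : ∀ (s : Set ℝ) (m : ℝ), (∀ᶠ x in nhdsWithin t s, g x = g t + m * (x - t)) →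
      Filter.Tendsto g (nhdsWithin t s) (nhds (g t)) := by
    intro s m hm
    have : ContinuousAt (fun x => g t + m * (x - t)) t := by fun_prop
    have h2 : Filter.Tendsto (fun x => g t + m * (x - t)) (nhdsWithin t s) (nhds (g t)) := by
      simpa [ContinuousAt] using this.tendsto.mono_left nhdsWithin_le_nhds
    exact h2.congr' (by filter_upwards [hm] with x hx using hx.symm)
  obtain ⟨⟨m, hm⟩, ⟨m', hm'⟩⟩ := hg t
  exact continuousAt_iff_continuous_left_right.2 ⟨key _ m' hm', key _ m hm⟩

/-- Between breakpoints, a function which is locally affine is affine. -/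
theorem exists_slope {g : ℝ → ℝ} (hg : LocallyPiecewiseAffine g) {x y : ℝ} (hxy : x < y)
    (h : ∀ t ∈ Set.Ioo x y, ∃ m : ℝ, ∀ᶠ z in nhds t, g z = g t + m * (z - t)) :
    ∃ m : ℝ, ∀ t ∈ Set.Icc x y, g t = g x + m * (t - x) := by
  obtain ⟨⟨m, hm⟩, -⟩ := hg x
  -- the set of `t` such that `g` is affine on `[x, t]` with the initial slope `m`
  refine ⟨m, ?_⟩
  let s : Set ℝ := {t | ∀ u ∈ Set.Icc x t, g u = g x + m * (u - x)}
  have hclosed : IsClosed (s ∩ Set.Icc x y) := by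
    rw [← isSeqClosed_iff_isClosed]
    intro u t hu hut
    have htm : t ∈ Set.Icc x y := isClosed_Icc.isSeqClosed (fun n => (hu n).2) hut
    refine ⟨fun z hz => ?_, htm⟩
    rcases hz.2.lt_or_eq with hzt | rfl
    · obtain ⟨n, hn⟩ := (hut.eventually (lt_mem_nhds hzt)).exists
      exact (hu n).1 z ⟨hz.1, hn.le⟩
    · refine tendsto_nhds_unique ((hg.continuous.tendsto z).comp hut) ?_
      have : Filter.Tendsto (fun n => g x + m * (u n - x)) Filter.atTop
          (nhds (g x + m * (z - x))) :=
        ((hut.sub_const x).const_mul m).const_add (g x)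
      refine this.congr fun n => ?_
      exact ((hu n).1 (u n) ⟨(hu n).2.1, le_rfl⟩).symm
  have hxs : x ∈ s := by
    intro u hu
    obtain rfl : u = x := le_antisymm hu.2 hu.1
    simp
  have hsub := hclosed.Icc_subset_of_forall_exists_gt hxs (a := x) (b := y) (by
    rintro t ⟨hts, htx, hty⟩ z hz
    have hright : ∀ᶠ u in nhdsWithin t (Set.Ioi t), g u = g x + m * (u - x) := by
      rcases htx.eq_or_lt with rfl | htx
      · exact nhdsWithin_mono _ Set.Ioi_subset_Ici_self hm
      · obtain ⟨m', hm'⟩ := h t ⟨htx, hty⟩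
        have hl : ∀ᶠ u in nhdsWithin t (Set.Iio t), x < u :=
          mem_nhdsWithin_of_mem_nhds (lt_mem_nhds htx)
        have hm'' : ∀ᶠ u in nhdsWithin t (Set.Iio t), g u = g t + m' * (u - t) :=
          mem_nhdsWithin_of_mem_nhds hm'
        obtain ⟨u, ⟨hu1, hu2⟩, hu3⟩ := ((hm''.and hl).and self_mem_nhdsWithin).exists
        have e1 := hts u ⟨hu2.le, le_of_lt hu3⟩
        have e2 := hts t ⟨htx.le, le_rfl⟩
        have hmm : m' = m := by
          have hne : u - t ≠ 0 := sub_ne_zero.2 (ne_of_lt hu3)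
          refine mul_right_cancel₀ hne ?_
          linear_combination e1 - hu1 - e2
        filter_upwards [mem_nhdsWithin_of_mem_nhds hm'] with v hv
        rw [hv, e2, hmm]; ring
    obtain ⟨w, hw, hw'⟩ := mem_nhdsGT_iff_exists_Ioo_subset.1 hright
    obtain ⟨v, hv1, hv2⟩ := exists_between (lt_min (Set.mem_Ioi.1 hw) (Set.mem_Ioi.1 hz))
    refine ⟨v, fun u hu => ?_, hv1, hv2.le.trans (min_le_right _ _)⟩
    rcases le_or_gt u t with hut | hut
    · exact hts u ⟨hu.1, hut⟩
    · exact hw' ⟨hut, hu.2.trans_lt (hv2.trans_le (min_le_left _ _))⟩)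
  exact fun t ht => hsub ⟨hxy.le, le_rfl⟩ t ht

theorem exists_breakpoints {g : ℝ → ℝ} (hg : LocallyPiecewiseAffine g) (a b : ℝ) :
    ∃ S : Finset ℝ, ∀ x y, a ≤ x → x < y → y ≤ b → (∀ s ∈ S, s ≤ x ∨ y ≤ s) →
      ∃ m : ℝ, ∀ t ∈ Set.Icc x y, g t = g x + m * (t - x) := by
  classical
  have hS : ∃ S : Finset ℝ, ∀ t ∈ Set.Icc a b, t ∉ S →
      ∃ m : ℝ, ∀ᶠ z in nhds t, g z = g t + m * (z - t) := by
    refine isCompact_Icc.induction_on (p := fun A => ∃ S : Finset ℝ, ∀ t ∈ A, t ∉ S →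
      ∃ m : ℝ, ∀ᶠ z in nhds t, g z = g t + m * (z - t)) ⟨∅, by simp⟩ ?_ ?_ ?_
    · rintro A B hAB ⟨S, hS⟩
      exact ⟨S, fun t ht => hS t (hAB ht)⟩
    · rintro A B ⟨S, hS⟩ ⟨S', hS'⟩
      refine ⟨S ∪ S', fun t ht hn => ?_⟩
      rw [Finset.mem_union, not_or] at hn
      exact ht.elim (fun h => hS t h hn.1) fun h => hS' t h hn.2
    · intro t ht
      obtain ⟨⟨m, hm⟩, ⟨m', hm'⟩⟩ := hg t
      have hgt := nhdsWithin_mono _ Set.Ioi_subset_Ici_self hm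
      have hlt := nhdsWithin_mono _ Set.Iio_subset_Iic_self hm'
      obtain ⟨u, hu, hu'⟩ := mem_nhdsGT_iff_exists_Ioo_subset.1 hgt
      obtain ⟨l, hl, hl'⟩ := mem_nhdsLT_iff_exists_Ioo_subset.1 hlt
      refine ⟨Set.Ioo l u, mem_nhdsWithin_of_mem_nhds (Ioo_mem_nhds hl hu), {t}, ?_⟩
      intro z hz hzt
      rw [Finset.mem_singleton] at hzt
      rcases lt_or_gt_of_ne hzt with h | h
      · refine ⟨m', ?_⟩
        have hzv : g z = g t + m' * (z - t) := hl' ⟨hz.1, h⟩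
        filter_upwards [Ioo_mem_nhds hz.1 h] with v hv
        have : g v = g t + m' * (v - t) := hl' hv
        rw [this, hzv]; ring
      · refine ⟨m, ?_⟩
        have hzv : g z = g t + m * (z - t) := hu' ⟨h, hz.2⟩
        filter_upwards [Ioo_mem_nhds h hz.2] with v hv
        have : g v = g t + m * (v - t) := hu' hv
        rw [this, hzv]; ring
  obtain ⟨S, hS⟩ := hS
  refine ⟨S, fun x y hx hxy hy hn => hg.exists_slope hxy fun t ht => hS t
    ⟨hx.trans ht.1.le, ht.2.le.trans hy⟩ fun hts => ?_⟩
  rcases hn t hts with h | h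
  · exact absurd ht.1 (not_lt.2 h)
  · exact absurd ht.2 (not_lt.2 h)

end LocallyPiecewiseAffine

/-- A map of the plane carrying piecewise affine curves to piecewise affine curves. -/
def IsPiecewiseAffineMap (F : ℝ × ℝ → ℝ × ℝ) : Prop :=
  ∀ x z : ℝ → ℝ, LocallyPiecewiseAffine x → LocallyPiecewiseAffine z →
    LocallyPiecewiseAffine (fun t => (F (x t, z t)).1) ∧
      LocallyPiecewiseAffine fun t => (F (x t, z t)).2

theorem IsPiecewiseAffineMap.comp {F G : ℝ × ℝ → ℝ × ℝ} (hF : IsPiecewiseAffineMap F)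
    (hG : IsPiecewiseAffineMap G) : IsPiecewiseAffineMap (F ∘ G) :=
  fun x z hx hz => hF _ _ (hG x z hx hz).1 (hG x z hx hz).2

/-- The norm of the plane in use here is the maximum norm, which is piecewise affine. -/
theorem LocallyPiecewiseAffine.norm_sub {x z : ℝ → ℝ} (hx : LocallyPiecewiseAffine x)
    (hz : LocallyPiecewiseAffine z) (c : ℝ × ℝ) :
    LocallyPiecewiseAffine fun t => ‖((x t, z t) : ℝ × ℝ) - c‖ :=
  (hx.sub (.const c.1)).abs.max (hz.sub (.const c.2)).abs

/-! ### Isotopies of the half-plane extending a motion of points -/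

theorem bijective_add_of_lipschitzWith {E : Type*} [NormedAddCommGroup E] [CompleteSpace E]
    {g : E → E} {κ : NNReal} (hκ : κ < 1) (hg : LipschitzWith κ g) :
    Function.Bijective fun x => x + g x := by
  constructor
  · intro x y hxy
    have h1 : x - y = g y - g x := by
      have : x + g x = y + g y := hxy
      rw [sub_eq_sub_iff_add_eq_add, this, add_comm]
    have h2 : dist x y ≤ κ * dist x y := by
      calc dist x y = dist (g y) (g x) := by rw [dist_eq_norm, dist_eq_norm, h1]
        _ ≤ κ * dist y x := hg.dist_le_mul y x
        _ = κ * dist x y := by rw [dist_comm]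
    have h3 : (κ : ℝ) < 1 := by exact_mod_cast hκ
    by_contra hne
    have := dist_pos.2 hne
    nlinarith
  · intro y
    have hc : ContractingWith κ fun x => y - g x := by
      refine ⟨hκ, LipschitzWith.of_dist_le_mul fun a b => ?_⟩
      rw [dist_sub_left]
      exact hg.dist_le_mul a b
    have h : y - g hc.fixedPoint = hc.fixedPoint := hc.fixedPoint_isFixedPt
    exact ⟨hc.fixedPoint, (sub_eq_iff_eq_add.1 h).symm⟩

/-- The map pushing each point `c i` to `c i + v i`, supported on squares of radius `r` around the
points `c i`. -/
noncomputable def pushMap {ι : Type*} [Fintype ι] (r : ℝ) (c v : ι → ℝ × ℝ) (x : ℝ × ℝ) : ℝ × ℝ :=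
  x + ∑ i, (max (r - ‖x - c i‖) 0 / r) • v i

theorem lipschitzWith_bump {E : Type*} [NormedAddCommGroup E] (r : ℝ) (c : E) :
    LipschitzWith 1 fun x : E => max (r - ‖x - c‖) 0 := by
  refine LipschitzWith.max_const ?_ 0
  refine LipschitzWith.of_dist_le_mul fun x y => ?_
  rw [NNReal.coe_one, one_mul, Real.dist_eq, dist_eq_norm]
  have : r - ‖x - c‖ - (r - ‖y - c‖) = ‖y - c‖ - ‖x - c‖ := by ring
  rw [this, norm_sub_rev x y]
  refine (abs_norm_sub_norm_le _ _).trans (le_of_eq ?_)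
  congr 1; abel

section pushMap

variable {ι : Type*} [Fintype ι] {r : ℝ} {c v : ι → ℝ × ℝ}

theorem bijective_pushMap (hr : 0 < r) (hv : ∑ i, ‖v i‖ < r) :
    Function.Bijective (pushMap r c v) := by
  have h0 : 0 ≤ (∑ i, ‖v i‖) / r := by positivity
  refine bijective_add_of_lipschitzWith (κ := ((∑ i, ‖v i‖) / r).toNNReal) ?_ ?_
  · rw [Real.toNNReal_lt_one]
    exact (div_lt_one hr).2 hv
  · refine LipschitzWith.of_dist_le_mul fun x y => ?_
    rw [dist_eq_norm, ← Finset.sum_sub_distrib]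
    refine (norm_sum_le _ _).trans ?_
    rw [Real.coe_toNNReal _ h0, Finset.sum_div, Finset.sum_mul]
    refine Finset.sum_le_sum fun i _ => ?_
    rw [← sub_smul, norm_smul, ← sub_div, norm_div, Real.norm_of_nonneg hr.le]
    have := (lipschitzWith_bump r (c i)).dist_le_mul x y
    rw [NNReal.coe_one, one_mul, Real.dist_eq] at this
    calc _ = |max (r - ‖x - c i‖) 0 - max (r - ‖y - c i‖) 0| * (‖v i‖ / r) := by
          rw [Real.norm_eq_abs]; ring
      _ ≤ dist x y * (‖v i‖ / r) := by gcongr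
      _ = _ := by ring

theorem pushMap_of_far {x : ℝ × ℝ} (h : ∀ i, r ≤ ‖x - c i‖) : pushMap r c v x = x := by
  rw [pushMap, Finset.sum_eq_zero, add_zero]
  intro i _
  rw [max_eq_right (by linarith [h i]), zero_div, zero_smul]

theorem pushMap_apply_center (hr : 0 < r) (hc : ∀ i j, i ≠ j → r ≤ ‖c i - c j‖) (i : ι) :
    pushMap r c v (c i) = c i + v i := by
  rw [pushMap, Finset.sum_eq_single i]
  · simp [hr.le, hr.ne']
  · intro j _ hj
    rw [max_eq_right (by linarith [hc i j hj.symm]), zero_div, zero_smul]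
  · simp

theorem isPiecewiseAffineMap_pushMap : IsPiecewiseAffineMap (pushMap r c v) := by
  intro x z hx hz
  have hb : ∀ i, LocallyPiecewiseAffine fun t => max (r - ‖((x t, z t) : ℝ × ℝ) - c i‖) 0 :=
    fun i => ((LocallyPiecewiseAffine.const r).sub (hx.norm_sub hz (c i))).max_zero
  constructor
  · have : (fun t => (pushMap r c v (x t, z t)).1) = fun t =>
        x t + ∑ i, ((v i).1 / r) * max (r - ‖((x t, z t) : ℝ × ℝ) - c i‖) 0 := by
      funext t
      simp only [pushMap, Prod.fst_add, Prod.fst_sum, Prod.smul_fst, smul_eq_mul]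
      congr 1
      exact Finset.sum_congr rfl fun i _ => by ring
    rw [this]
    exact hx.add (.sum _ fun i _ => (hb i).const_mul _)
  · have : (fun t => (pushMap r c v (x t, z t)).2) = fun t =>
        z t + ∑ i, ((v i).2 / r) * max (r - ‖((x t, z t) : ℝ × ℝ) - c i‖) 0 := by
      funext t
      simp only [pushMap, Prod.snd_add, Prod.snd_sum, Prod.smul_snd, smul_eq_mul]
      congr 1
      exact Finset.sum_congr rfl fun i _ => by ring
    rw [this]
    exact hz.add (.sum _ fun i _ => (hb i).const_mul _)

end pushMap

/-- A continuous family of bijections of the plane with compact support in the half-plane of all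
points with positive first coordinate. -/
structure IsHalfPlaneIsotopy (ψ : ℝ → ℝ × ℝ → ℝ × ℝ) : Prop where
  continuous : Continuous fun p : ℝ × (ℝ × ℝ) => ψ p.1 p.2
  bijective : ∀ a, Function.Bijective (ψ a)
  exists_margin : ∃ σ > 0, ∀ a x, x.1 ≤ σ → ψ a x = x
  exists_radius : ∃ R, ∀ a x, R ≤ ‖x‖ → ψ a x = x

namespace IsHalfPlaneIsotopy

theorem id : IsHalfPlaneIsotopy fun _ x => x where
  continuous := continuous_snd
  bijective _ := Function.bijective_id
  exists_margin := ⟨1, one_pos, fun _ _ _ => rfl⟩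
  exists_radius := ⟨0, fun _ _ _ => rfl⟩

theorem comp {ψ φ : ℝ → ℝ × ℝ → ℝ × ℝ} (hψ : IsHalfPlaneIsotopy ψ) (hφ : IsHalfPlaneIsotopy φ) :
    IsHalfPlaneIsotopy fun a x => ψ a (φ a x) := by
  obtain ⟨σ, hσ, h1⟩ := hψ.exists_margin
  obtain ⟨σ', hσ', h1'⟩ := hφ.exists_margin
  obtain ⟨R, h2⟩ := hψ.exists_radius
  obtain ⟨R', h2'⟩ := hφ.exists_radius
  refine ⟨hψ.continuous.comp (continuous_fst.prodMk hφ.continuous),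
    fun a => (hψ.bijective a).comp (hφ.bijective a), ⟨min σ σ', lt_min hσ hσ', fun a x hx => ?_⟩,
    ⟨max R R', fun a x hx => ?_⟩⟩
  · rw [h1' a x (hx.trans (min_le_right _ _)), h1 a x (hx.trans (min_le_left _ _))]
  · rw [h2' a x ((le_max_right _ _).trans hx), h2 a x ((le_max_left _ _).trans hx)]

theorem reparam {ψ : ℝ → ℝ × ℝ → ℝ × ℝ} (hψ : IsHalfPlaneIsotopy ψ) {κ : ℝ → ℝ}
    (hκ : Continuous κ) : IsHalfPlaneIsotopy fun a => ψ (κ a) := by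
  obtain ⟨σ, hσ, h1⟩ := hψ.exists_margin
  obtain ⟨R, h2⟩ := hψ.exists_radius
  exact ⟨hψ.continuous.comp ((hκ.comp continuous_fst).prodMk continuous_snd),
    fun a => hψ.bijective _, ⟨σ, hσ, fun a => h1 _⟩, ⟨R, fun a => h2 _⟩⟩

theorem exists_inverse {ψ : ℝ → ℝ × ℝ → ℝ × ℝ} (hψ : IsHalfPlaneIsotopy ψ) :
    ∃ φ, IsHalfPlaneIsotopy φ ∧ (∀ a x, φ a (ψ a x) = x) ∧ ∀ a x, ψ a (φ a x) = x := by
  let e : ℝ × (ℝ × ℝ) ≃ ℝ × (ℝ × ℝ) :=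
    { toFun := fun p => (p.1, ψ p.1 p.2)
      invFun := fun p => (p.1, (Equiv.ofBijective _ (hψ.bijective p.1)).symm p.2)
      left_inv := fun p => Prod.ext rfl (Equiv.ofBijective_symm_apply_apply _ (hψ.bijective p.1) p.2)
      right_inv := fun p =>
        Prod.ext rfl (Equiv.ofBijective_apply_symm_apply _ (hψ.bijective p.1) p.2) }
  obtain ⟨σ, hσ, h1⟩ := hψ.exists_margin
  obtain ⟨R, h2⟩ := hψ.exists_radius
  have he : Continuous e.symm := by
    refine continuous_symm_of_norm_le e (continuous_fst.prodMk hψ.continuous) R fun p => ?_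
    rcases le_total R ‖p.2‖ with h | h
    · have : e p = p := Prod.ext rfl (h2 p.1 p.2 h)
      rw [this]; exact le_max_right _ _
    · refine max_le ?_ (h.trans (le_max_left _ _))
      exact (le_max_left ‖(e p).1‖ ‖(e p).2‖).trans (le_max_right _ _)
  have hl : ∀ a x, (Equiv.ofBijective _ (hψ.bijective a)).symm (ψ a x) = x := fun a x =>
    Equiv.ofBijective_symm_apply_apply _ (hψ.bijective a) x
  have hr : ∀ a x, ψ a ((Equiv.ofBijective _ (hψ.bijective a)).symm x) = x := fun a x =>
    Equiv.ofBijective_apply_symm_apply _ (hψ.bijective a) x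
  refine ⟨fun a => (Equiv.ofBijective _ (hψ.bijective a)).symm,
    ⟨continuous_snd.comp he, fun a => Equiv.bijective _, ⟨σ, hσ, fun a x hx => ?_⟩,
      ⟨R, fun a x hx => ?_⟩⟩, hl, hr⟩
  · nth_rewrite 1 [← h1 a x hx]; exact hl a x
  · nth_rewrite 1 [← h2 a x hx]; exact hl a x

end IsHalfPlaneIsotopy

theorem exists_uniform_distance {ι : Type*} [Finite ι] {q : ℝ → ι → ℝ × ℝ} {T : ℝ}
    (hq : ∀ i, Continuous fun a => q a i)
    (hinj : ∀ a ∈ Set.Icc 0 T, Function.Injective (q a))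
    (hpos : ∀ a ∈ Set.Icc 0 T, ∀ i, 0 < (q a i).1) :
    ∃ r > 0, ∀ a ∈ Set.Icc 0 T, (∀ i j, i ≠ j → r ≤ ‖q a i - q a j‖) ∧
      ∀ i, 2 * r ≤ (q a i).1 := by
  have key : ∀ g : ℝ → ℝ, Continuous g → (∀ a ∈ Set.Icc 0 T, 0 < g a) →
      ∀ᶠ r in nhdsWithin (0 : ℝ) (Set.Ioi 0), ∀ a ∈ Set.Icc 0 T, r ≤ g a := by
    intro g hg h0
    obtain ⟨δ, hδ, h⟩ := isCompact_Icc.exists_forall_le' hg.continuousOn h0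
    filter_upwards [mem_nhdsWithin_of_mem_nhds (gt_mem_nhds hδ)] with r hr a ha
    exact (le_of_lt hr).trans (h a ha)
  have h1 : ∀ᶠ r in nhdsWithin (0 : ℝ) (Set.Ioi 0), ∀ i j, i ≠ j → ∀ a ∈ Set.Icc 0 T,
      r ≤ ‖q a i - q a j‖ := by
    rw [Filter.eventually_all]; intro i
    rw [Filter.eventually_all]; intro j
    by_cases hij : i = j
    · simp [hij]
    · filter_upwards [key (fun a => ‖q a i - q a j‖) ((hq i).sub (hq j)).norm fun a ha =>
        norm_pos_iff.2 (sub_ne_zero.2 fun h => hij (hinj a ha h))] with r hr _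
      exact hr
  have h2 : ∀ᶠ r in nhdsWithin (0 : ℝ) (Set.Ioi 0), ∀ i, ∀ a ∈ Set.Icc 0 T,
      r ≤ (q a i).1 / 2 := by
    rw [Filter.eventually_all]; intro i
    exact key (fun a => (q a i).1 / 2) ((continuous_fst.comp (hq i)).div_const 2) fun a ha =>
      half_pos (hpos a ha i)
  obtain ⟨r, ⟨hr1, hr2⟩, hr3⟩ := ((h1.and h2).and self_mem_nhdsWithin).exists
  exact ⟨r, hr3, fun a ha => ⟨fun i j hij => hr1 i j hij a ha, fun i => by
    linarith [hr2 i a ha]⟩⟩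

/-- Isotopy extension in the half-plane, by piecewise affine maps: a motion of finitely many points
is subdivided into small steps, in each of which the points are pushed to their new positions
within disjoint squares. -/
theorem exists_isotopy_extending_motion {ι : Type*} [Fintype ι] {q : ℝ → ι → ℝ × ℝ} {T : ℝ}
    (hT : 0 ≤ T) (hq : ∀ i, Continuous fun a => q a i)
    (hinj : ∀ a ∈ Set.Icc 0 T, Function.Injective (q a))
    (hpos : ∀ a ∈ Set.Icc 0 T, ∀ i, 0 < (q a i).1) :
    ∃ ψ, IsHalfPlaneIsotopy ψ ∧ (∀ x, ψ 0 x = x) ∧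
      (∀ a ∈ Set.Icc 0 T, ∀ i, ψ a (q 0 i) = q a i) ∧ ∀ a, IsPiecewiseAffineMap (ψ a) := by
  obtain ⟨r, hr, hsep⟩ := exists_uniform_distance hq hinj hpos
  -- the isotopy up to the time `b`
  let A : ℝ → Prop := fun b => ∃ ψ, IsHalfPlaneIsotopy ψ ∧ (∀ x, ψ 0 x = x) ∧
      (∀ a, 0 ≤ a → ∀ i, ψ a (q 0 i) = q (min a b) i) ∧ ∀ a, IsPiecewiseAffineMap (ψ a)
  have hA0 : A 0 := ⟨_, .id, fun _ => rfl, fun a ha i => by rw [min_eq_right ha],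
    fun a x z hx hz => ⟨hx, hz⟩⟩
  obtain ⟨δ, hδ, hsmall⟩ : ∃ δ > 0, ∀ b ∈ Set.Icc 0 T, ∀ a ∈ Set.Icc 0 T, |a - b| ≤ δ →
      ∑ i, ‖q a i - q b i‖ < r := by
    have hu : ∀ i, ∀ᶠ δ in nhdsWithin (0 : ℝ) (Set.Ioi 0), ∀ b ∈ Set.Icc 0 T, ∀ a ∈ Set.Icc 0 T,
        |a - b| ≤ δ → ‖q a i - q b i‖ < r / (Fintype.card ι) := by
      intro i
      have hcard : (0 : ℝ) < Fintype.card ι := by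
        exact_mod_cast Fintype.card_pos_iff.2 ⟨i⟩
      have := isCompact_Icc.uniformContinuousOn_of_continuous
        (hq i).continuousOn (s := Set.Icc 0 T)
      rw [Metric.uniformContinuousOn_iff] at this
      obtain ⟨δ, hδ, h⟩ := this (r / Fintype.card ι) (by positivity)
      filter_upwards [mem_nhdsWithin_of_mem_nhds (gt_mem_nhds hδ)] with d hd b hb a ha hab
      rw [← dist_eq_norm]
      exact h a ha b hb (lt_of_le_of_lt hab hd)
    rw [← Filter.eventually_all] at hu
    obtain ⟨δ, hδ, h⟩ := (hu.and self_mem_nhdsWithin).exists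
    refine ⟨δ, h, fun b hb a ha hab => ?_⟩
    rcases isEmpty_or_nonempty ι with hι | hι
    · simpa using hr
    · have hcard : (Fintype.card ι : ℝ) ≠ 0 := by
        exact_mod_cast Fintype.card_ne_zero
      calc ∑ i, ‖q a i - q b i‖ < ∑ i : ι, r / (Fintype.card ι) :=
            Finset.sum_lt_sum_of_nonempty Finset.univ_nonempty fun i _ => hδ i b hb a ha hab
        _ = r := by rw [Finset.sum_const, Finset.card_univ, nsmul_eq_mul]; field_simp
  have hstep : ∀ b ∈ Set.Icc 0 T, ∀ b' ∈ Set.Icc b T, b' ≤ b + δ → A b → A b' := by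
    rintro b hb b' hb' hbb ⟨ψ, hψ, hψ0, hψq, hψl⟩
    let cl : ℝ → ℝ := fun a => max b (min a b')
    have hcl : ∀ a, cl a ∈ Set.Icc b b' := fun a => ⟨le_max_left _ _, max_le hb'.1 (min_le_right _ _)⟩
    have hclT : ∀ a, cl a ∈ Set.Icc 0 T := fun a =>
      ⟨hb.1.trans (hcl a).1, (hcl a).2.trans hb'.2⟩
    have hclc : Continuous cl := by fun_prop
    let v : ℝ → ι → ℝ × ℝ := fun a i => q (cl a) i - q b i
    have hv : ∀ a, ∑ i, ‖v a i‖ < r := fun a => hsmall b hb (cl a) (hclT a) (by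
      rw [abs_of_nonneg (sub_nonneg.2 (hcl a).1)]; linarith [(hcl a).2])
    have hvc : ∀ i, Continuous fun a => v a i := fun i => ((hq i).comp hclc).sub continuous_const
    have hbound : ∃ M, ∀ i, ‖q b i‖ ≤ M := by
      obtain ⟨M, hM⟩ := (Set.finite_range fun i => ‖q b i‖).bddAbove
      exact ⟨M, fun i => hM ⟨i, rfl⟩⟩
    obtain ⟨M, hM⟩ := hbound
    have hpush : IsHalfPlaneIsotopy fun a => pushMap r (q b) (v a) := by
      refine ⟨?_, fun a => bijective_pushMap hr (hv a), ⟨r, hr, fun a x hx => ?_⟩,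
        ⟨M + r, fun a x hx => ?_⟩⟩
      · unfold pushMap
        refine continuous_snd.add (continuous_finsetSum _ fun i _ => ?_)
        have h1 : Continuous fun p : ℝ × (ℝ × ℝ) => max (r - ‖p.2 - q b i‖) 0 / r := by fun_prop
        have h2 : Continuous fun p : ℝ × (ℝ × ℝ) => v p.1 i := (hvc i).comp continuous_fst
        exact h1.smul h2
      · refine pushMap_of_far fun i => ?_
        have h1 := (hsep b hb).2 i
        have h2 : |x.1 - (q b i).1| ≤ ‖x - q b i‖ := le_max_left _ _
        have h3 := neg_abs_le (x.1 - (q b i).1)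
        linarith
      · refine pushMap_of_far fun i => ?_
        have := norm_sub_norm_le x (q b i)
        linarith [hM i]
    refine ⟨_, hpush.comp hψ, fun x => ?_, fun a ha i => ?_,
      fun a => isPiecewiseAffineMap_pushMap.comp (hψl a)⟩
    · have : v 0 = 0 := by
        have : cl 0 = b := max_eq_left ((min_le_left _ _).trans hb.1)
        funext i; simp [v, this]
      simp [hψ0, pushMap, this]
    · rw [hψq a ha]
      rcases le_total a b with hab | hab
      · have hv0 : v a = 0 := by
          have : cl a = b := max_eq_left ((min_le_left _ _).trans hab)
          funext i; simp [v, this]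
        rw [min_eq_left hab, min_eq_left (hab.trans hb'.1)]
        simp [pushMap, hv0]
      · rw [min_eq_right hab, pushMap_apply_center hr (hsep b hb).1]
        simp only [v, cl]
        rw [max_eq_right (le_min hab hb'.1)]
        abel
  have hall : ∀ k : ℕ, A (min (k * δ) T) := by
    intro k
    induction k with
    | zero => simpa [hT] using hA0
    | succ k ih =>
      have h0 : (0 : ℝ) ≤ k * δ := by positivity
      have hle : (k : ℝ) * δ ≤ (k + 1 : ℕ) * δ := by push_cast; nlinarith
      refine hstep _ ⟨le_min h0 hT, min_le_right _ _⟩ _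
        ⟨min_le_min_right _ hle, min_le_right _ _⟩ ?_ ih
      rw [← min_add_add_right]
      refine min_le_min ?_ (by linarith)
      push_cast; linarith
  obtain ⟨k, hk⟩ := exists_nat_gt (T / δ)
  rw [div_lt_iff₀ hδ] at hk
  have := hall k
  rw [min_eq_right hk.le] at this
  obtain ⟨ψ, h1, h2, h3, h4⟩ := this
  exact ⟨ψ, h1, h2, fun a ha i => by rw [h3 a ha.1, min_eq_left ha.2], h4⟩

/-! ### Straightening a closed braid -/

/-- The map of Euclidean space, in coordinates `(x, y, z)`, that preserves the half-planes bounded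
by the `z`-axis and acts on them by the maps `ω a`. Points of such a half-plane have the coordinates
`|x| + |y|` and `z`; the index `a` of the map is a function `A` of `x / (|x| + |y|)`. -/
noncomputable def pageMap (A : ℝ → ℝ) (ω : ℝ → ℝ × ℝ → ℝ × ℝ) (p : ℝ × ℝ × ℝ) : ℝ × ℝ × ℝ :=
  ((ω (A (p.1 / (|p.1| + |p.2.1|))) (|p.1| + |p.2.1|, p.2.2)).1 / (|p.1| + |p.2.1|) * p.1,
    (ω (A (p.1 / (|p.1| + |p.2.1|))) (|p.1| + |p.2.1|, p.2.2)).1 / (|p.1| + |p.2.1|) * p.2.1,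
    (ω (A (p.1 / (|p.1| + |p.2.1|))) (|p.1| + |p.2.1|, p.2.2)).2)

theorem pageMap_polar (A : ℝ → ℝ) (ω : ℝ → ℝ × ℝ → ℝ × ℝ) {ρ : ℝ} (hρ : 0 < ρ) {d e : ℝ}
    (hd : |d| + |e| = 1) (z : ℝ) :
    pageMap A ω (ρ * d, ρ * e, z) =
      ((ω (A d) (ρ, z)).1 * d, (ω (A d) (ρ, z)).1 * e, (ω (A d) (ρ, z)).2) := by
  have h : |ρ * d| + |ρ * e| = ρ := by
    rw [abs_mul, abs_mul, abs_of_pos hρ, ← mul_add, hd, mul_one]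
  simp only [pageMap, h, mul_div_cancel_left₀ _ hρ.ne']
  refine Prod.ext ?_ (Prod.ext ?_ rfl)
  · change _ / ρ * (ρ * d) = _; field_simp
  · change _ / ρ * (ρ * e) = _; field_simp

theorem exists_polar {p : ℝ × ℝ × ℝ} (hp : 0 < |p.1| + |p.2.1|) :
    ∃ ρ d e z : ℝ, 0 < ρ ∧ |d| + |e| = 1 ∧ p = (ρ * d, ρ * e, z) := by
  refine ⟨|p.1| + |p.2.1|, p.1 / (|p.1| + |p.2.1|), p.2.1 / (|p.1| + |p.2.1|), p.2.2, hp, ?_, ?_⟩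
  · rw [abs_div, abs_div, abs_of_pos hp, ← add_div, div_self hp.ne']
  · rw [mul_div_cancel₀ _ hp.ne', mul_div_cancel₀ _ hp.ne']

theorem pageMap_of_near (A : ℝ → ℝ) {ω : ℝ → ℝ × ℝ → ℝ × ℝ} {p : ℝ × ℝ × ℝ}
    (h : ∀ a, ω a (|p.1| + |p.2.1|, p.2.2) = (|p.1| + |p.2.1|, p.2.2)) : pageMap A ω p = p := by
  simp only [pageMap, h]
  by_cases h0 : |p.1| + |p.2.1| = 0
  · have h1 : p.1 = 0 := abs_eq_zero.1 (by linarith [abs_nonneg p.1, abs_nonneg p.2.1])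
    have h2 : p.2.1 = 0 := abs_eq_zero.1 (by linarith [abs_nonneg p.1, abs_nonneg p.2.1])
    exact Prod.ext (by simp [h1]) (Prod.ext (by simp [h2]) rfl)
  · simp [div_self h0]

namespace IsHalfPlaneIsotopy

variable {ω φ : ℝ → ℝ × ℝ → ℝ × ℝ}

theorem apply_of_nonpos (hω : IsHalfPlaneIsotopy ω) (a : ℝ) {x : ℝ × ℝ} (hx : x.1 ≤ 0) :
    ω a x = x := by
  obtain ⟨σ, hσ, h⟩ := hω.exists_margin
  exact h a x (hx.trans hσ.le)

theorem fst_pos (hω : IsHalfPlaneIsotopy ω) (a : ℝ) {x : ℝ × ℝ} (hx : 0 < x.1) :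
    0 < (ω a x).1 := by
  by_contra h
  have h1 := hω.apply_of_nonpos a (not_lt.1 h)
  have h2 := (hω.bijective a).1 h1
  rw [h2] at h
  exact h hx

theorem pageMap_leftInverse (hω : IsHalfPlaneIsotopy ω) (hφ : IsHalfPlaneIsotopy φ)
    (h : ∀ a x, φ a (ω a x) = x) (A : ℝ → ℝ) (p : ℝ × ℝ × ℝ) :
    pageMap A φ (pageMap A ω p) = p := by
  rcases (add_nonneg (abs_nonneg p.1) (abs_nonneg p.2.1)).eq_or_lt with h0 | h0
  · rw [pageMap_of_near A (ω := ω) fun a => hω.apply_of_nonpos a h0.symm.le,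
      pageMap_of_near A (ω := φ) fun a => hφ.apply_of_nonpos a h0.symm.le]
  · obtain ⟨ρ, d, e, z, hρ, hd, rfl⟩ := exists_polar h0
    rw [pageMap_polar A ω hρ hd, pageMap_polar A φ (hω.fst_pos _ hρ) hd, Prod.mk.eta, h]

theorem bijective_pageMap (hω : IsHalfPlaneIsotopy ω) (A : ℝ → ℝ) :
    Function.Bijective (pageMap A ω) := by
  obtain ⟨φ, hφ, h1, h2⟩ := hω.exists_inverse
  exact Function.bijective_iff_has_inverse.2 ⟨pageMap A φ, hω.pageMap_leftInverse hφ h1 A,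
    hφ.pageMap_leftInverse hω h2 A⟩

theorem continuous_pageMap (hω : IsHalfPlaneIsotopy ω) {A : ℝ → ℝ} (hA : Continuous A) :
    Continuous (pageMap A ω) := by
  obtain ⟨σ, hσ, hm⟩ := hω.exists_margin
  have hn : Continuous fun p : ℝ × ℝ × ℝ => |p.1| + |p.2.1| := by fun_prop
  rw [continuous_iff_continuousAt]
  intro p
  by_cases h0 : |p.1| + |p.2.1| < σ
  · refine continuousAt_id.congr ?_
    filter_upwards [hn.continuousAt.eventually (gt_mem_nhds h0)] with x hx
    exact (pageMap_of_near A fun a => hm a _ (le_of_lt hx)).symm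
  · have hne : |p.1| + |p.2.1| ≠ 0 := by linarith
    have h1 : ContinuousAt (fun p : ℝ × ℝ × ℝ => A (p.1 / (|p.1| + |p.2.1|))) p :=
      hA.continuousAt.comp (continuous_fst.continuousAt.div hn.continuousAt hne)
    have h2 : ContinuousAt (fun p : ℝ × ℝ × ℝ =>
        ω (A (p.1 / (|p.1| + |p.2.1|))) (|p.1| + |p.2.1|, p.2.2)) p :=
      hω.continuous.continuousAt.comp (h1.prodMk (hn.continuousAt.prodMk
        (continuous_snd.comp continuous_snd).continuousAt))
    have h3 := (continuous_fst.continuousAt.comp h2).div hn.continuousAt hne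
    exact (h3.mul continuous_fst.continuousAt).prodMk
      ((h3.mul (continuous_fst.comp continuous_snd).continuousAt).prodMk
        (continuous_snd.continuousAt.comp h2))

theorem pageMap_of_norm_le {R : ℝ} (hR : ∀ a x, R ≤ ‖x‖ → ω a x = x) (A : ℝ → ℝ)
    {p : ℝ × ℝ × ℝ} (hp : R ≤ ‖p‖) : pageMap A ω p = p := by
  refine pageMap_of_near A fun a => hR a _ (hp.trans ?_)
  have h1 : |p.1| + |p.2.1| ≤ ‖((|p.1| + |p.2.1|, p.2.2) : ℝ × ℝ)‖ :=
    (le_abs_self _).trans (le_max_left _ _)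
  have h2 : |p.2.2| ≤ ‖((|p.1| + |p.2.1|, p.2.2) : ℝ × ℝ)‖ := le_max_right _ _
  refine max_le ?_ (max_le ?_ h2)
  · change |p.1| ≤ _; linarith [abs_nonneg p.2.1]
  · change |p.2.1| ≤ _; linarith [abs_nonneg p.1]

theorem pageMap_nonneg_iff (hω : IsHalfPlaneIsotopy ω) (A : ℝ → ℝ) (p : ℝ × ℝ × ℝ) :
    0 ≤ (pageMap A ω p).2.1 ↔ 0 ≤ p.2.1 := by
  rcases (add_nonneg (abs_nonneg p.1) (abs_nonneg p.2.1)).eq_or_lt with h0 | h0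
  · rw [pageMap_of_near A (ω := ω) fun a => hω.apply_of_nonpos a h0.symm.le]
  · obtain ⟨ρ, d, e, z, hρ, hd, rfl⟩ := exists_polar h0
    rw [pageMap_polar A ω hρ hd]
    simp only [mul_nonneg_iff_of_pos_left, hω.fst_pos (A d) (x := (ρ, z)) hρ, hρ]

end IsHalfPlaneIsotopy

/-- The map of Euclidean space, in coordinates `(x, y, z)`, that preserves the planes parallel to
the plane of the axes of `x` and `z` and acts on the plane at depth `y` by the map `χ y`. -/
def layerMap (χ : ℝ → ℝ × ℝ → ℝ × ℝ) (p : ℝ × ℝ × ℝ) : ℝ × ℝ × ℝ :=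
  ((χ p.2.1 (p.1, p.2.2)).1, p.2.1, (χ p.2.1 (p.1, p.2.2)).2)

theorem IsHalfPlaneIsotopy.continuous_layerMap {χ : ℝ → ℝ × ℝ → ℝ × ℝ}
    (hχ : IsHalfPlaneIsotopy χ) : Continuous (layerMap χ) := by
  have h : Continuous fun p : ℝ × ℝ × ℝ => χ p.2.1 (p.1, p.2.2) :=
    hχ.continuous.comp (by fun_prop : Continuous fun p : ℝ × ℝ × ℝ => (p.2.1, (p.1, p.2.2)))
  exact (continuous_fst.comp h).prodMk
    ((continuous_fst.comp continuous_snd).prodMk (continuous_snd.comp h))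

theorem IsHalfPlaneIsotopy.bijective_layerMap {χ : ℝ → ℝ × ℝ → ℝ × ℝ}
    (hχ : IsHalfPlaneIsotopy χ) : Function.Bijective (layerMap χ) := by
  obtain ⟨φ, -, h1, h2⟩ := hχ.exists_inverse
  refine Function.bijective_iff_has_inverse.2 ⟨layerMap φ, fun p => ?_, fun p => ?_⟩
  · simp [layerMap, h1]
  · simp [layerMap, h2]

theorem bijective_ite_of_sign {X : Type*} {f g : X → X} (y : X → ℝ) (hf : Function.Bijective f)
    (hg : Function.Bijective g) (hfy : ∀ p, 0 ≤ y (f p) ↔ 0 ≤ y p)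
    (hgy : ∀ p, 0 ≤ y (g p) ↔ 0 ≤ y p) :
    Function.Bijective fun p => if 0 ≤ y p then f p else g p := by
  constructor
  · intro p q hpq
    simp only at hpq
    by_cases h1 : 0 ≤ y p <;> by_cases h2 : 0 ≤ y q
    · simp only [h1, h2, if_true] at hpq; exact hf.1 hpq
    · simp only [h1, h2, if_true, if_false] at hpq
      exact absurd ((hgy q).1 (hpq ▸ (hfy p).2 h1)) h2
    · simp only [h1, h2, if_true, if_false] at hpq
      exact absurd ((hgy p).1 (hpq ▸ (hfy q).2 h2)) h1
    · simp only [h1, h2, if_false] at hpq; exact hg.1 hpq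
  · intro r
    by_cases h : 0 ≤ y r
    · obtain ⟨p, rfl⟩ := hf.2 r
      exact ⟨p, by simp [(hfy p).1 h]⟩
    · obtain ⟨p, rfl⟩ := hg.2 r
      exact ⟨p, if_neg fun h' => h ((hgy p).2 h')⟩

/-- The map straightening the parts of a closed braid in the half-spaces `y ≥ 0` and `y ≤ 0`: in
both of them the half-planes bounded by the axis are moved by `ω`, and for `y ≤ 0` the layers of
constant `y` are moved by `χ` afterwards. The half-planes are indexed from `0` to `4` in
counterclockwise order, both `0` and `4` belonging to the half-plane `x > 0`, `y = 0`. -/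
noncomputable def straightening (ω χ : ℝ → ℝ × ℝ → ℝ × ℝ) (p : ℝ × ℝ × ℝ) : ℝ × ℝ × ℝ :=
  if 0 ≤ p.2.1 then pageMap (fun c => 1 - c) ω p else layerMap χ (pageMap (fun c => 3 + c) ω p)

/-- On the plane `y = 0` both parts of the definition of `straightening` agree. -/
theorem straightening_aux {ω χ : ℝ → ℝ × ℝ → ℝ × ℝ} (hω : IsHalfPlaneIsotopy ω)
    (hχ : IsHalfPlaneIsotopy χ) (hωχ : ∀ x, χ 0 (ω 4 x) = ω 0 x) (x z : ℝ) :
    pageMap (fun c => 1 - c) ω (x, 0, z) = layerMap χ (pageMap (fun c => 3 + c) ω (x, 0, z)) := by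
  rcases lt_trichotomy x 0 with h | rfl | h
  · have e : ((x, 0, z) : ℝ × ℝ × ℝ) = (-x * -1, -x * 0, z) := by ext <;> simp
    rw [e, pageMap_polar _ _ (neg_pos.2 h) (by norm_num), pageMap_polar _ _ (neg_pos.2 h)
      (by norm_num)]
    norm_num [layerMap]
    have := hω.fst_pos 2 (x := (-x, z)) (neg_pos.2 h)
    rw [hχ.apply_of_nonpos 0 (by simpa using this.le)]
    exact ⟨rfl, rfl⟩
  · have e : ∀ A, pageMap A ω (0, 0, z) = (0, 0, z) := fun A =>
      pageMap_of_near A fun a => hω.apply_of_nonpos a (by simp)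
    rw [e, e, layerMap, hχ.apply_of_nonpos 0 (by simp)]
  · have e : ((x, 0, z) : ℝ × ℝ × ℝ) = (x * 1, x * 0, z) := by ext <;> simp
    rw [e, pageMap_polar _ _ h (by norm_num), pageMap_polar _ _ h (by norm_num)]
    norm_num [layerMap, hωχ]

theorem straightening_of_nonpos {ω χ : ℝ → ℝ × ℝ → ℝ × ℝ} (hω : IsHalfPlaneIsotopy ω)
    (hχ : IsHalfPlaneIsotopy χ) (hωχ : ∀ x, χ 0 (ω 4 x) = ω 0 x) {p : ℝ × ℝ × ℝ}
    (hp : p.2.1 ≤ 0) :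
    straightening ω χ p = layerMap χ (pageMap (fun c => 3 + c) ω p) := by
  rcases hp.lt_or_eq with h | h
  · rw [straightening, if_neg (not_le.2 h)]
  · rw [straightening, if_pos h.symm.le]
    have := straightening_aux hω hχ hωχ p.1 p.2.2
    rwa [← h] at this

theorem isCompactlySupportedBijection_straightening {ω χ : ℝ → ℝ × ℝ → ℝ × ℝ}
    (hω : IsHalfPlaneIsotopy ω) (hχ : IsHalfPlaneIsotopy χ) (hωχ : ∀ x, χ 0 (ω 4 x) = ω 0 x)
    {B : ℝ} (hB : ∀ a ≤ -B, ∀ x, χ a x = x) :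
    IsCompactlySupportedBijection (straightening ω χ) := by
  obtain ⟨R, hR⟩ := hω.exists_radius
  obtain ⟨R', hR'⟩ := hχ.exists_radius
  refine ⟨?_, ?_, max R (max R' B), fun p hp => ?_⟩
  · refine Continuous.if_le (hω.continuous_pageMap (by fun_prop))
      (hχ.continuous_layerMap.comp (hω.continuous_pageMap (by fun_prop))) continuous_const
      (continuous_fst.comp continuous_snd) fun p hp => ?_
    have := straightening_aux hω hχ hωχ p.1 p.2.2
    change 0 = p.2.1 at hp
    rwa [hp] at this
  · exact bijective_ite_of_sign (fun p : ℝ × ℝ × ℝ => p.2.1) (hω.bijective_pageMap _)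
      (hχ.bijective_layerMap.comp (hω.bijective_pageMap _)) (hω.pageMap_nonneg_iff _)
      (hω.pageMap_nonneg_iff _)
  · have h1 : R ≤ ‖p‖ := (le_max_left _ _).trans hp
    have h2 : R' ≤ ‖p‖ := (le_max_left _ _).trans ((le_max_right _ _).trans hp)
    have h3 : B ≤ ‖p‖ := (le_max_right _ _).trans ((le_max_right _ _).trans hp)
    unfold straightening
    split_ifs with h
    · exact IsHalfPlaneIsotopy.pageMap_of_norm_le hR _ h1
    · rw [IsHalfPlaneIsotopy.pageMap_of_norm_le hR _ h1, layerMap]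
      suffices χ p.2.1 (p.1, p.2.2) = (p.1, p.2.2) by rw [this]
      rcases le_or_gt R' ‖((p.1, p.2.2) : ℝ × ℝ)‖ with h4 | h4
      · exact hR' _ _ h4
      · refine hB _ ?_ _
        have e1 : |p.1| ≤ ‖((p.1, p.2.2) : ℝ × ℝ)‖ := le_max_left _ _
        have e2 : |p.2.2| ≤ ‖((p.1, p.2.2) : ℝ × ℝ)‖ := le_max_right _ _
        have e3 : ‖p‖ = max |p.1| (max |p.2.1| |p.2.2|) := rfl
        have e4 : ‖p‖ ≤ |p.2.1| := by
          by_contra hlt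
          rw [not_le] at hlt
          have : ‖p‖ < ‖p‖ := by
            nth_rewrite 1 [e3]
            exact max_lt (by linarith) (max_lt hlt (by linarith))
          exact this.false
        rw [abs_of_neg (not_le.1 h)] at e4
        linarith

theorem apply_add_mul_period {X : Type*} {p : ℝ → X} {N : ℕ} (hper : ∀ a, p (a + 4 * N) = p a)
    (a : ℝ) (k : ℤ) : p (a + 4 * (N * k)) = p a := by
  have h : Function.Periodic p (4 * N) := hper
  rw [← mul_assoc, mul_comm]; exact h.int_mul k a

/-- Some compactly supported homeomorphism of the half-plane (the stage `0` of an isotopy) gives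
finitely many points different second coordinates: it moves them by a generic shear. -/
theorem exists_isotopy_separating {ι : Type*} [Fintype ι] {c : ι → ℝ × ℝ}
    (hc : Function.Injective c) (hpos : ∀ i, 0 < (c i).1) :
    ∃ ψ, IsHalfPlaneIsotopy ψ ∧ Function.Injective fun i => (ψ 0 (c i)).2 := by
  obtain ⟨ψ, hψ, hψ0, hψc, -⟩ := exists_isotopy_extending_motion
    (q := fun s i => ((c i).1, (c i).2 + s * (c i).1)) zero_le_one (fun i => by fun_prop)
    (fun s _ i j hij => hc (by
      simp only [Prod.mk.injEq] at hij
      refine Prod.ext hij.1 ?_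
      have := hij.2
      rw [hij.1] at this
      linarith)) fun s _ i => hpos i
  have hfin : (⋃ (i : ι) (j : ι), {s : ℝ | i ≠ j ∧
      (c i).2 + s * (c i).1 = (c j).2 + s * (c j).1}).Finite := by
    refine Set.finite_iUnion fun i => Set.finite_iUnion fun j => Set.Subsingleton.finite ?_
    rintro s ⟨hij, hs⟩ t ⟨-, ht⟩
    have h1 : (s - t) * ((c i).1 - (c j).1) = 0 := by linear_combination hs - ht
    rcases mul_eq_zero.1 h1 with h | h
    · linarith
    · have h2 : (c i).1 = (c j).1 := by linarith
      rw [h2] at hs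
      exact absurd (hc (Prod.ext h2 (by linarith))) hij
  obtain ⟨s, hs, hsn⟩ := (Set.Ioo_infinite (zero_lt_one' ℝ)).exists_notMem_finite hfin
  refine ⟨fun a => ψ (s + a), hψ.reparam (by fun_prop), fun i j hij => ?_⟩
  by_contra hne
  refine hsn (Set.mem_iUnion₂.2 ⟨i, j, hne, ?_⟩)
  have h : ∀ i, ψ s (c i) = ((c i).1, (c i).2 + s * (c i).1) := fun i => by
    have := hψc s ⟨hs.1.le, hs.2.le⟩ i
    simpa using this
  simpa [h] using hij

/-- The shape of a straightened closed braid, with period `4 * N`. On its `i`-th turn around the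
axis, it first runs through `y ≥ 0` along two straight segments above a segment with `z`-coordinate
`(b i).2`, and then through `y ≤ 0` below the image under `G` of such a segment. -/
structure IsStraightened (N : ℕ) (b : ℤ → ℝ × ℝ) (G : ℝ × ℝ → ℝ × ℝ) (F : ℝ → ℝ × ℝ × ℝ) :
    Prop where
  base_periodic : ∀ i, b (i + N) = b i
  base_pos : ∀ i, 0 < (b i).1
  base_separated : ∀ i j, (b i).2 = (b j).2 → (N : ℤ) ∣ i - j
  bijective : Function.Bijective G
  piecewiseAffine : IsPiecewiseAffineMap G
  apply_base : ∀ i, G (b i) = b (i + 1)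
  fst_eq_zero : ∀ x : ℝ × ℝ, (G x).1 = 0 → x.1 = 0
  apply_base_neg : ∀ i, G (-(b i).1, (b i).2) = (-(b i).1, (b i).2)
  upper : ∀ (i : ℤ), ∀ c ∈ Set.Icc (0 : ℝ) 2,
    F (c + 4 * i) = ((b i).1 * (1 - c), (b i).1 * (1 - |1 - c|), (b i).2)
  lower : ∀ (i : ℤ), ∀ c ∈ Set.Icc (2 : ℝ) 4,
    F (c + 4 * i) = ((G ((b i).1 * (c - 3), (b i).2)).1, -((b i).1 * (1 - |c - 3|)),
      (G ((b i).1 * (c - 3), (b i).2)).2)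

/-- A closed braid, given by the positions `p a` of its points in the half-planes bounded by the
axis, can be straightened. -/
theorem exists_straightening {N : ℕ} (hN : 0 < N) {p : ℝ → ℝ × ℝ} (hp : Continuous p)
    (hper : ∀ a, p (a + 4 * N) = p a) (hpos : ∀ a, 0 < (p a).1)
    (hinj : ∀ (a : ℝ) (i j : ℤ), p (a + 4 * i) = p (a + 4 * j) → (N : ℤ) ∣ i - j) :
    ∃ Θ b G, IsCompactlySupportedBijection Θ ∧ IsStraightened N b G fun a =>
      Θ ((p a).1 * diamond a 0, (p a).1 * diamond a 1, (p a).2) := by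
  have hNz : (0 : ℤ) < N := by exact_mod_cast hN
  let q : ℝ → Fin N → ℝ × ℝ := fun a j => p (a + 4 * (j : ℕ))
  have hqinj : ∀ a, Function.Injective (q a) := by
    intro a j k hjk
    have h1 := hinj a (j : ℕ) (k : ℕ) (by simpa [q] using hjk)
    have h2 := Int.eq_zero_of_abs_lt_dvd h1 (by have := j.2; have := k.2; rw [abs_lt]; omega)
    exact Fin.ext (by omega)
  have hpq : ∀ i : ℤ, ∃ j : Fin N, (∀ a, p (a + 4 * i) = q a j) ∧ (N : ℤ) ∣ i - (j : ℕ) := by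
    intro i
    have h0 := Int.emod_nonneg i hNz.ne'
    refine ⟨⟨(i % N).toNat, by have := Int.emod_lt_of_pos i hNz; omega⟩, fun a => ?_, ?_⟩
    · change _ = p (a + 4 * (((i % N).toNat : ℕ) : ℝ))
      have h1 : (((i % N).toNat : ℕ) : ℝ) = ((i % N : ℤ) : ℝ) := by
        rw [← Int.cast_natCast, Int.toNat_of_nonneg h0]
      have h2 : (i : ℝ) = ((i % N : ℤ) : ℝ) + N * ((i / N : ℤ) : ℝ) := by
        exact_mod_cast (Int.emod_add_mul_ediv i N).symm
      rw [h1, h2, mul_add, ← add_assoc, apply_add_mul_period hper]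
    · change (N : ℤ) ∣ i - ((i % N).toNat : ℤ)
      rw [Int.toNat_of_nonneg h0]; exact Int.dvd_self_sub_emod
  obtain ⟨S, hS, hsep⟩ := exists_isotopy_separating (hqinj 0) fun j => hpos _
  set E := S 0
  have hEc : Continuous E := hS.continuous.comp (Continuous.prodMk_right 0)
  obtain ⟨ψ, hψ, hψ0, hψq, hψl⟩ := exists_isotopy_extending_motion (q := fun a j => E (q a j))
    (T := 4) (by norm_num) (fun j => hEc.comp (hp.comp (by fun_prop)))
    (fun a _ => (hS.bijective 0).1.comp (hqinj a)) fun a _ j => hS.fst_pos 0 (hpos _)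
  obtain ⟨φ, hφ, hφψ, hψφ⟩ := hψ.exists_inverse
  let b : ℤ → ℝ × ℝ := fun i => E (p (4 * i))
  have hbN : ∀ i, b (i + N) = b i := fun i => by
    have := hper (4 * i)
    simp only [b]; rw [← this]; push_cast; ring_nf
  have hψb : ∀ a ∈ Set.Icc (0 : ℝ) 4, ∀ i, ψ a (b i) = E (p (a + 4 * i)) := by
    intro a ha i
    obtain ⟨j, hj, -⟩ := hpq i
    have := hψq a ha j
    rw [← hj, ← hj, zero_add] at this
    exact this
  obtain ⟨M, hM⟩ : ∃ M, ∀ i, (b i).1 ≤ M := by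
    obtain ⟨M, hM⟩ := (Set.finite_range fun j => (E (q 0 j)).1).bddAbove
    refine ⟨M, fun i => ?_⟩
    obtain ⟨j, hj, -⟩ := hpq i
    have := hj 0
    rw [zero_add] at this
    simp only [b, this]
    exact hM ⟨j, rfl⟩
  let ω : ℝ → ℝ × ℝ → ℝ × ℝ := fun a x => φ a (S 0 x)
  have hω : IsHalfPlaneIsotopy ω := hφ.comp (hS.reparam (κ := fun _ => 0) continuous_const)
  let κ : ℝ → ℝ := fun y => max 0 (min 4 (y + M + 4))
  let χ : ℝ → ℝ × ℝ → ℝ × ℝ := fun y => ψ (κ y)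
  have hχ : IsHalfPlaneIsotopy χ := hψ.reparam (by fun_prop)
  have hMpos : 0 < M := (hS.fst_pos 0 (hpos _)).trans_le (hM 0)
  have hκ : ∀ y, -M ≤ y → κ y = 4 := fun y hy => by
    simp only [κ]; rw [min_eq_left (by linarith), max_eq_right (by norm_num)]
  have hωχ : ∀ x, χ 0 (ω 4 x) = ω 0 x := by
    intro x
    simp only [χ, ω, hκ 0 (by linarith), hψφ]
    have := hφψ 0 (S 0 x)
    rw [hψ0] at this
    exact this.symm
  have hωp : ∀ i : ℤ, ∀ c ∈ Set.Icc (0 : ℝ) 4, ω c (p (c + 4 * i)) = b i := by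
    intro i c hc
    have := hφψ c (b i)
    rwa [hψb c hc] at this
  have hG0 : ∀ x : ℝ × ℝ, x.1 ≤ 0 → ψ 4 x = x := fun x hx => hψ.apply_of_nonpos 4 hx
  refine ⟨straightening ω χ, b, ψ 4, isCompactlySupportedBijection_straightening hω hχ hωχ
    (B := M + 4) fun a ha x => ?_, hbN, fun i => hS.fst_pos 0 (hpos _), fun i j hij => ?_,
    hψ.bijective 4, hψl 4, fun i => ?_, fun x hx => ?_, fun i => hG0 _ ?_, fun i c hc => ?_,
    fun i c hc => ?_⟩
  · have : κ a = 0 := by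
      simp only [κ]; exact max_eq_left ((min_le_right _ _).trans (by linarith))
    simp only [χ, this, hψ0]
  · obtain ⟨i', hi, hid⟩ := hpq i
    obtain ⟨j', hj, hjd⟩ := hpq j
    have e1 := hi 0
    have e2 := hj 0
    rw [zero_add] at e1 e2
    simp only [b, e1, e2] at hij
    have := hsep hij
    subst this
    simpa using dvd_sub hid hjd
  · rw [hψb 4 (by norm_num)]
    simp only [b]; push_cast; ring_nf
  · rw [hG0 _ ?_] at hx
    · exact hx
    · by_contra hlt
      exact (hψ.fst_pos 4 (not_le.1 hlt)).ne' hx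
  · simpa using (hS.fst_pos 0 (hpos _)).le
  · obtain ⟨e0, e1⟩ := diamond_of_mem_upper hc.1 hc.2
    have habs : |1 - c| ≤ 1 := abs_le.2 ⟨by linarith [hc.2], by linarith [hc.1]⟩
    simp only [diamond_add_four_mul]
    rw [straightening, if_pos (by rw [e1]; exact mul_nonneg (hpos _).le (by linarith)),
      pageMap_polar _ _ (hpos _) (abs_diamond_add_abs_diamond c), e0, e1, sub_sub_cancel,
      Prod.mk.eta, hωp i c ⟨hc.1, hc.2.trans (by norm_num)⟩]
  · obtain ⟨e0, e1⟩ := diamond_of_mem_lower hc.1 hc.2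
    have habs : |c - 3| ≤ 1 := abs_le.2 ⟨by linarith [hc.1], by linarith [hc.2]⟩
    simp only [diamond_add_four_mul]
    rw [straightening_of_nonpos hω hχ hωχ (by
        rw [e1]; nlinarith [hpos (c + 4 * i)]),
      pageMap_polar _ _ (hpos _) (abs_diamond_add_abs_diamond c), e0, e1, add_sub_cancel,
      Prod.mk.eta, hωp i c ⟨(by norm_num : (0 : ℝ) ≤ 2).trans hc.1, hc.2⟩, layerMap]
    have hb := hM i
    have hb0 : 0 < (b i).1 := hS.fst_pos 0 (hpos _)
    have : κ ((b i).1 * -(1 - |c - 3|)) = 4 := hκ _ (by nlinarith [abs_nonneg (c - 3)])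
    simp only [χ, this]
    rw [mul_neg]

/-! ### General position -/

/-- A piecewise affine function with compact support, vanishing on a given finite set only, as far
as points of norm less than `R` are concerned: it measures the distance from this set. -/
theorem exists_tilt_height (S : Finset (ℝ × ℝ)) (R : ℝ) :
    ∃ k : ℝ × ℝ → ℝ, LipschitzWith 1 k ∧ (∀ q, 0 ≤ k q) ∧ (∀ q, R ≤ ‖q‖ → k q = 0) ∧
      (∀ e ∈ S, ∀ q, k q ≤ ‖q - e‖) ∧ (∀ q ∉ S, ‖q‖ < R → 0 < k q) ∧
      ∀ x z : ℝ → ℝ, LocallyPiecewiseAffine x → LocallyPiecewiseAffine z →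
        LocallyPiecewiseAffine fun t => k (x t, z t) := by
  classical
  induction S using Finset.induction_on with
  | empty =>
    refine ⟨fun q => max (R - ‖q - 0‖) 0, lipschitzWith_bump R 0, fun q => le_max_right _ _,
      fun q hq => max_eq_right (by simpa using hq), by simp,
      fun q _ hq => lt_max_of_lt_left (by simpa using hq), fun x z hx hz =>
      ((LocallyPiecewiseAffine.const R).sub (hx.norm_sub hz 0)).max_zero⟩
  | insert e S _ ih =>
    obtain ⟨k, h1, h2, h3, h4, h5, h6⟩ := ih
    have hl : LipschitzWith 1 fun q : ℝ × ℝ => ‖q - e‖ := by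
      simpa [dist_eq_norm] using LipschitzWith.dist_left e
    refine ⟨fun q => min (k q) ‖q - e‖, by simpa using h1.min hl,
      fun q => le_min (h2 q) (norm_nonneg _), fun q hq => ?_, ?_, fun q hq hqR => ?_,
      fun x z hx hz => (h6 x z hx hz).min (hx.norm_sub hz e)⟩
    · simp only [h3 q hq]; exact min_eq_left (norm_nonneg _)
    · intro e' he' q
      rcases Finset.mem_insert.1 he' with rfl | he'
      · exact min_le_right _ _
      · exact (min_le_left _ _).trans (h4 e' he' q)
    · rw [Finset.mem_insert, not_or] at hq
      exact lt_min (h5 q hq.2 hqR) (norm_pos_iff.2 (sub_ne_zero.2 hq.1))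

/-- The map of Euclidean space, in coordinates `(x, y, z)`, which raises the points of the layers
with `-M ≤ y ≤ 0` by `δ * k (x, z)`, and the other ones less, if at all. -/
noncomputable def tiltMap (k : ℝ × ℝ → ℝ) (δ M : ℝ) (p : ℝ × ℝ × ℝ) : ℝ × ℝ × ℝ :=
  (p.1, p.2.1, p.2.2 + δ * max (k (p.1, p.2.2) - max p.2.1 0 - max (-p.2.1 - M) 0) 0)

theorem tiltMap_of_upper {k : ℝ × ℝ → ℝ} {δ M x y z : ℝ} (h : k (x, z) ≤ y) :
    tiltMap k δ M (x, y, z) = (x, y, z) := by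
  have h1 : k (x, z) - max y 0 - max (-y - M) 0 ≤ 0 := by
    linarith [le_max_left y 0, le_max_right (-y - M) 0]
  simp only [tiltMap, max_eq_right h1, mul_zero, add_zero]

theorem tiltMap_of_lower {k : ℝ × ℝ → ℝ} (hk : ∀ q, 0 ≤ k q) {δ M x y z : ℝ} (h0 : y ≤ 0)
    (h1 : -M ≤ y) : tiltMap k δ M (x, y, z) = (x, y, z + δ * k (x, z)) := by
  simp only [tiltMap, max_eq_right h0, max_eq_right (show -y - M ≤ 0 by linarith), sub_zero,
    max_eq_left (hk (x, z))]

theorem isCompactlySupportedBijection_tiltMap {k : ℝ × ℝ → ℝ} (hk : LipschitzWith 1 k) {R : ℝ}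
    (hR : ∀ q, R ≤ ‖q‖ → k q = 0) {δ : ℝ} (h0 : 0 ≤ δ) (h1 : δ < 1 / 3) (M : ℝ) :
    IsCompactlySupportedBijection (tiltMap k δ M) := by
  let u : ℝ × ℝ × ℝ → ℝ := fun p =>
    max (k (p.1, p.2.2) - max p.2.1 0 - max (-p.2.1 - M) 0) 0
  have hu : LipschitzWith 3 u := by
    refine LipschitzWith.of_dist_le_mul fun p q => ?_
    rw [Real.dist_eq]
    have e1 : |k (p.1, p.2.2) - k (q.1, q.2.2)| ≤ dist p q := by
      have := hk.dist_le_mul (p.1, p.2.2) (q.1, q.2.2)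
      rw [NNReal.coe_one, one_mul, Real.dist_eq] at this
      exact this.trans (max_le (le_max_left _ _) ((le_max_right _ _).trans (le_max_right _ _)))
    have e2 : |p.2.1 - q.2.1| ≤ dist p q := by
      rw [← Real.dist_eq]
      exact (le_max_left (dist p.2.1 q.2.1) (dist p.2.2 q.2.2)).trans
        (le_max_right (dist p.1 q.1) (dist p.2 q.2))
    have e3 : |max p.2.1 0 - max q.2.1 0| ≤ dist p q := (abs_max_sub_max_le_abs _ _ _).trans e2
    have e4 : |max (-p.2.1 - M) 0 - max (-q.2.1 - M) 0| ≤ dist p q := by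
      refine (abs_max_sub_max_le_abs _ _ _).trans ?_
      rw [show -p.2.1 - M - (-q.2.1 - M) = -(p.2.1 - q.2.1) by ring, abs_neg]
      exact e2
    refine (abs_max_sub_max_le_abs _ _ _).trans ?_
    rw [abs_le] at e1 e3 e4 ⊢
    change -(3 * dist p q) ≤ _ ∧ _ ≤ 3 * dist p q
    constructor <;> linarith [e1.1, e1.2, e3.1, e3.2, e4.1, e4.2]
  have hform : tiltMap k δ M = fun p => p + ((0, 0, δ * u p) : ℝ × ℝ × ℝ) := by
    funext p
    exact Prod.ext (add_zero _).symm (Prod.ext (add_zero _).symm rfl)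
  have hg : LipschitzWith (δ * 3).toNNReal fun p => ((0, 0, δ * u p) : ℝ × ℝ × ℝ) := by
    refine LipschitzWith.of_dist_le_mul fun p q => ?_
    rw [Real.coe_toNNReal _ (by linarith)]
    have : dist (δ * u p) (δ * u q) ≤ δ * 3 * dist p q := by
      rw [Real.dist_eq, ← mul_sub, abs_mul, abs_of_nonneg h0, mul_assoc]
      exact mul_le_mul_of_nonneg_left (hu.dist_le_mul p q) h0
    have hn : (0 : ℝ) ≤ δ * 3 * dist p q := by positivity
    rw [Prod.dist_eq, Prod.dist_eq, dist_self]
    exact max_le hn (max_le hn this)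
  refine ⟨?_, ?_, max R (max M R + R), fun p hp => ?_⟩
  · rw [hform]
    exact continuous_id.add hg.continuous
  · rw [hform]
    exact bijective_add_of_lipschitzWith (by rw [Real.toNNReal_lt_one]; linarith) hg
  · suffices hz : k (p.1, p.2.2) - max p.2.1 0 - max (-p.2.1 - M) 0 ≤ 0 by
      simp only [tiltMap, max_eq_right hz, mul_zero, add_zero]
    rcases le_or_gt R ‖((p.1, p.2.2) : ℝ × ℝ)‖ with h | h
    · rw [hR _ h]; linarith [le_max_right p.2.1 0, le_max_right (-p.2.1 - M) 0]
    · -- the value of `k` is at most `R`, the depth is at least `R` or at most `-M - R`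
      have hR0 : 0 < R := (norm_nonneg _).trans_lt h
      have hkR : k (p.1, p.2.2) ≤ R := by
        have h' : k (p.1 + R, p.2.2) = 0 ∨ k (p.1 - R, p.2.2) = 0 := by
          rcases le_total 0 p.1 with hx | hx
          · left; exact hR _ ((show R ≤ |p.1 + R| by
              rw [abs_of_nonneg (by linarith)]; linarith).trans (le_max_left _ _))
          · right; exact hR _ ((show R ≤ |p.1 - R| by
              rw [abs_of_nonpos (by linarith)]; linarith).trans (le_max_left _ _))
        rcases h' with h' | h'
        · have e := hk.dist_le_mul (p.1, p.2.2) (p.1 + R, p.2.2)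
          rw [h', Prod.dist_eq, Real.dist_eq, Real.dist_eq, dist_self] at e
          simp only [sub_zero, sub_add_cancel_left, abs_neg, abs_of_pos hR0, NNReal.coe_one,
            one_mul, max_eq_left hR0.le] at e
          exact (le_abs_self _).trans e
        · have e := hk.dist_le_mul (p.1, p.2.2) (p.1 - R, p.2.2)
          rw [h', Prod.dist_eq, Real.dist_eq, Real.dist_eq, dist_self] at e
          simp only [sub_zero, sub_sub_cancel, abs_of_pos hR0, NNReal.coe_one,
            one_mul, max_eq_left hR0.le] at e
          exact (le_abs_self _).trans e
      have e1 : |p.1| ≤ ‖((p.1, p.2.2) : ℝ × ℝ)‖ := le_max_left _ _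
      have e2 : |p.2.2| ≤ ‖((p.1, p.2.2) : ℝ × ℝ)‖ := le_max_right _ _
      have e4 : max M R + R ≤ |p.2.1| := by
        have e3 : max M R + R ≤ max |p.1| (max |p.2.1| |p.2.2|) := (le_max_right _ _).trans hp
        rcases le_max_iff.1 e3 with h5 | h5
        · linarith [le_max_right M R]
        · rcases le_max_iff.1 h5 with h5 | h5
          · exact h5
          · linarith [le_max_right M R]
      rcases le_total 0 p.2.1 with hy | hy
      · rw [abs_of_nonneg hy] at e4
        linarith [le_max_left p.2.1 0, le_max_right (-p.2.1 - M) 0, le_max_right M R]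
      · rw [abs_of_nonpos hy] at e4
        linarith [le_max_right p.2.1 0, le_max_left (-p.2.1 - M) 0, le_max_left M R]

theorem bijective_shift_snd {k : ℝ × ℝ → ℝ} (hk : LipschitzWith 1 k) {δ : ℝ} (h0 : 0 ≤ δ)
    (h1 : δ < 1) : Function.Bijective fun q : ℝ × ℝ => (q.1, q.2 + δ * k q) := by
  have hform : (fun q : ℝ × ℝ => (q.1, q.2 + δ * k q)) =
      fun q => q + ((0, δ * k q) : ℝ × ℝ) := by
    funext q
    exact Prod.ext (add_zero _).symm rfl
  rw [hform]
  refine bijective_add_of_lipschitzWith (κ := δ.toNNReal) (by rwa [Real.toNNReal_lt_one]) ?_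
  refine LipschitzWith.of_dist_le_mul fun p q => ?_
  rw [Real.coe_toNNReal _ h0]
  have := hk.dist_le_mul p q
  rw [NNReal.coe_one, one_mul, Real.dist_eq] at this
  rw [Prod.dist_eq, dist_self, Real.dist_eq, ← mul_sub, abs_mul, abs_of_nonneg h0]
  exact max_le (by positivity) (by gcongr)

theorem exists_nat_lt_of_periodic {X : Type*} {b : ℤ → X} {N : ℕ} (hN : 0 < N)
    (hb : ∀ i, b (i + N) = b i) (i : ℤ) : ∃ j : Fin N, b i = b (j : ℕ) := by
  have hNz : (0 : ℤ) < N := by exact_mod_cast hN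
  have h0 := Int.emod_nonneg i hNz.ne'
  refine ⟨⟨(i % N).toNat, by have := Int.emod_lt_of_pos i hNz; omega⟩, ?_⟩
  change b i = b (((i % N).toNat : ℕ) : ℤ)
  rw [Int.toNat_of_nonneg h0]
  have hp : Function.Periodic b N := hb
  have := hp.int_mul (i / N) (i % N)
  rw [← this]
  congr 1
  rw [mul_comm]; exact (Int.emod_add_mul_ediv i N).symm

theorem eq_of_dvd_of_periodic {X : Type*} {b : ℤ → X} {N : ℕ} (hb : ∀ i, b (i + N) = b i)
    {i j : ℤ} (h : (N : ℤ) ∣ i - j) : b i = b j := by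
  obtain ⟨k, hk⟩ := h
  have hp : Function.Periodic b N := hb
  rw [show i = j + k * N by linarith]
  exact hp.int_mul k j

/-- General position of a straightened closed braid with respect to the projection along the
`y`-axis: the finitely many vertices `s` of the lower arcs do not project to the lines containing
the projections of the upper arcs. -/
structure IsGeneric (b : ℤ → ℝ × ℝ) (G : ℝ × ℝ → ℝ × ℝ) (S : Finset ℝ) : Prop where
  mem_Ioo : ∀ s ∈ S, s ∈ Set.Ioo (2 : ℝ) 4
  three_mem : (3 : ℝ) ∈ S
  affine : ∀ (i : ℤ) (x y : ℝ), 2 ≤ x → x < y → y ≤ 4 → (∀ s ∈ S, s ≤ x ∨ y ≤ s) →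
    ∃ m : ℝ × ℝ, ∀ t ∈ Set.Icc x y,
      G ((b i).1 * (t - 3), (b i).2) = G ((b i).1 * (x - 3), (b i).2) + (t - x) • m
  ne : ∀ s ∈ S, ∀ i j : ℤ, (G ((b i).1 * (s - 3), (b i).2)).2 ≠ (b j).2

/-- The endpoints of the arcs are the only points of the lower arcs projecting to endpoints. -/
theorem IsStraightened.apply_ne_endpoint {N : ℕ} {b : ℤ → ℝ × ℝ} {G : ℝ × ℝ → ℝ × ℝ}
    {F : ℝ → ℝ × ℝ × ℝ} (h : IsStraightened N b G F) {i j : ℤ} {s : ℝ}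
    (hs : s ∈ Set.Ioo (2 : ℝ) 4) :
    G ((b i).1 * (s - 3), (b i).2) ≠ b j ∧
      G ((b i).1 * (s - 3), (b i).2) ≠ (-(b j).1, (b j).2) := by
  constructor
  · intro he
    have h1 := h.apply_base (j - 1)
    rw [sub_add_cancel, ← he] at h1
    have h2 := h.bijective.1 h1
    have h2' : (b (j - 1)).2 = (b i).2 := (Prod.ext_iff.1 h2).2
    have h3 : b (j - 1) = b i := eq_of_dvd_of_periodic h.base_periodic
      (h.base_separated _ _ h2')
    rw [h3] at h2
    have h4 := congrArg Prod.fst h2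
    simp only at h4
    nlinarith [h.base_pos i, hs.1, hs.2]
  · intro he
    rw [← h.apply_base_neg j] at he
    have h2 := h.bijective.1 he
    have h2' : (b i).2 = (b j).2 := (Prod.ext_iff.1 h2).2
    have h3 : b i = b j := eq_of_dvd_of_periodic h.base_periodic
      (h.base_separated _ _ h2')
    rw [h3] at h2
    have h4 := congrArg Prod.fst h2
    simp only at h4
    nlinarith [h.base_pos j, hs.1, hs.2]

/-- A straightened closed braid can be put in general position. The vertices of its lower arcs
are raised by amounts proportional to a parameter `δ`, only finitely many values of which are
excluded. -/
theorem IsStraightened.exists_generic {N : ℕ} (hN : 0 < N) {b : ℤ → ℝ × ℝ} {G : ℝ × ℝ → ℝ × ℝ}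
    {F : ℝ → ℝ × ℝ × ℝ} (h : IsStraightened N b G F) :
    ∃ τ G' S, IsCompactlySupportedBijection τ ∧ IsStraightened N b G' (fun a => τ (F a)) ∧
      IsGeneric b G' S := by
  classical
  let γ : ℤ → ℝ → ℝ × ℝ := fun i c => G ((b i).1 * (c - 3), (b i).2)
  have hlin : ∀ i, LocallyPiecewiseAffine fun c => (b i).1 * (c - 3) := fun i =>
    (LocallyPiecewiseAffine.id.sub (.const 3)).const_mul _
  have hγ : ∀ i, LocallyPiecewiseAffine (fun c => (γ i c).1) ∧
      LocallyPiecewiseAffine fun c => (γ i c).2 := fun i =>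
    h.piecewiseAffine _ _ (hlin i) (.const _)
  obtain ⟨R, hR⟩ : ∃ R, ∀ i : Fin N, ∀ c ∈ Set.Icc (2 : ℝ) 4, ‖γ (i : ℕ) c‖ < R := by
    have : ∀ᶠ R in Filter.atTop, ∀ i : Fin N, ∀ c ∈ Set.Icc (2 : ℝ) 4, ‖γ (i : ℕ) c‖ < R := by
      rw [Filter.eventually_all]
      intro i
      have hc : Continuous (γ (i : ℕ)) := (hγ _).1.continuous.prodMk (hγ _).2.continuous
      obtain ⟨C, hC⟩ := (isCompact_Icc (a := (2 : ℝ)) (b := 4)).exists_bound_of_continuousOn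
        hc.continuousOn
      filter_upwards [Filter.eventually_gt_atTop C] with R hR c hcI
      exact (hC c hcI).trans_lt hR
    exact this.exists
  obtain ⟨M, hM⟩ : ∃ M, ∀ i, (b i).1 ≤ M := by
    obtain ⟨M, hM⟩ := (Set.finite_range fun j : Fin N => (b (j : ℕ)).1).bddAbove
    refine ⟨M, fun i => ?_⟩
    obtain ⟨j, hj⟩ := exists_nat_lt_of_periodic hN h.base_periodic i
    rw [hj]; exact hM ⟨j, rfl⟩
  let ends : Finset (ℝ × ℝ) := Finset.univ.image (fun j : Fin N => b (j : ℕ)) ∪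
    Finset.univ.image (fun j : Fin N => (-(b (j : ℕ)).1, (b (j : ℕ)).2))
  have hends : ∀ i, b i ∈ ends ∧ (-(b i).1, (b i).2) ∈ ends := by
    intro i
    obtain ⟨j, hj⟩ := exists_nat_lt_of_periodic hN h.base_periodic i
    rw [hj]
    exact ⟨Finset.mem_union_left _ (Finset.mem_image_of_mem _ (Finset.mem_univ j)),
      Finset.mem_union_right _ (Finset.mem_image_of_mem
        (fun j : Fin N => (-(b (j : ℕ)).1, (b (j : ℕ)).2)) (Finset.mem_univ j))⟩
  obtain ⟨k, hkl, hk0, hkR, hke, hkpos, hkp⟩ := exists_tilt_height ends R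
  have hκ : ∀ i, LocallyPiecewiseAffine fun c => k (γ i c) := fun i => hkp _ _ (hγ i).1 (hγ i).2
  choose S₁ hS₁ using fun i : Fin N => (hγ (i : ℕ)).1.exists_breakpoints 2 4
  choose S₂ hS₂ using fun i : Fin N => (hγ (i : ℕ)).2.exists_breakpoints 2 4
  choose S₃ hS₃ using fun i : Fin N => (hκ (i : ℕ)).exists_breakpoints 2 4
  let S : Finset ℝ := ({3} ∪ Finset.univ.biUnion fun i => S₁ i ∪ S₂ i ∪ S₃ i).filter
    fun s => s ∈ Set.Ioo (2 : ℝ) 4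
  have hSmem : ∀ s ∈ S, s ∈ Set.Ioo (2 : ℝ) 4 := fun s hs => (Finset.mem_filter.1 hs).2
  have hSsub : ∀ (i : Fin N) (x y : ℝ), 2 ≤ x → y ≤ 4 → (∀ s ∈ S, s ≤ x ∨ y ≤ s) →
      ∀ s ∈ S₁ i ∪ S₂ i ∪ S₃ i, s ≤ x ∨ y ≤ s := by
    intro i x y hx hy hS s hs
    by_cases hs' : s ∈ Set.Ioo (2 : ℝ) 4
    · exact hS s (Finset.mem_filter.2 ⟨Finset.mem_union_right _
        (Finset.mem_biUnion.2 ⟨i, Finset.mem_univ i, hs⟩), hs'⟩)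
    · by_contra hcon
      push Not at hcon
      exact hs' ⟨hx.trans_lt hcon.1, hcon.2.trans_le hy⟩
  have hkγ : ∀ s ∈ S, ∀ i : Fin N, 0 < k (γ (i : ℕ) s) := by
    intro s hs i
    refine hkpos _ (fun hmem => ?_) (hR i s ⟨(hSmem s hs).1.le, (hSmem s hs).2.le⟩)
    rcases Finset.mem_union.1 hmem with hmem | hmem
    · obtain ⟨j, -, hj⟩ := Finset.mem_image.1 hmem
      exact (h.apply_ne_endpoint (hSmem s hs)).1 hj.symm
    · obtain ⟨j, -, hj⟩ := Finset.mem_image.1 hmem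
      exact (h.apply_ne_endpoint (hSmem s hs)).2 hj.symm
  have hbad : (⋃ (i : Fin N) (j : Fin N) (s : S),
      {δ : ℝ | (γ (i : ℕ) s).2 + δ * k (γ (i : ℕ) s) = (b (j : ℕ)).2}).Finite := by
    refine Set.finite_iUnion fun i => Set.finite_iUnion fun j => Set.finite_iUnion fun s =>
      Set.Subsingleton.finite ?_
    intro δ hδ ε hε
    have h1 : (γ (i : ℕ) s).2 + δ * k (γ (i : ℕ) s) = (b (j : ℕ)).2 := hδ
    have h2 : (γ (i : ℕ) s).2 + ε * k (γ (i : ℕ) s) = (b (j : ℕ)).2 := hε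
    exact mul_right_cancel₀ (hkγ s s.2 i).ne' (by linarith)
  obtain ⟨δ, hδ, hδn⟩ :=
    (Set.Ioo_infinite (show (0 : ℝ) < 1 / 3 by norm_num)).exists_notMem_finite hbad
  let T : ℝ × ℝ → ℝ × ℝ := fun q => (q.1, q.2 + δ * k q)
  have hTends : ∀ e ∈ ends, T e = e := fun e he => by
    have : k e = 0 := le_antisymm (by simpa using hke e he e) (hk0 e)
    simp [T, this]
  refine ⟨tiltMap k δ M, T ∘ G, S,
    isCompactlySupportedBijection_tiltMap hkl hkR hδ.1.le hδ.2 M,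
    ⟨h.base_periodic, h.base_pos, h.base_separated,
      (bijective_shift_snd hkl hδ.1.le (by linarith [hδ.2])).comp h.bijective, ?_, fun i => ?_,
      fun x hx => h.fst_eq_zero x hx, fun i => ?_, fun i c hc => ?_, fun i c hc => ?_⟩,
    ⟨hSmem, ?_, ?_, ?_⟩⟩
  · refine IsPiecewiseAffineMap.comp (fun x z hx hz => ⟨hx, ?_⟩) h.piecewiseAffine
    exact hz.add ((hkp x z hx hz).const_mul δ)
  · rw [Function.comp, h.apply_base, hTends _ (hends _).1]
  · rw [Function.comp, h.apply_base_neg, hTends _ (hends _).2]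
  · rw [h.upper i c hc]
    have hb := h.base_pos i
    refine tiltMap_of_upper ?_
    rcases le_total c 1 with hc1 | hc1
    · refine (hke _ (hends i).1 _).trans ?_
      rw [abs_of_nonneg (by linarith)]
      refine max_le ?_ ?_
      · change |(b i).1 * (1 - c) - (b i).1| ≤ _
        rw [show (b i).1 * (1 - c) - (b i).1 = -((b i).1 * c) by ring, abs_neg,
          abs_of_nonneg (mul_nonneg hb.le hc.1)]
        linarith
      · change |(b i).2 - (b i).2| ≤ _
        rw [sub_self, abs_zero]; exact mul_nonneg hb.le (by linarith [hc.1])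
    · refine (hke _ (hends i).2 _).trans ?_
      rw [abs_of_nonpos (by linarith)]
      refine max_le ?_ ?_
      · change |(b i).1 * (1 - c) - -(b i).1| ≤ _
        rw [show (b i).1 * (1 - c) - -(b i).1 = (b i).1 * (2 - c) by ring,
          abs_of_nonneg (mul_nonneg hb.le (by linarith [hc.2]))]
        linarith
      · change |(b i).2 - (b i).2| ≤ _
        rw [sub_self, abs_zero]; exact mul_nonneg hb.le (by linarith [hc.2])
  · rw [h.lower i c hc]
    have hb := h.base_pos i
    have habs : |c - 3| ≤ 1 := abs_le.2 ⟨by linarith [hc.1], by linarith [hc.2]⟩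
    refine tiltMap_of_lower hk0 ?_ ?_
    · nlinarith
    · nlinarith [hM i, abs_nonneg (c - 3)]
  · exact Finset.mem_filter.2 ⟨Finset.mem_union_left _ (Finset.mem_singleton_self 3), by norm_num⟩
  · intro i x y hx hxy hy hn
    obtain ⟨j, hj⟩ := exists_nat_lt_of_periodic hN h.base_periodic i
    have hsub := hSsub j x y hx hy hn
    obtain ⟨m₁, h1⟩ := hS₁ j x y hx hxy hy fun s hs => hsub s
      (Finset.mem_union_left _ (Finset.mem_union_left _ hs))
    obtain ⟨m₂, h2⟩ := hS₂ j x y hx hxy hy fun s hs => hsub s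
      (Finset.mem_union_left _ (Finset.mem_union_right _ hs))
    obtain ⟨m₃, h3⟩ := hS₃ j x y hx hxy hy fun s hs => hsub s (Finset.mem_union_right _ hs)
    refine ⟨(m₁, m₂ + δ * m₃), fun t ht => ?_⟩
    rw [hj]
    change T (γ (j : ℕ) t) = T (γ (j : ℕ) x) + _
    have e1 := h1 t ht
    have e2 := h2 t ht
    have e3 := h3 t ht
    refine Prod.ext ?_ ?_
    · change (γ (j : ℕ) t).1 = (γ (j : ℕ) x).1 + (t - x) * m₁
      rw [e1]; ring
    · change (γ (j : ℕ) t).2 + δ * k (γ (j : ℕ) t) =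
        (γ (j : ℕ) x).2 + δ * k (γ (j : ℕ) x) + (t - x) * (m₂ + δ * m₃)
      rw [e2, e3]; ring
  · intro s hs i j he
    obtain ⟨i', hi⟩ := exists_nat_lt_of_periodic hN h.base_periodic i
    obtain ⟨j', hj⟩ := exists_nat_lt_of_periodic hN h.base_periodic j
    rw [hi, hj] at he
    exact hδn (Set.mem_iUnion.2 ⟨i', Set.mem_iUnion.2 ⟨j', Set.mem_iUnion.2 ⟨⟨s, hs⟩, he⟩⟩⟩)

/-! ### Change of the direction of projection -/

/-- The rotation about the `x`-axis by the angle `φ`, in coordinates `(x, y, z)`, where `φ` is a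
right angle within a large ball and decreases to zero outside of it. -/
noncomputable def cutoffRotation (B : ℝ) (p : ℝ × ℝ × ℝ) : ℝ × ℝ × ℝ :=
  let φ := Real.pi / 2 * max 0 (min 1 (B - (p.1 ^ 2 + p.2.1 ^ 2 + p.2.2 ^ 2)))
  (p.1, p.2.1 * Real.cos φ - p.2.2 * Real.sin φ, p.2.1 * Real.sin φ + p.2.2 * Real.cos φ)

theorem isCompactlySupportedBijection_cutoffRotation (B : ℝ) :
    IsCompactlySupportedBijection (cutoffRotation B) := by
  have hrot : ∀ (y z φ : ℝ), (y * Real.cos φ - z * Real.sin φ) ^ 2 +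
      (y * Real.sin φ + z * Real.cos φ) ^ 2 = y ^ 2 + z ^ 2 := by
    intro y z φ
    linear_combination (y ^ 2 + z ^ 2) * Real.sin_sq_add_cos_sq φ
  let ang : ℝ × ℝ × ℝ → ℝ := fun p =>
    Real.pi / 2 * max 0 (min 1 (B - (p.1 ^ 2 + p.2.1 ^ 2 + p.2.2 ^ 2)))
  have hform : ∀ p, cutoffRotation B p = (p.1, p.2.1 * Real.cos (ang p) - p.2.2 * Real.sin (ang p),
      p.2.1 * Real.sin (ang p) + p.2.2 * Real.cos (ang p)) := fun _ => rfl
  let inv : ℝ × ℝ × ℝ → ℝ × ℝ × ℝ := fun p =>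
    (p.1, p.2.1 * Real.cos (ang p) + p.2.2 * Real.sin (ang p),
      -p.2.1 * Real.sin (ang p) + p.2.2 * Real.cos (ang p))
  have hang : ∀ x y z y' z' : ℝ, y' ^ 2 + z' ^ 2 = y ^ 2 + z ^ 2 →
      ang (x, y', z') = ang (x, y, z) := by
    intro x y z y' z' h
    simp only [ang]
    rw [add_assoc, h, ← add_assoc]
  refine ⟨?_, Function.bijective_iff_has_inverse.2 ⟨inv, ?_, ?_⟩, |B| + 1, fun p hp => ?_⟩
  · unfold cutoffRotation
    fun_prop
  · rintro ⟨x, y, z⟩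
    have e := hang x y z _ _ (hrot y z (ang (x, y, z)))
    rw [hform]
    simp only [inv, e]
    have hs := Real.sin_sq_add_cos_sq (ang (x, y, z))
    refine Prod.ext rfl (Prod.ext ?_ ?_)
    · simp only; linear_combination y * hs
    · simp only; linear_combination z * hs
  · rintro ⟨x, y, z⟩
    have e := hang x y z (y * Real.cos (ang (x, y, z)) + z * Real.sin (ang (x, y, z)))
      (-y * Real.sin (ang (x, y, z)) + z * Real.cos (ang (x, y, z))) (by
        linear_combination (y ^ 2 + z ^ 2) * Real.sin_sq_add_cos_sq (ang (x, y, z)))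
    simp only [inv, hform, e]
    have hs := Real.sin_sq_add_cos_sq (ang (x, y, z))
    refine Prod.ext rfl (Prod.ext ?_ ?_)
    · simp only; linear_combination y * hs
    · simp only; linear_combination z * hs
  · have h1 : B ≤ p.1 ^ 2 + p.2.1 ^ 2 + p.2.2 ^ 2 := by
      have h2 : |B| + 1 ≤ max |p.1| (max |p.2.1| |p.2.2|) := hp
      have h3 : ∀ u : ℝ, |B| + 1 ≤ |u| → B ≤ u ^ 2 := fun u hu => by
        rw [← sq_abs]; nlinarith [le_abs_self B, abs_nonneg B]
      rcases le_max_iff.1 h2 with h | h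
      · nlinarith [h3 _ h, sq_nonneg p.2.1, sq_nonneg p.2.2]
      · rcases le_max_iff.1 h with h | h
        · nlinarith [h3 _ h, sq_nonneg p.1, sq_nonneg p.2.2]
        · nlinarith [h3 _ h, sq_nonneg p.1, sq_nonneg p.2.1]
    have h0 : ang p = 0 := by
      simp only [ang]
      rw [max_eq_left ((min_le_right _ _).trans (by linarith)), mul_zero]
    rw [hform, h0]
    simp

theorem cutoffRotation_of_le {B x y z : ℝ} (h : x ^ 2 + y ^ 2 + z ^ 2 ≤ B - 1) :
    cutoffRotation B (x, y, z) = (x, -z, y) := by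
  have h1 : max 0 (min 1 (B - (x ^ 2 + y ^ 2 + z ^ 2))) = 1 := by
    rw [min_eq_left (by linarith), max_eq_right zero_le_one]
  simp [cutoffRotation, h1]

/-- The point of Euclidean space with given coordinates. -/
noncomputable def pointOfCoords (p : ℝ × ℝ × ℝ) : E3 := !₂[p.1, p.2.1, p.2.2]

/-- The coordinates of a point of Euclidean space. -/
def coordsOfPoint (p : E3) : ℝ × ℝ × ℝ := (p 0, p 1, p 2)

theorem coordsOfPoint_pointOfCoords (p : ℝ × ℝ × ℝ) : coordsOfPoint (pointOfCoords p) = p := by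
  simp [coordsOfPoint, pointOfCoords]

theorem pointOfCoords_coordsOfPoint (p : E3) : pointOfCoords (coordsOfPoint p) = p := by
  ext i
  fin_cases i <;> simp [coordsOfPoint, pointOfCoords]

theorem continuous_coordsOfPoint : Continuous coordsOfPoint := by
  unfold coordsOfPoint
  fun_prop

theorem continuous_pointOfCoords : Continuous pointOfCoords := by
  refine (PiLp.continuous_toLp 2 _).comp (continuous_pi fun i => ?_)
  fin_cases i
  · exact continuous_fst
  · exact continuous_fst.comp continuous_snd
  · exact continuous_snd.comp continuous_snd

theorem IsCompactlySupportedBijection.conj_coords {f : ℝ × ℝ × ℝ → ℝ × ℝ × ℝ}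
    (hf : IsCompactlySupportedBijection f) :
    IsCompactlySupportedBijection fun p => pointOfCoords (f (coordsOfPoint p)) := by
  obtain ⟨R, hR⟩ := hf.exists_radius
  have b1 : Function.Bijective coordsOfPoint := Function.bijective_iff_has_inverse.2
    ⟨pointOfCoords, pointOfCoords_coordsOfPoint, coordsOfPoint_pointOfCoords⟩
  have b2 : Function.Bijective pointOfCoords := Function.bijective_iff_has_inverse.2
    ⟨coordsOfPoint, coordsOfPoint_pointOfCoords, pointOfCoords_coordsOfPoint⟩
  refine ⟨continuous_pointOfCoords.comp (hf.continuous.comp continuous_coordsOfPoint),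
    b2.comp (hf.bijective.comp b1), 2 * |R|, fun p hp => ?_⟩
  rw [hR, pointOfCoords_coordsOfPoint]
  by_contra hlt
  rw [not_le] at hlt
  have h0 : |p 0| ≤ ‖coordsOfPoint p‖ := le_max_left _ _
  have h1 : |p 1| ≤ ‖coordsOfPoint p‖ := (le_max_left _ _).trans (le_max_right _ _)
  have h2 : |p 2| ≤ ‖coordsOfPoint p‖ := (le_max_right _ _).trans (le_max_right _ _)
  have hR0 : ‖coordsOfPoint p‖ < |R| := hlt.trans_le (le_abs_self R)
  have hn := EuclideanSpace.norm_sq_eq p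
  rw [Fin.sum_univ_three] at hn
  simp only [Real.norm_eq_abs] at hn
  have hpos := abs_nonneg R
  have s : ∀ u : ℝ, |u| ≤ ‖coordsOfPoint p‖ → |u| ^ 2 < |R| ^ 2 := fun u hu => by
    nlinarith [abs_nonneg u]
  nlinarith [s _ h0, s _ h1, s _ h2]

/-! ### The diagram of a straightened closed braid -/

/-- Finitely many breakpoints in one period, enumerated by the integers. -/
theorem exists_periodic_enumeration (S : Finset ℝ) (hS : ∀ s ∈ S, s ∈ Set.Ico (0 : ℝ) 4)
    (h0 : (0 : ℝ) ∈ S) :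
    ∃ (K : ℕ) (β : ℤ → ℝ), 0 < K ∧ StrictMono β ∧ (∀ k, β (k + K) = β k + 4) ∧
      (∀ k, ∃ s ∈ S, ∃ i : ℤ, β k = s + 4 * i) ∧
      ∀ k, ∃ (i : ℤ) (x y : ℝ), 0 ≤ x ∧ x < y ∧ y ≤ 4 ∧ β k = x + 4 * i ∧ β (k + 1) = y + 4 * i ∧
        ∀ s ∈ S, s ≤ x ∨ y ≤ s := by
  have hK : 0 < S.card := Finset.card_pos.2 ⟨0, h0⟩
  have hKz : (0 : ℤ) < S.card := by exact_mod_cast hK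
  let e : Fin S.card ↪o ℝ := S.orderEmbOfFin rfl
  have he : ∀ j, e j ∈ S := S.orderEmbOfFin_mem rfl
  have hsurj : ∀ s ∈ S, ∃ j, e j = s := fun s hs => by
    have : s ∈ Set.range (S.orderEmbOfFin rfl) := by
      rw [Finset.range_orderEmbOfFin]; exact hs
    exact this
  have he0 : e ⟨0, hK⟩ = 0 := by
    obtain ⟨j, hj⟩ := hsurj 0 h0
    refine le_antisymm ?_ (hS _ (he _)).1
    rw [← hj]; exact e.monotone (Nat.zero_le _)
  let r : ℤ → Fin S.card := fun k => ⟨(k % S.card).toNat, by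
    have := Int.emod_lt_of_pos k hKz
    have := Int.emod_nonneg k hKz.ne'
    omega⟩
  let β : ℤ → ℝ := fun k => e (r k) + 4 * ((k / S.card : ℤ) : ℝ)
  have hedge : ∀ k, ∃ (i : ℤ) (x y : ℝ), 0 ≤ x ∧ x < y ∧ y ≤ 4 ∧ β k = x + 4 * i ∧
      β (k + 1) = y + 4 * i ∧ ∀ s ∈ S, s ≤ x ∨ y ≤ s := by
    intro k
    have d1 := Int.mul_ediv_add_emod k S.card
    have r1 := Int.emod_nonneg k hKz.ne'
    have r2 := Int.emod_lt_of_pos k hKz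
    rcases (show k % S.card + 1 < S.card ∨ k % S.card + 1 = S.card by omega) with hr | hr
    · have hdiv : (k + 1) / (S.card : ℤ) = k / S.card := by
        rw [show k + 1 = (k % S.card + 1) + S.card * (k / S.card) by linarith,
          Int.add_mul_ediv_left _ _ hKz.ne', Int.ediv_eq_zero_of_lt (by omega) hr, zero_add]
      have hmod : (k + 1) % (S.card : ℤ) = k % S.card + 1 := by
        have := Int.mul_ediv_add_emod (k + 1) S.card
        rw [hdiv] at this; linarith
      refine ⟨k / S.card, e (r k), e (r (k + 1)), (hS _ (he _)).1, e.strictMono ?_,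
        (hS _ (he _)).2.le, rfl, ?_, fun s hs => ?_⟩
      · change (k % S.card).toNat < ((k + 1) % S.card).toNat
        omega
      · simp only [β, hdiv]
      · obtain ⟨j, rfl⟩ := hsurj s hs
        rcases le_or_gt j (r k) with hj | hj
        · exact Or.inl (e.monotone hj)
        · refine Or.inr (e.monotone ?_)
          change ((k + 1) % S.card).toNat ≤ j
          have : (k % S.card).toNat < j := hj
          omega
    · have hk : k + 1 = S.card * (k / S.card + 1) := by linarith
      have hdiv : (k + 1) / (S.card : ℤ) = k / S.card + 1 := by
        conv_lhs => rw [hk]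
        exact Int.mul_ediv_cancel_left _ hKz.ne'
      have hmod : (k + 1) % (S.card : ℤ) = 0 := by
        rw [hk]; exact Int.mul_emod_right _ _
      have hr0 : r (k + 1) = ⟨0, hK⟩ := Fin.ext (by
        change ((k + 1) % S.card).toNat = 0
        rw [hmod]; rfl)
      refine ⟨k / S.card, e (r k), 4, (hS _ (he _)).1, (hS _ (he _)).2, le_rfl, rfl, ?_,
        fun s hs => ?_⟩
      · simp only [β, hdiv, hr0, he0]; push_cast; ring
      · obtain ⟨j, rfl⟩ := hsurj s hs
        refine Or.inl (e.monotone ?_)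
        change (j : ℕ) ≤ (k % S.card).toNat
        have := j.2
        omega
  refine ⟨S.card, β, hK, strictMono_int_of_lt_succ fun k => ?_, fun k => ?_,
    fun k => ⟨_, he (r k), _, rfl⟩, hedge⟩
  · obtain ⟨i, x, y, -, hxy, -, e1, e2, -⟩ := hedge k
    rw [e1, e2]; linarith
  · have hr : r (k + S.card) = r k := Fin.ext (by
      change ((k + S.card) % S.card).toNat = (k % S.card).toNat
      rw [Int.add_emod_right])
    have hd : (k + S.card) / (S.card : ℤ) = k / S.card + 1 := by
      rw [Int.add_ediv_of_dvd_right (dvd_refl _), Int.ediv_self hKz.ne']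
    simp only [β, hr, hd]; push_cast; ring

/-- The piecewise affine interpolation of a strictly increasing sequence of real numbers. -/
theorem exists_orderIso_interpolating {β : ℤ → ℝ} (hβ : StrictMono β) {K : ℕ}
    (hper : ∀ k, β (k + K) = β k + 4) :
    ∃ B : ℝ ≃o ℝ, (∀ t, B (t + K) = B t + 4) ∧ ∀ (k : ℤ) (t : ℝ), k ≤ t → t ≤ k + 1 →
      B t = AffineMap.lineMap (β k) (β (k + 1)) (t - k) := by
  let v : ℤ → E3 := fun k => pointOfCoords (β k, 0, 0)
  let g : ℝ → ℝ := fun t => polygonalCurve v t 0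
  have hg : ∀ (k : ℤ) (t : ℝ), k ≤ t → t ≤ k + 1 →
      g t = AffineMap.lineMap (β k) (β (k + 1)) (t - k) := by
    intro k t h0 h1
    simp only [g, polygonalCurve_of_mem v k h0 h1]
    simp [v, pointOfCoords, AffineMap.lineMap_apply]
  have hgc : Continuous g :=
    (continuous_fst.comp continuous_coordsOfPoint).comp (continuous_polygonalCurve v)
  have hmono : StrictMono g := strictMono_of_strictMonoOn_Icc_int fun k s hs t ht hst => by
    rw [hg k s hs.1 hs.2, hg k t ht.1 ht.2]
    have := hβ (lt_add_one k)
    simp only [AffineMap.lineMap_apply, vsub_eq_sub, smul_eq_mul, vadd_eq_add]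
    nlinarith
  have hgp : ∀ t, g (t + K) = g t + 4 := by
    intro t
    have h0 := Int.floor_le t
    have h1 := (Int.lt_floor_add_one t).le
    rw [hg ⌊t⌋ t h0 h1, hg (⌊t⌋ + K) (t + K) (by push_cast; linarith) (by push_cast; linarith),
      hper, show ⌊t⌋ + (K : ℤ) + 1 = ⌊t⌋ + 1 + K by ring, hper]
    simp only [AffineMap.lineMap_apply, vsub_eq_sub, smul_eq_mul, vadd_eq_add]
    push_cast; ring
  exact ⟨hmono.orderIsoOfSurjective g (surjective_of_add_period hgc (by norm_num) hgp), hgp, hg⟩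

/-- A function which is affine between the points of a finite set `S` and avoids a value on `S`
takes this value finitely often. -/
theorem finite_of_affine_between {g : ℝ → ℝ} {S : Finset ℝ} (hS : S.Nonempty) {u w : ℝ}
    (hSI : ∀ s ∈ S, s ∈ Set.Icc u w)
    (haff : ∀ x y, u ≤ x → x < y → y ≤ w → (∀ s ∈ S, s ≤ x ∨ y ≤ s) →
      ∃ m : ℝ, ∀ t ∈ Set.Icc x y, g t = g x + m * (t - x)) {v : ℝ} (hv : ∀ s ∈ S, g s ≠ v) :
    {c | c ∈ Set.Icc u w ∧ g c = v}.Finite := by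
  classical
  have key : ∀ c c', u ≤ c → c < c' → c' ≤ w → g c = v → g c' = v →
      S.filter (· ≤ c) ≠ S.filter (· ≤ c') := by
    intro c c' huc hcc hcw hgc hgc' hfil
    have hgap : ∀ s ∈ S, s ≤ c ∨ c' < s := by
      intro s hs
      by_contra hcon
      push Not at hcon
      have : s ∈ S.filter (· ≤ c') := Finset.mem_filter.2 ⟨hs, hcon.2⟩
      rw [← hfil] at this
      exact absurd (Finset.mem_filter.1 this).2 (not_le.2 hcon.1)
    by_cases hne : (S.filter (· ≤ c)).Nonempty
    · -- the affine piece to the left up to a point of `S` would be constant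
      obtain ⟨s, hs, hmax⟩ := (S.filter (· ≤ c)).exists_max_image _root_.id hne
      rw [Finset.mem_filter] at hs
      obtain ⟨m, hm⟩ := haff s c' (hSI s hs.1).1 (hs.2.trans_lt hcc) hcw fun s' hs' => by
        rcases hgap s' hs' with h | h
        · exact Or.inl (hmax s' (Finset.mem_filter.2 ⟨hs', h⟩))
        · exact Or.inr h.le
      have e1 := hm c ⟨hs.2, hcc.le⟩
      have e2 := hm c' ⟨hs.2.trans hcc.le, le_rfl⟩
      have hm0 : m = 0 := by
        have : m * (c' - c) = 0 := by linarith
        exact (mul_eq_zero.1 this).resolve_right (by linarith)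
      rw [hm0, hgc] at e1
      exact hv s hs.1 (by linarith)
    · obtain ⟨s, hs, hmin⟩ := S.exists_min_image _root_.id hS
      have hc's : c' < s := by
        rcases hgap s hs with h | h
        · exact absurd ⟨s, Finset.mem_filter.2 ⟨hs, h⟩⟩ hne
        · exact h
      obtain ⟨m, hm⟩ := haff c s huc (hcc.trans hc's) (hSI s hs).2 fun s' hs' =>
        Or.inr (hmin s' hs')
      have e1 := hm c' ⟨hcc.le, hc's.le⟩
      have e2 := hm s ⟨(hcc.trans hc's).le, le_rfl⟩
      have hm0 : m = 0 := by
        have : m * (c' - c) = 0 := by linarith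
        exact (mul_eq_zero.1 this).resolve_right (by linarith)
      rw [hm0, hgc] at e2
      exact hv s hs (by linarith)
  refine Set.Finite.of_finite_image (f := fun c => S.filter (· ≤ c))
    ((S.powerset.finite_toSet).subset ?_) ?_
  · rintro _ ⟨c, -, rfl⟩
    exact Finset.mem_coe.2 (Finset.mem_powerset.2 (Finset.filter_subset _ _))
  · intro c hc c' hc' hfil
    rcases lt_trichotomy c c' with h | h | h
    · exact absurd hfil (key c c' hc.1.1 h hc'.1.2 hc.2 hc'.2)
    · exact h
    · exact absurd hfil.symm (key c' c hc'.1.1 h hc.1.2 hc'.2 hc.2)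

/-- The parameters of the upper arcs of a straightened closed braid. -/
def IsUpperParameter (a : ℝ) : Prop := ∃ i : ℤ, ∃ c ∈ Set.Icc (0 : ℝ) 2, a = c + 4 * i

/-- The parameters of the lower arcs of a straightened closed braid. -/
def IsLowerParameter (a : ℝ) : Prop := ∃ i : ℤ, ∃ c ∈ Set.Icc (2 : ℝ) 4, a = c + 4 * i

theorem isUpperParameter_or_isLowerParameter (a : ℝ) : IsUpperParameter a ∨ IsLowerParameter a := by
  obtain ⟨c, i, h0, h4, h⟩ := exists_eq_add_four_mul a
  rcases le_total c 2 with h2 | h2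
  · exact Or.inl ⟨i, c, ⟨h0, h2⟩, h⟩
  · exact Or.inr ⟨i, c, ⟨h2, h4.le⟩, h⟩

namespace IsStraightened

variable {N : ℕ} {b : ℤ → ℝ × ℝ} {G : ℝ × ℝ → ℝ × ℝ} {F : ℝ → ℝ × ℝ × ℝ}

theorem depth_nonneg (h : IsStraightened N b G F) {a : ℝ} (ha : IsUpperParameter a) :
    0 ≤ (F a).2.1 := by
  obtain ⟨i, c, hc, rfl⟩ := ha
  rw [h.upper i c hc]
  have : |1 - c| ≤ 1 := abs_le.2 ⟨by linarith [hc.2], by linarith [hc.1]⟩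
  exact mul_nonneg (h.base_pos i).le (by linarith)

theorem depth_nonpos (h : IsStraightened N b G F) {a : ℝ} (ha : IsLowerParameter a) :
    (F a).2.1 ≤ 0 := by
  obtain ⟨i, c, hc, rfl⟩ := ha
  rw [h.lower i c hc]
  have : |c - 3| ≤ 1 := abs_le.2 ⟨by linarith [hc.1], by linarith [hc.2]⟩
  exact neg_nonpos.2 (mul_nonneg (h.base_pos i).le (by linarith))

/-- The projections of the upper arcs are disjoint and simple. -/
theorem eq_of_upper (h : IsStraightened N b G F) {a a' : ℝ} (ha : IsUpperParameter a)
    (ha' : IsUpperParameter a') (hx : (F a).1 = (F a').1) (hz : (F a).2.2 = (F a').2.2) :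
    F a = F a' := by
  obtain ⟨i, c, hc, rfl⟩ := ha
  obtain ⟨j, d, hd, rfl⟩ := ha'
  rw [h.upper i c hc, h.upper j d hd] at *
  have hb : b i = b j := eq_of_dvd_of_periodic h.base_periodic (h.base_separated _ _ hz)
  rw [hb] at hx ⊢
  have := mul_left_cancel₀ (h.base_pos j).ne' hx
  rw [this]

/-- The projections of the lower arcs are disjoint and simple. -/
theorem eq_of_lower (h : IsStraightened N b G F) {a a' : ℝ} (ha : IsLowerParameter a)
    (ha' : IsLowerParameter a') (hx : (F a).1 = (F a').1) (hz : (F a).2.2 = (F a').2.2) :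
    F a = F a' := by
  obtain ⟨i, c, hc, rfl⟩ := ha
  obtain ⟨j, d, hd, rfl⟩ := ha'
  rw [h.lower i c hc, h.lower j d hd] at *
  have hG := h.bijective.1 (Prod.ext hx hz)
  rw [Prod.mk.injEq] at hG
  have hb : b i = b j := eq_of_dvd_of_periodic h.base_periodic (h.base_separated _ _ hG.2)
  rw [hb] at hG ⊢
  have := mul_left_cancel₀ (h.base_pos j).ne' hG.1
  rw [this]

/-- Of two different points with the same projection, one is on an upper arc and the other one is
on a lower arc. -/
theorem upper_lower_of_ne (h : IsStraightened N b G F) {a a' : ℝ} (hne : F a ≠ F a')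
    (hx : (F a).1 = (F a').1) (hz : (F a).2.2 = (F a').2.2) :
    (IsUpperParameter a ∧ IsLowerParameter a') ∨ (IsLowerParameter a ∧ IsUpperParameter a') := by
  rcases isUpperParameter_or_isLowerParameter a with h1 | h1 <;>
    rcases isUpperParameter_or_isLowerParameter a' with h2 | h2
  · exact absurd (h.eq_of_upper h1 h2 hx hz) hne
  · exact Or.inl ⟨h1, h2⟩
  · exact Or.inr ⟨h1, h2⟩
  · exact absurd (h.eq_of_lower h1 h2 hx hz) hne

theorem exists_snd_eq (h : IsStraightened N b G F) {a : ℝ} (ha : IsUpperParameter a) :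
    ∃ j, (F a).2.2 = (b j).2 := by
  obtain ⟨i, c, hc, rfl⟩ := ha
  exact ⟨i, by rw [h.upper i c hc]⟩

theorem add_period (h : IsStraightened N b G F) (a : ℝ) : F (a + 4 * N) = F a := by
  obtain ⟨c, i, h0, h4, rfl⟩ := exists_eq_add_four_mul a
  have e : c + 4 * (i : ℝ) + 4 * N = c + 4 * ((i + N : ℤ) : ℝ) := by push_cast; ring
  rw [e]
  rcases le_total c 2 with h2 | h2
  · rw [h.upper _ c ⟨h0, h2⟩, h.upper _ c ⟨h0, h2⟩, h.base_periodic]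
  · rw [h.lower _ c ⟨h2, h4.le⟩, h.lower _ c ⟨h2, h4.le⟩, h.base_periodic]

/-- Between consecutive breakpoints, the curve is affine. -/
theorem lineMap_eq (h : IsStraightened N b G F) {S : Finset ℝ} (hS : IsGeneric b G S) {i : ℤ}
    {x y : ℝ} (h0 : 0 ≤ x) (hxy : x < y) (h4 : y ≤ 4)
    (hn : ∀ s ∈ insert 0 (insert 1 (insert 2 S)), s ≤ x ∨ y ≤ s) {τ : ℝ} (hτ0 : 0 ≤ τ)
    (hτ1 : τ ≤ 1) :
    F (AffineMap.lineMap (x + 4 * i) (y + 4 * i) τ) =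
      AffineMap.lineMap (F (x + 4 * i)) (F (y + 4 * i)) τ := by
  have h1 : (1 : ℝ) ≤ x ∨ y ≤ 1 := hn 1 (by simp)
  have h2 : (2 : ℝ) ≤ x ∨ y ≤ 2 := hn 2 (by simp)
  have h3 : (3 : ℝ) ≤ x ∨ y ≤ 3 := hn 3 (by simp [hS.three_mem])
  set c := x + τ * (y - x) with hc
  have hlm : AffineMap.lineMap (x + 4 * (i : ℝ)) (y + 4 * i) τ = c + 4 * i := by
    simp only [AffineMap.lineMap_apply, vsub_eq_sub, smul_eq_mul, vadd_eq_add]; ring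
  have hcx : x ≤ c := by nlinarith
  have hcy : c ≤ y := by nlinarith
  rw [hlm]
  rcases h2 with h2 | h2
  · obtain ⟨m, hm⟩ := hS.affine i x y h2 hxy h4 fun s hs => hn s (by simp [hs])
    have habs : ∃ ε η : ℝ, ∀ t ∈ Set.Icc x y, |t - 3| = ε * t + η := by
      rcases h3 with h3 | h3
      · exact ⟨1, -3, fun t ht => by rw [abs_of_nonneg (by linarith [ht.1])]; ring⟩
      · exact ⟨-1, 3, fun t ht => by rw [abs_of_nonpos (by linarith [ht.2])]; ring⟩
    obtain ⟨ε, η, habs⟩ := habs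
    rw [h.lower i c ⟨h2.trans hcx, hcy.trans h4⟩, h.lower i x ⟨h2, hxy.le.trans h4⟩,
      h.lower i y ⟨h2.trans hxy.le, h4⟩, hm c ⟨hcx, hcy⟩, hm y ⟨hxy.le, le_rfl⟩,
      habs c ⟨hcx, hcy⟩, habs x ⟨le_rfl, hxy.le⟩, habs y ⟨hxy.le, le_rfl⟩]
    refine Prod.ext ?_ (Prod.ext ?_ ?_)
    · simp [AffineMap.lineMap_apply]; rw [hc]; ring
    · simp [AffineMap.lineMap_apply]; rw [hc]; ring
    · simp [AffineMap.lineMap_apply]; rw [hc]; ring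
  · have habs : ∃ ε η : ℝ, ∀ t ∈ Set.Icc x y, |1 - t| = ε * t + η := by
      rcases h1 with h1 | h1
      · exact ⟨1, -1, fun t ht => by rw [abs_of_nonpos (by linarith [ht.1])]; ring⟩
      · exact ⟨-1, 1, fun t ht => by rw [abs_of_nonneg (by linarith [ht.2])]; ring⟩
    obtain ⟨ε, η, habs⟩ := habs
    rw [h.upper i c ⟨h0.trans hcx, hcy.trans h2⟩, h.upper i x ⟨h0, hxy.le.trans h2⟩,
      h.upper i y ⟨h0.trans hxy.le, h2⟩,
      habs c ⟨hcx, hcy⟩, habs x ⟨le_rfl, hxy.le⟩, habs y ⟨hxy.le, le_rfl⟩]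
    refine Prod.ext ?_ (Prod.ext ?_ ?_)
    · simp [AffineMap.lineMap_apply]; rw [hc]; ring
    · simp [AffineMap.lineMap_apply]; rw [hc]; ring
    · simp [AffineMap.lineMap_apply]

/-- At a breakpoint the projection is not shared by an upper and a lower arc, unless these arcs
meet over it. -/
theorem not_crossing_of_breakpoint (h : IsStraightened N b G F) {S : Finset ℝ}
    (hS : IsGeneric b G S) {s : ℝ} (hs : s ∈ insert 0 (insert 1 (insert 2 S))) (i : ℤ) {a a' : ℝ}
    (ha : IsUpperParameter a) (ha' : IsLowerParameter a')
    (hx : (F a).1 = (F (s + 4 * i)).1) (hz : (F a).2.2 = (F (s + 4 * i)).2.2)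
    (hx' : (F a').1 = (F (s + 4 * i)).1) (hz' : (F a').2.2 = (F (s + 4 * i)).2.2) :
    F a = F a' := by
  have hboth : IsUpperParameter (s + 4 * i) → IsLowerParameter (s + 4 * i) → F a = F a' :=
    fun hu hl => (h.eq_of_upper ha hu hx hz).trans (h.eq_of_lower ha' hl hx' hz').symm
  simp only [Finset.mem_insert] at hs
  rcases hs with rfl | rfl | rfl | hs
  · exact hboth ⟨i, 0, by norm_num, rfl⟩ ⟨i - 1, 4, by norm_num, by push_cast; ring⟩
  · exfalso
    obtain ⟨j, c, hc, rfl⟩ := ha'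
    rw [h.upper i 1 (by norm_num), h.lower j c hc] at hx' hz'
    simp only [sub_self, mul_zero] at hx' hz'
    have h1 := h.fst_eq_zero _ hx'
    have h2 : c = 3 := by
      rcases mul_eq_zero.1 h1 with h3 | h3
      · exact absurd h3 (h.base_pos j).ne'
      · linarith
    rw [h2] at hz'
    exact hS.ne 3 hS.three_mem j i hz'
  · exact hboth ⟨i, 2, by norm_num, rfl⟩ ⟨i, 2, by norm_num, rfl⟩
  · exfalso
    obtain ⟨j, hj⟩ := h.exists_snd_eq ha
    have hmem := hS.mem_Ioo s hs
    rw [hj, h.lower i s ⟨hmem.1.le, hmem.2.le⟩] at hz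
    exact hS.ne s hs i j hz.symm

/-- The lower arcs pass below finitely many points of the lines that contain the projections of
the upper arcs. -/
theorem finite_crossings (h : IsStraightened N b G F) (hN : 0 < N) {S : Finset ℝ}
    (hS : IsGeneric b G S) :
    {q : ℝ × ℝ | ∃ a, IsLowerParameter a ∧ ((F a).1, (F a).2.2) = q ∧ ∃ j, (b j).2 = q.2}.Finite := by
  have hfin : ∀ i j : Fin N, {c | c ∈ Set.Icc (2 : ℝ) 4 ∧
      (G ((b (i : ℕ)).1 * (c - 3), (b (i : ℕ)).2)).2 = (b (j : ℕ)).2}.Finite := fun i j => by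
    refine finite_of_affine_between (g := fun c => (G ((b (i : ℕ)).1 * (c - 3), (b (i : ℕ)).2)).2)
      ⟨3, hS.three_mem⟩ (fun s hs => ⟨(hS.mem_Ioo s hs).1.le, (hS.mem_Ioo s hs).2.le⟩)
      (fun x y hx hxy hy hn => ?_) fun s hs => hS.ne s hs i j
    obtain ⟨m, hm⟩ := hS.affine i x y hx hxy hy hn
    refine ⟨m.2, fun t ht => ?_⟩
    simp only [hm t ht, Prod.snd_add, Prod.smul_snd, smul_eq_mul]
    ring
  refine (Set.finite_iUnion fun i : Fin N => Set.finite_iUnion fun j : Fin N =>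
    (hfin i j).image fun c => G ((b (i : ℕ)).1 * (c - 3), (b (i : ℕ)).2)).subset ?_
  rintro q ⟨a, ⟨i, c, hc, rfl⟩, rfl, j, hj⟩
  obtain ⟨i', hi⟩ := exists_nat_lt_of_periodic hN h.base_periodic i
  obtain ⟨j', hj'⟩ := exists_nat_lt_of_periodic hN h.base_periodic j
  rw [h.lower i c hc] at hj ⊢
  rw [hi, hj'] at hj
  exact Set.mem_iUnion₂.2 ⟨i', j', c, ⟨hc, hj.symm⟩, by rw [hi]⟩

end IsStraightened

/-- The point of Euclidean space above the point `(x, -z)` of the plane at height `y`. -/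
noncomputable def turnedPoint (p : ℝ × ℝ × ℝ) : E3 := pointOfCoords (p.1, -p.2.2, p.2.1)

theorem turnedPoint_injective : Function.Injective turnedPoint := by
  intro p q hpq
  have h := congrArg coordsOfPoint hpq
  simp only [turnedPoint, coordsOfPoint_pointOfCoords, Prod.mk.injEq, neg_inj] at h
  exact Prod.ext h.1 (Prod.ext h.2.2 h.2.1)

theorem turnedPoint_two (p : ℝ × ℝ × ℝ) : turnedPoint p 2 = p.2.1 := by
  simp [turnedPoint, pointOfCoords]

theorem planeProj_turnedPoint_eq_iff {p q : ℝ × ℝ × ℝ} :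
    planeProj (turnedPoint p) = planeProj (turnedPoint q) ↔ p.1 = q.1 ∧ p.2.2 = q.2.2 := by
  constructor
  · intro h
    have h0 := congrArg (fun v : EuclideanSpace ℝ (Fin 2) => v 0) h
    have h1 := congrArg (fun v : EuclideanSpace ℝ (Fin 2) => v 1) h
    simp only [planeProj, turnedPoint, pointOfCoords] at h0 h1
    exact ⟨by simpa using h0, by simpa using h1⟩
  · rintro ⟨h0, h1⟩
    simp [planeProj, turnedPoint, pointOfCoords, h0, h1]

theorem turnedPoint_lineMap (p q : ℝ × ℝ × ℝ) (τ : ℝ) :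
    turnedPoint (AffineMap.lineMap p q τ) =
      AffineMap.lineMap (turnedPoint p) (turnedPoint q) τ := by
  ext i
  fin_cases i
  · simp [turnedPoint, pointOfCoords, AffineMap.lineMap_apply]
  · simp [turnedPoint, pointOfCoords, AffineMap.lineMap_apply]; ring
  · simp [turnedPoint, pointOfCoords, AffineMap.lineMap_apply]

/-- A polygonal knot that some compactly supported homeomorphism carries to a straightened closed
braid in general position, turned so that the direction of projection becomes vertical, has a
diagram with at most `N` overpasses. -/
theorem PolygonalKnot.exists_diagram_of_straightened (P : PolygonalKnot) {N : ℕ} (hN : 0 < N)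
    {α : ℝ ≃o ℝ} (hα : ∀ t, α (t + P.numEdges) = α t + 4 * N) {f : E3 → E3}
    (hf : IsCompactlySupportedBijection f) {b : ℤ → ℝ × ℝ} {G : ℝ × ℝ → ℝ × ℝ}
    {F : ℝ → ℝ × ℝ × ℝ} (h : IsStraightened N b G F) {S : Finset ℝ} (hS : IsGeneric b G S)
    (hF : ∀ a, f (P.curve (α.symm a)) = turnedPoint (F a)) :
    ∃ D : KnotDiagram, P.toKnot.Isotopic D.toPolygonalKnot.toKnot ∧ D.overpassNumber ≤ N := by
  obtain ⟨K, β, hK, hβ, hβper, hβS, hβedge⟩ := exists_periodic_enumeration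
    (insert 0 (insert 1 (insert 2 S))) (by
      intro s hs
      simp only [Finset.mem_insert] at hs
      rcases hs with rfl | rfl | rfl | hs
      · norm_num
      · norm_num
      · norm_num
      · exact ⟨by linarith [(hS.mem_Ioo s hs).1], (hS.mem_Ioo s hs).2⟩) (by simp)
  obtain ⟨B, hBper, hB⟩ := exists_orderIso_interpolating hβ hβper
  have hBperN : ∀ (M : ℕ) t, B (t + (M * K : ℕ)) = B t + 4 * M := by
    intro M t
    induction M with
    | zero => simp
    | succ M ih =>
      have := hBper (t + (M * K : ℕ))
      rw [ih] at this
      rw [show t + ((M + 1) * K : ℕ) = t + (M * K : ℕ) + K by push_cast; ring, this]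
      push_cast; ring
  have hBint : ∀ k : ℤ, B k = β k := fun k => by
    have := hB k k le_rfl (by linarith)
    simpa using this
  have hBsymm : ∀ a, B.symm (a + 4 * N) = B.symm a + (N * K : ℕ) := fun a => by
    rw [OrderIso.symm_apply_eq, hBperN, OrderIso.apply_symm_apply]
  have hαsymm : ∀ a, α.symm (a + 4 * N) = α.symm a + P.numEdges := fun a => by
    rw [OrderIso.symm_apply_eq, hα, OrderIso.apply_symm_apply]
  let v : ℤ → E3 := fun k => turnedPoint (F (β k))
  have hcurve : ∀ t, polygonalCurve v t = turnedPoint (F (B t)) := by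
    intro t
    have h0 := Int.floor_le t
    have h1 := (Int.lt_floor_add_one t).le
    obtain ⟨i, x, y, hx, hxy, hy, e1, e2, hn⟩ := hβedge ⌊t⌋
    rw [polygonalCurve_of_mem v ⌊t⌋ h0 h1, hB ⌊t⌋ t h0 h1]
    simp only [v, e1, e2]
    rw [h.lineMap_eq hS hx hxy hy hn (by linarith) (by linarith), turnedPoint_lineMap]
  have hinj : ∀ a a', F a = F a' → ∃ k : ℤ, a' = a + k * (4 * N) := by
    intro a a' haa
    have h1 := congrArg turnedPoint haa
    rw [← hF, ← hF] at h1
    obtain ⟨k, hk⟩ := P.embedded _ _ (hf.bijective.1 h1)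
    refine ⟨k, ?_⟩
    have hq : ∀ q : ℤ, α.symm (a + q * (4 * N)) = α.symm a + q * P.numEdges := by
      intro q
      induction q using Int.induction_on with
      | zero => simp
      | succ n ih =>
        have := hαsymm (a + (n : ℤ) * (4 * N))
        rw [ih] at this
        rw [show a + ((n + 1 : ℤ) : ℝ) * (4 * N) = a + (n : ℤ) * (4 * N) + 4 * N by
          push_cast; ring, this]
        push_cast; ring
      | pred n ih =>
        have := hαsymm (a + ((-n - 1 : ℤ) : ℝ) * (4 * N))
        rw [show a + ((-n - 1 : ℤ) : ℝ) * (4 * N) + 4 * N = a + ((-n : ℤ) : ℝ) * (4 * N) by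
          push_cast; ring, ih] at this
        push_cast at this ⊢; linarith
    exact α.symm.injective (by rw [hk, hq])
  have hNK : 0 < N * K := Nat.mul_pos hN hK
  let Q : PolygonalKnot :=
    { numEdges := N * K
      numEdges_pos := hNK
      vertex := v
      vertex_periodic := fun k => by
        have h1 := hBperN N k
        have h2 : β (k + (N * K : ℕ)) = β k + 4 * N := by
          rw [← hBint, ← hBint, ← h1]; push_cast; rfl
        simp only [v, h2, h.add_period]
      embedded := fun s t hst => by
        rw [hcurve, hcurve] at hst
        obtain ⟨k, hk⟩ := hinj _ _ (turnedPoint_injective hst)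
        refine ⟨k, B.injective ?_⟩
        rw [hk]
        have := add_mul_of_periodic (a := fun j : ℤ => B (s + j * (N * K : ℕ))) (k := 1)
          (T := 4 * N) (fun j => by
            have := hBperN N (s + j * (N * K : ℕ))
            rw [← this]; push_cast; ring_nf) 0 k
        simpa using this.symm }
  have hQ : ∀ t, Q.curve t = turnedPoint (F (B t)) := hcurve
  have hcar : ∀ p, p ∈ Q.carrier ↔ ∃ a, turnedPoint (F a) = p := by
    intro p
    constructor
    · rintro ⟨t, rfl⟩; exact ⟨B t, (hQ t).symm⟩
    · rintro ⟨a, rfl⟩; exact ⟨B.symm a, by rw [hQ, OrderIso.apply_symm_apply]⟩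
  -- every double point comes from an upper and a lower arc
  have hmult : ∀ q ∈ Q.multiplePoints, ∃ a a', IsUpperParameter a ∧ IsLowerParameter a' ∧
      F a ≠ F a' ∧ planeProj (turnedPoint (F a)) = q ∧ planeProj (turnedPoint (F a')) = q := by
    rintro q ⟨p, hp, p', hp', hne, e1, e2⟩
    obtain ⟨a, rfl⟩ := (hcar p).1 hp
    obtain ⟨a', rfl⟩ := (hcar p').1 hp'
    have hne' : F a ≠ F a' := fun he => hne (by rw [he])
    obtain ⟨hx, hz⟩ := planeProj_turnedPoint_eq_iff.1 (e1.trans e2.symm)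
    rcases h.upper_lower_of_ne hne' hx hz with ⟨h1, h2⟩ | ⟨h1, h2⟩
    · exact ⟨a, a', h1, h2, hne', e1, e2⟩
    · exact ⟨a', a, h2, h1, hne'.symm, e2, e1⟩
  have hreg : Q.HasRegularProjection := by
    refine ⟨?_, fun q hq => ?_, fun k hk => ?_⟩
    · refine ((h.finite_crossings hN hS).image
        fun q : ℝ × ℝ => planeProj (turnedPoint (q.1, 0, q.2))).subset fun q hq => ?_
      obtain ⟨a, a', h1, h2, -, e1, e2⟩ := hmult q hq
      obtain ⟨-, hz⟩ := planeProj_turnedPoint_eq_iff.1 (e1.trans e2.symm)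
      obtain ⟨j, hj⟩ := h.exists_snd_eq h1
      refine ⟨((F a').1, (F a').2.2), ⟨a', h2, rfl, j, by rw [← hj, hz]⟩, ?_⟩
      rw [← e2]
      exact planeProj_turnedPoint_eq_iff.2 ⟨rfl, rfl⟩
    · obtain ⟨a, a', h1, h2, hne, e1, e2⟩ := hmult q hq
      have : {p | p ∈ Q.carrier ∧ planeProj p = q} = {turnedPoint (F a), turnedPoint (F a')} := by
        ext p
        constructor
        · rintro ⟨hp, hpq⟩
          obtain ⟨a'', rfl⟩ := (hcar p).1 hp
          rcases isUpperParameter_or_isLowerParameter a'' with h3 | h3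
          · obtain ⟨hx, hz⟩ := planeProj_turnedPoint_eq_iff.1 (hpq.trans e1.symm)
            exact Or.inl (by rw [h.eq_of_upper h3 h1 hx hz])
          · obtain ⟨hx, hz⟩ := planeProj_turnedPoint_eq_iff.1 (hpq.trans e2.symm)
            exact Or.inr (by rw [h.eq_of_lower h3 h2 hx hz]; rfl)
        · rintro (rfl | rfl)
          · exact ⟨(hcar _).2 ⟨a, rfl⟩, e1⟩
          · exact ⟨(hcar _).2 ⟨a', rfl⟩, e2⟩
      rw [this]
      exact Set.encard_pair (turnedPoint_injective.ne hne)
    · obtain ⟨a, a', h1, h2, hne, e1, e2⟩ := hmult _ hk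
      obtain ⟨s, hs, i, hsi⟩ := hβS k
      change _ = planeProj (turnedPoint (F (β k))) at e1 e2
      rw [hsi] at e1 e2
      obtain ⟨hx, hz⟩ := planeProj_turnedPoint_eq_iff.1 e1
      obtain ⟨hx', hz'⟩ := planeProj_turnedPoint_eq_iff.1 e2
      exact hne (h.not_crossing_of_breakpoint hS hs i h1 h2 hx hz hx' hz')
  let D : KnotDiagram := ⟨Q, hreg⟩
  have hDcurve : ∀ t, D.curve t = turnedPoint (F (B t)) := hcurve
  refine ⟨D, ?_, ?_⟩
  · have hm : (0 : ℝ) < P.numEdges := by exact_mod_cast P.numEdges_pos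
    have hk : (0 : ℝ) < (N * K : ℕ) := by exact_mod_cast hNK
    refine Knot.Isotopic.of_bijection hf
      (fun t => B.symm (α (t * P.numEdges)) / (N * K : ℕ)) ?_ ?_ ?_ ?_
    · exact (B.symm.continuous.comp (α.continuous.comp (continuous_mul_const _))).div_const _
    · intro s t hst
      refine div_lt_div_of_pos_right ?_ hk
      exact B.symm.strictMono (α.strictMono (mul_lt_mul_of_pos_right hst hm))
    · intro t
      simp only [add_mul, one_mul, hα, hBsymm, add_div, div_self hk.ne']
    · intro t
      change OnePoint.map f ((P.curve (t * P.numEdges) : E3) : S3) =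
        ((Q.curve (B.symm (α (t * P.numEdges)) / (N * K : ℕ) * (N * K : ℕ)) : E3) : S3)
      rw [div_mul_cancel₀ _ hk.ne', hQ, OrderIso.apply_symm_apply, ← hF, OrderIso.symm_apply_apply]
      rfl
  · have hDcar : ∀ p, p ∈ D.carrier ↔ ∃ a, turnedPoint (F a) = p := hcar
    refine D.overpassNumber_le_of_isAlternatingDivision hN (s := fun i => B.symm (4 * i))
      (f := fun i => B.symm (4 * i + 2)) ⟨fun i => ⟨?_, ?_⟩, fun i => ⟨?_, ?_⟩, ?_, ?_⟩
    · exact B.symm.strictMono (by linarith)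
    · exact B.symm.strictMono (by push_cast; linarith)
    · change _ = B.symm (4 * i) + ((N * K : ℕ) : ℝ)
      rw [← hBsymm]; push_cast; ring_nf
    · change _ = B.symm (4 * i + 2) + ((N * K : ℕ) : ℝ)
      rw [← hBsymm]; push_cast; ring_nf
    · rintro i t ⟨ht1, ht2⟩ ⟨p, hp, hpp, hlt⟩
      have hU : IsUpperParameter (B t) := by
        have h1 := (B.symm_apply_le).1 ht1
        have h2 := (B.le_symm_apply).1 ht2
        exact ⟨i, B t - 4 * i, ⟨by linarith, by linarith⟩, by ring⟩
      obtain ⟨a, rfl⟩ := (hDcar p).1 hp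
      rw [hDcurve] at hpp hlt
      rw [turnedPoint_two, turnedPoint_two] at hlt
      obtain ⟨hx, hz⟩ := planeProj_turnedPoint_eq_iff.1 hpp
      rcases isUpperParameter_or_isLowerParameter a with ha | ha
      · rw [h.eq_of_upper ha hU hx hz] at hlt; exact hlt.false
      · linarith [h.depth_nonneg hU, h.depth_nonpos ha]
    · rintro i t ⟨ht1, ht2⟩ ⟨p, hp, hpp, hlt⟩
      have hL : IsLowerParameter (B t) := by
        have h1 := (B.symm_apply_le).1 ht1
        have h2 := (B.le_symm_apply).1 ht2
        push_cast at h2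
        exact ⟨i, B t - 4 * i, ⟨by linarith, by linarith⟩, by ring⟩
      obtain ⟨a, rfl⟩ := (hDcar p).1 hp
      rw [hDcurve] at hpp hlt
      rw [turnedPoint_two, turnedPoint_two] at hlt
      obtain ⟨hx, hz⟩ := planeProj_turnedPoint_eq_iff.1 hpp
      rcases isUpperParameter_or_isLowerParameter a with ha | ha
      · linarith [h.depth_nonpos hL, h.depth_nonneg ha]
      · rw [h.eq_of_lower ha hL hx hz] at hlt; exact hlt.false

/-! ### Bridge number and braid index -/

theorem PolygonalKnot.IsClosedBraid.exists_diagram {P : PolygonalKnot} {n : ℕ}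
    (hP : P.IsClosedBraid n) :
    ∃ D : KnotDiagram, P.toKnot.Isotopic D.toPolygonalKnot.toKnot ∧ D.overpassNumber ≤ n := by
  obtain ⟨N, α, hN, hNn, hα, hdir⟩ := hP.exists_orderIso
  have hPc : Continuous P.curve := continuous_polygonalCurve P.vertex
  have hαsymm : ∀ a, α.symm (a + 4 * N) = α.symm a + P.numEdges := fun a => by
    rw [OrderIso.symm_apply_eq, hα, OrderIso.apply_symm_apply]
  let C : ℝ → E3 := fun a => P.curve (α.symm a)
  have hC : Continuous C := hPc.comp α.symm.continuous
  have hCper : ∀ a, C (a + 4 * N) = C a := fun a => by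
    simp only [C, hαsymm, P.curve_add_numEdges]
  let p : ℝ → ℝ × ℝ := fun a => (|C a 0| + |C a 1|, C a 2)
  have hp : Continuous p := by fun_prop
  have hpolar : ∀ a, 0 < (p a).1 ∧ C a 0 = (p a).1 * diamond a 0 ∧
      C a 1 = (p a).1 * diamond a 1 := by
    intro a
    obtain ⟨ρ, hρ, e0, e1⟩ := hdir (α.symm a)
    rw [α.apply_symm_apply] at e0 e1
    have hpρ : (p a).1 = ρ := by
      change |C a 0| + |C a 1| = ρ
      simp only [C, e0, e1]
      rw [abs_mul, abs_mul, abs_of_pos hρ, ← mul_add, abs_diamond_add_abs_diamond, mul_one]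
    rw [hpρ]
    exact ⟨hρ, e0, e1⟩
  have hcoords : ∀ a, coordsOfPoint (C a) =
      ((p a).1 * diamond a 0, (p a).1 * diamond a 1, (p a).2) := fun a => by
    rw [← (hpolar a).2.1, ← (hpolar a).2.2]; rfl
  have hinj : ∀ (a : ℝ) (i j : ℤ), p (a + 4 * i) = p (a + 4 * j) → (N : ℤ) ∣ i - j := by
    intro a i j hij
    have h1 : coordsOfPoint (C (a + 4 * i)) = coordsOfPoint (C (a + 4 * j)) := by
      rw [hcoords, hcoords, hij, diamond_add_four_mul, diamond_add_four_mul]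
    have h2 : C (a + 4 * i) = C (a + 4 * j) := by
      rw [← pointOfCoords_coordsOfPoint (C (a + 4 * i)), h1, pointOfCoords_coordsOfPoint]
    obtain ⟨k, hk⟩ := P.embedded _ _ h2
    have h3 := add_mul_of_periodic (a := fun q : ℤ => α (α.symm (a + 4 * i) + q * P.numEdges))
      (k := 1) (T := 4 * N) (fun q => by
        rw [← hα]; push_cast; ring_nf) 0 k
    simp only [zero_add, mul_one, Int.cast_zero, zero_mul, add_zero] at h3
    rw [← hk, α.apply_symm_apply, α.apply_symm_apply] at h3
    have h4 : (j : ℝ) = i + k * N := by linarith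
    have h5 : j = i + k * N := by exact_mod_cast h4
    exact ⟨-k, by rw [h5]; ring⟩
  obtain ⟨Θ, b, G, hΘ, hstr⟩ := exists_straightening hN hp
    (fun a => by simp only [p, hCper]) (fun a => (hpolar a).1) hinj
  obtain ⟨τ, G', S, hτ, hstr', hgen⟩ := hstr.exists_generic hN
  set F : ℝ → ℝ × ℝ × ℝ := fun a =>
    τ (Θ ((p a).1 * diamond a 0, (p a).1 * diamond a 1, (p a).2))
  have hFC : ∀ a, F a = τ (Θ (coordsOfPoint (C a))) := fun a => by rw [hcoords]
  have hFc : Continuous F := by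
    have : F = fun a => τ (Θ (coordsOfPoint (C a))) := funext hFC
    rw [this]
    exact hτ.continuous.comp (hΘ.continuous.comp (continuous_coordsOfPoint.comp hC))
  obtain ⟨B, hB⟩ : ∃ B : ℝ, ∀ a, (F a).1 ^ 2 + (F a).2.1 ^ 2 + (F a).2.2 ^ 2 ≤ B - 1 := by
    have hN4 : (0 : ℝ) < 4 * N := by
      have : (0 : ℝ) < N := by exact_mod_cast hN
      linarith
    have hc : Continuous fun a => (F a).1 ^ 2 + (F a).2.1 ^ 2 + (F a).2.2 ^ 2 := by fun_prop
    obtain ⟨B, hB⟩ := (isCompact_Icc (a := (0 : ℝ)) (b := 4 * N)).exists_bound_of_continuousOn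
      hc.continuousOn
    refine ⟨B + 1, fun a => ?_⟩
    obtain ⟨a', ha', e⟩ := Function.Periodic.exists_mem_Ico₀ (f := F) hstr'.add_period hN4 a
    rw [e, add_sub_cancel_right]
    exact (le_abs_self _).trans (hB a' (Set.Ico_subset_Icc_self ha'))
  obtain ⟨D, hD, hDN⟩ := P.exists_diagram_of_straightened hN hα
    ((isCompactlySupportedBijection_cutoffRotation B).comp (hτ.comp hΘ)).conj_coords hstr' hgen
    (fun a => by
      change pointOfCoords (cutoffRotation B (τ (Θ (coordsOfPoint (C a))))) = _
      rw [← hFC]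
      exact congrArg pointOfCoords (cutoffRotation_of_le (hB a)))
  exact ⟨D, hD, hDN.trans (by exact_mod_cast hNn)⟩

theorem theorem3p6 (K : Knot) (hK : K.IsTame) (hnt : ¬ K.IsTrivial) :
    K.overpassNumber ≤ K.braidIndex := by
  refine le_iInf₂ fun n hn => ?_
  obtain ⟨P, hKP, hP⟩ := hn
  obtain ⟨D, hPD, hD⟩ := hP.exists_diagram
  exact (iInf₂_le D (hKP.trans hPD)).trans hD
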